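/- **Setting.** Let $A_0=\mathbb{C}1\hookrightarrow A_1\hookrightarrow A_2\hookrightarrow\cdots$ be a sequence of atomic $W^*$-algebras with separable preduals and unital normal injective $*$-homomorphisms, and let $A=\varinjlim A_n$ be its inductive limit $C^*$-algebra. Let $\mathfrak{Z}_n$ be the set of minimal projections of the center of $A_n$ and assume that $zA_n=B(\mathcal{H}_z)$ with $\dim(z):=\dim\mathcal{H}_z<\infty$ for all $z\in\mathfrak{Z}_n$, $n\ge 0$. Let $\alpha:\mathbb{R}\curvearrowright A$ be a flow with $\alpha^t(A_n)=A_n$ for all $t,n$, whose restriction $\alpha_n^t$ to each $A_n$ is continuous in the $u$-topology. Let $\rho_z\in zA_n$ ($z\in\mathfrak{Z}_n$, $n\ge0$) be positive invertible with $\alpha_n^t=\mathrm{Ad}\,\rho_z^{it}$ on $zA_n$, with $\rho_1=1$ for the unit $1\in\mathfrak{Z}_0$ (for instance normalized by $\mathrm{Tr}(\rho_z)=\mathrm{Tr}(\rho_z^{-1})$). Let $\Gamma\subset(0,\infty)$ be the multiplicative group generated by all eigenvalues of all $\rho_z$, and let $p_z(\gamma)$ be the spectral projection of $\rho_z$ for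 $\gamma$. Let $\beta\in\mathbb{R}$ and $\dim_\beta(z):=\mathrm{Tr}(\rho_z^{-\beta})$. Put $\widetilde{\mathfrak{Z}}_n:=\mathfrak{Z}_n\times\Gamma$ and, for $(z,\gamma)\in\widetilde{\mathfrak{Z}}_{n+1}$, $(z',\gamma')\in\widetilde{\mathfrak{Z}}_n$, $$\tilde\mu((z,\gamma),(z',\gamma')):=\frac{\mathrm{Tr}\big(q_{(z,z')}(\gamma^{-1}\gamma')\big)}{\dim(z)},\qquad q_{(z,z')}(\gamma):=\sum_{\gamma''\in\Gamma}p_z(\gamma\gamma'')\,p_{z'}(\gamma'')\in zA_{n+1}.$$ Let $D_n$ be the additive group of bounded functions $f$ on $\widetilde{\mathfrak{Z}}_n$ with $f(z,\gamma)\in\frac{1}{\dim(z)}\mathbb{Z}$ for all $(z,\gamma)$, and $D_n^+\subset D_n$ the pointwise nonnegative functions. Multiplication by the matrix $\tilde\mu$ maps $D_n$ into $D_{n+1}$ and $D_n^+$ into $D_{n+1}^+$; let $(\mathfrak{D}\supset\mathfrak{D}_+)$ be the inductive limit of $(D_n\supset D_n^+)$ along these maps, with canonical maps $\iota_n^{**}:D_n\to\mathfrak{D}$.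 The group $\Gamma$ acts on $\mathfrak{D}$ by $\gamma\cdot\iota_n^{**}(f)=\iota_n^{**}(f\circ T_\gamma^{-1})$, where $T_\gamma(z,\gamma')=(z,\gamma\gamma')$. Let $K_\beta^{\mathrm{ln}}(\alpha^t)$ be the convex set of $(\alpha^t,\beta)$-KMS states on $A$ whose restrictions to all $A_n$ are normal. Let $\mathcal{W}_\beta^{\mathrm{ln}}(\tilde\mu)$ be the convex set of additive maps $\psi:\mathfrak{D}_+\to[0,\infty]$ such that - (i) $\psi(\gamma\cdot x)=\gamma^\beta\psi(x)$ for all $\gamma\in\Gamma$, $x\in\mathfrak{D}_+$; - (ii) for each $n$, if $f_k\nearrow f$ pointwise in $D_n^+$, then $\psi(\iota_n^{**}(f_k))\nearrow\psi(\iota_n^{**}(f))$ as $k\to\infty$; - (iii) $\psi(\iota_0^{**}(\delta_{(1,1)}))=1$. **Theorem 5.5.** For each $\omega\in K_\beta^{\mathrm{ln}}(\alpha^t)$ there is a unique $\psi_\omega\in\mathcal{W}_\beta^{\mathrm{ln}}(\tilde\mu)$ with $$\psi_\omega(\iota_n^{**}(\delta_{(z,\gamma)}))=\frac{\dim(z)}{\dim_\beta(z)}\,\omega(z)\,\gamma^\beta,\qquad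 (z,\gamma)\in\widetilde{\mathfrak{Z}}_n,\ n=0,1,\dots,$$ and $\omega\mapsto\psi_\omega$ is an affine isomorphism of $K_\beta^{\mathrm{ln}}(\alpha^t)$ onto $\mathcal{W}_\beta^{\mathrm{ln}}(\tilde\mu)$. Its inverse assigns to $\psi\in\mathcal{W}_\beta^{\mathrm{ln}}(\tilde\mu)$ the unique $\omega_\psi\in K_\beta^{\mathrm{ln}}(\alpha^t)$ with $$\omega_\psi(a)=\sum_{z\in\mathfrak{Z}_n}\psi(\iota_n^{**}(\delta_{(z,1)}))\,\frac{\mathrm{Tr}(\rho_z^{-\beta}za)}{\dim(z)},\qquad a\in A_n,\ n=0,1,\dots;$$ in particular every element of $K_\beta^{\mathrm{ln}}(\alpha^t)$ arises in this way. -/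

import Mathlib

open Filter Topology
open scoped ENNReal NNReal ComplexOrder Matrix.Norms.L2Operator

universe u v

noncomputable section

namespace LimitFlow

/-! ### Order, normality and positivity in `*`-algebras -/

section Order

variable {M N : Type*} [Ring M] [StarRing M] [Ring N] [StarRing N]

/-- The order `a ≤ b` of a C*-algebra: `b - a` is of the form `c* c`. -/
def StarLE (a b : M) : Prop := ∃ c : M, b - a = star c * c

/-- `a` is the least upper bound of `D` for the order of the algebra. -/
def IsStarLUB (D : Set M) (a : M) : Prop :=
  (∀ x ∈ D, StarLE x a) ∧ ∀ b, (∀ x ∈ D, StarLE x b) → StarLE a b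

/-- Normality: suprema of (bounded) upward directed families of self-adjoint elements are
preserved. -/
def IsNormalMap (φ : M → N) : Prop :=
  ∀ (D : Set M) (a : M), D.Nonempty → (∀ x ∈ D, IsSelfAdjoint x) → DirectedOn StarLE D →
    IsStarLUB D a → IsStarLUB (φ '' D) (φ a)

/-- Positive linear functionals (in `ℂ`, `StarLE 0 w` says that `w` is real and `≥ 0`). -/
def IsPositiveFunctional [Algebra ℂ M] (φ : M →ₗ[ℂ] ℂ) : Prop :=
  ∀ a, StarLE 0 (φ (star a * a))

/-- States: positive linear functionals that are `1` at the unit. -/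
def IsState [Algebra ℂ M] (φ : M →ₗ[ℂ] ℂ) : Prop :=
  IsPositiveFunctional φ ∧ φ 1 = 1

end Order

/-! ### Functional calculus of Hermitian matrices -/

section Spectral

variable {ι : Type*} [Fintype ι] [DecidableEq ι] {R : Matrix ι ι ℂ}

/-- `f(R)` for a Hermitian matrix `R` and a function `f` on the real line: with a unitary `U`
such that `R = U diag(r₁, …, r_d) U*`, this is `U diag(f(r₁), …, f(r_d)) U*`. -/
def funCalc (hR : R.IsHermitian) (f : ℝ → ℂ) : Matrix ι ι ℂ :=
  (hR.eigenvectorUnitary : Matrix ι ι ℂ) * Matrix.diagonal (fun i => f (hR.eigenvalues i)) *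
    star (hR.eigenvectorUnitary : Matrix ι ι ℂ)

/-- The spectral projection of `R` for the value `r` (zero if `r` is not an eigenvalue). -/
def eigProj (hR : R.IsHermitian) (r : ℝ) : Matrix ι ι ℂ :=
  funCalc hR fun x => if x = r then 1 else 0

/-- The imaginary power `R^{it}`. -/
def imPow (hR : R.IsHermitian) (t : ℝ) : Matrix ι ι ℂ :=
  funCalc hR fun x => (x : ℂ) ^ ((t : ℂ) * Complex.I)

/-- The real power `R^s`. -/
def realPow (hR : R.IsHermitian) (s : ℝ) : Matrix ι ι ℂ :=
  funCalc hR fun x => ((x ^ s : ℝ) : ℂ)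

theorem funCalc_mul (hR : R.IsHermitian) (f g : ℝ → ℂ) :
    funCalc hR f * funCalc hR g = funCalc hR fun x => f x * g x := by
  have h : star (hR.eigenvectorUnitary : Matrix ι ι ℂ) * (hR.eigenvectorUnitary : Matrix ι ι ℂ) = 1 :=
    Unitary.coe_star_mul_self _
  unfold funCalc
  rw [← Matrix.diagonal_mul_diagonal]
  simp only [Matrix.mul_assoc]
  rw [← Matrix.mul_assoc (star (hR.eigenvectorUnitary : Matrix ι ι ℂ))
    (hR.eigenvectorUnitary : Matrix ι ι ℂ), h, Matrix.one_mul]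

theorem funCalc_congr (hR : R.IsHermitian) {f g : ℝ → ℂ}
    (h : ∀ i, f (hR.eigenvalues i) = g (hR.eigenvalues i)) : funCalc hR f = funCalc hR g := by
  unfold funCalc
  simp only [h]

theorem funCalc_one (hR : R.IsHermitian) : funCalc hR (fun _ => 1) = 1 := by
  unfold funCalc
  rw [Matrix.diagonal_one, Matrix.mul_one]
  exact Unitary.coe_mul_star_self _

theorem funCalc_smul (hR : R.IsHermitian) (c : ℂ) (f : ℝ → ℂ) :
    funCalc hR (fun x => c * f x) = c • funCalc hR f := by
  unfold funCalc
  have : Matrix.diagonal (fun i => c * f (hR.eigenvalues i))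
      = c • Matrix.diagonal (fun i => f (hR.eigenvalues i)) := by
    ext i j; by_cases h : i = j <;> simp [Matrix.diagonal, h]
  rw [this, Matrix.mul_smul, Matrix.smul_mul]

theorem funCalc_sum (hR : R.IsHermitian) {κ : Type*} (E : Finset κ) (f : κ → ℝ → ℂ) :
    funCalc hR (fun x => ∑ k ∈ E, f k x) = ∑ k ∈ E, funCalc hR (f k) := by
  unfold funCalc
  rw [← Finset.sum_mul, ← Finset.mul_sum]
  congr 2
  ext i j
  rw [Matrix.sum_apply]
  by_cases h : i = j <;> simp [Matrix.diagonal, h]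

theorem eigProj_mul_self (hR : R.IsHermitian) (r : ℝ) :
    eigProj hR r * eigProj hR r = eigProj hR r := by
  unfold eigProj
  rw [funCalc_mul]
  exact funCalc_congr _ fun i => by simp

theorem funCalc_zero (hR : R.IsHermitian) : funCalc hR (fun _ => 0) = 0 := by
  simp [funCalc]

theorem eigProj_mul_of_ne (hR : R.IsHermitian) {r s : ℝ} (h : r ≠ s) :
    eigProj hR r * eigProj hR s = 0 := by
  unfold eigProj
  rw [funCalc_mul, ← funCalc_zero hR]
  refine funCalc_congr _ fun i => ?_
  by_cases h1 : hR.eigenvalues i = r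
  · simp [h1, h]
  · simp [h1]

theorem funCalc_mul_eigProj (hR : R.IsHermitian) (f : ℝ → ℂ) (r : ℝ) :
    funCalc hR f * eigProj hR r = f r • eigProj hR r := by
  unfold eigProj
  rw [funCalc_mul, ← funCalc_smul]
  refine funCalc_congr _ fun i => ?_
  by_cases h1 : hR.eigenvalues i = r <;> simp [h1]

theorem eigProj_mul_funCalc (hR : R.IsHermitian) (f : ℝ → ℂ) (r : ℝ) :
    eigProj hR r * funCalc hR f = f r • eigProj hR r := by
  rw [← funCalc_mul_eigProj]
  unfold eigProj
  rw [funCalc_mul, funCalc_mul]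
  exact funCalc_congr _ fun i => mul_comm _ _

theorem exists_trace_eq_natCast {e : Matrix ι ι ℂ} (he : e * e = e) :
    ∃ k : ℕ, k ≤ Fintype.card ι ∧ e.trace = k := by
  have h : IsIdempotentElem (Matrix.toLin' e) := by
    unfold IsIdempotentElem
    rw [Module.End.mul_eq_comp, ← Matrix.toLin'_mul, he]
  refine ⟨Module.finrank ℂ (LinearMap.range (Matrix.toLin' e)), ?_, ?_⟩
  · simpa using Submodule.finrank_le (LinearMap.range (Matrix.toLin' e))
  · rw [← Matrix.trace_toLin'_eq]
    exact (LinearMap.IsIdempotentElem.isProj_range _ h).trace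

end Spectral


section Cross

variable {ι κ : Type*} [Fintype ι] [DecidableEq ι] [Fintype κ] [DecidableEq κ]
variable {R : Matrix ι ι ℂ} {R' : Matrix κ κ ℂ} {Γ : Subgroup {x : ℝ // 0 < x}}

/-- All eigenvalues of `R` lie in the group `Γ` of positive reals. -/
def EigIn (hR : R.IsHermitian) (Γ : Subgroup {x : ℝ // 0 < x}) : Prop :=
  ∀ i, ∃ a : Γ, ((a : {x : ℝ // 0 < x}) : ℝ) = hR.eigenvalues i

/-- For a multiplicative linear map `ψ` between matrix algebras, the element
`q(γ) = ∑ a, p_R(γ a) ψ(p_{R'}(a))`, the sum being over `a ∈ Γ`. -/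
def crossProj (hR : R.IsHermitian) (hR' : R'.IsHermitian) (Γ : Subgroup {x : ℝ // 0 < x})
    (ψ : Matrix κ κ ℂ →ₙₐ[ℂ] Matrix ι ι ℂ) (γ : Γ) : Matrix ι ι ℂ :=
  ∑ᶠ a : Γ, eigProj hR ((γ * a : Γ) : {x : ℝ // 0 < x}) *
    ψ (eigProj hR' (a : {x : ℝ // 0 < x}))

theorem EigIn.exists_finset {hR : R.IsHermitian} (h : EigIn hR Γ) :
    ∃ E : Finset Γ, (∀ a ∉ E, eigProj hR (a : {x : ℝ // 0 < x}) = 0) ∧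
      ∑ a ∈ E, eigProj hR (a : {x : ℝ // 0 < x}) = 1 := by
  classical
  choose e he using h
  refine ⟨Finset.univ.image e, fun a ha => ?_, ?_⟩
  · rw [← funCalc_zero hR]
    refine funCalc_congr _ fun i => ?_
    rw [if_neg]
    intro hi
    apply ha
    rw [Finset.mem_image]
    exact ⟨i, Finset.mem_univ _, Subtype.ext (Subtype.ext (by rw [he, hi]))⟩
  · unfold eigProj
    rw [← funCalc_sum, ← funCalc_one hR]
    refine funCalc_congr _ fun i => ?_
    rw [Finset.sum_eq_single (e i)]
    · rw [if_pos (he i).symm]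
    · intro b _ hb
      rw [if_neg]
      intro hi
      exact hb (Subtype.ext (Subtype.ext (by rw [he, hi])))
    · intro hi
      exact absurd (Finset.mem_image_of_mem e (Finset.mem_univ i)) hi

theorem eigProj_mul_eigProj_of_ne (hR : R.IsHermitian) {a b : Γ} (h : a ≠ b) :
    eigProj hR (a : {x : ℝ // 0 < x}) * eigProj hR (b : {x : ℝ // 0 < x}) = 0 :=
  eigProj_mul_of_ne hR fun h' => h (Subtype.ext (Subtype.ext h'))

theorem eq_of_forall_cpow {a b : ℝ} (ha : 0 < a) (hb : 0 < b)
    (h : ∀ t : ℝ, (a : ℂ) ^ ((t : ℂ) * Complex.I) = (b : ℂ) ^ ((t : ℂ) * Complex.I)) : a = b := by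
  by_contra hab
  have hθ : Real.log a - Real.log b ≠ 0 := fun h0 =>
    hab (Real.log_injOn_pos ha hb (sub_eq_zero.1 h0))
  have h1 := h (Real.pi / (Real.log a - Real.log b))
  rw [Complex.cpow_def_of_ne_zero (by exact_mod_cast ha.ne'),
    Complex.cpow_def_of_ne_zero (by exact_mod_cast hb.ne'), ← Complex.ofReal_log ha.le,
    ← Complex.ofReal_log hb.le, Complex.exp_eq_exp_iff_exp_sub_eq_one] at h1
  have h2 : (Real.log a : ℂ) * (((Real.pi / (Real.log a - Real.log b) : ℝ) : ℂ) * Complex.I) -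
      (Real.log b : ℂ) * (((Real.pi / (Real.log a - Real.log b) : ℝ) : ℂ) * Complex.I)
      = (Real.pi : ℂ) * Complex.I := by
    have : (Real.log a : ℂ) - Real.log b ≠ 0 := by exact_mod_cast hθ
    push_cast
    field_simp
  rw [h2, Complex.exp_pi_mul_I] at h1
  norm_num at h1

variable (hR : R.IsHermitian) (hR' : R'.IsHermitian)
variable {ψ : Matrix κ κ ℂ →ₙₐ[ℂ] Matrix ι ι ℂ}

theorem cross_eq_zero
    (hψ : ∀ (t : ℝ) x, imPow hR t * ψ x * imPow hR (-t) = ψ (imPow hR' t * x * imPow hR' (-t)))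
    (l m a b : Γ) (hne : l * b ≠ a * m) (x : Matrix κ κ ℂ) :
    eigProj hR (l : {x : ℝ // 0 < x}) *
      ψ (eigProj hR' (a : {x : ℝ // 0 < x}) * x * eigProj hR' (b : {x : ℝ // 0 < x})) *
      eigProj hR (m : {x : ℝ // 0 < x}) = 0 := by
  set Pl := eigProj hR (l : {x : ℝ // 0 < x})
  set Pm := eigProj hR (m : {x : ℝ // 0 < x})
  set pa := eigProj hR' (a : {x : ℝ // 0 < x})
  set pb := eigProj hR' (b : {x : ℝ // 0 < x})
  let pw : Γ → ℝ → ℂ := fun g t => (((g : {x : ℝ // 0 < x}) : ℝ) : ℂ) ^ ((t : ℂ) * Complex.I)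
  by_contra hZ
  apply hne
  have key : ∀ t : ℝ, pw l t * pw m (-t) = pw a t * pw b (-t) := by
    intro t
    have h1 : Pl * (imPow hR t * ψ (pa * x * pb) * imPow hR (-t)) * Pm
        = (pw l t * pw m (-t)) • (Pl * ψ (pa * x * pb) * Pm) := by
      have e1 : Pl * imPow hR t = pw l t • Pl := eigProj_mul_funCalc _ _ _
      have e2 : imPow hR (-t) * Pm = pw m (-t) • Pm := funCalc_mul_eigProj _ _ _
      calc _ = (Pl * imPow hR t) * ψ (pa * x * pb) * (imPow hR (-t) * Pm) := by
            simp only [Matrix.mul_assoc]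
        _ = _ := by
            rw [e1, e2]
            simp only [Matrix.smul_mul, Matrix.mul_smul, smul_smul]
            rw [mul_comm]
    have h2 : imPow hR' t * (pa * x * pb) * imPow hR' (-t)
        = (pw a t * pw b (-t)) • (pa * x * pb) := by
      have e1 : imPow hR' t * pa = pw a t • pa := funCalc_mul_eigProj _ _ _
      have e2 : pb * imPow hR' (-t) = pw b (-t) • pb := eigProj_mul_funCalc _ _ _
      calc _ = (imPow hR' t * pa) * x * (pb * imPow hR' (-t)) := by
            simp only [Matrix.mul_assoc]
        _ = _ := by
            rw [e1, e2]
            simp only [Matrix.smul_mul, Matrix.mul_smul, smul_smul]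
            rw [mul_comm]
    rw [hψ, h2, map_smul, Matrix.mul_smul, Matrix.smul_mul] at h1
    have h3 := sub_eq_zero.2 h1
    rw [← sub_smul, smul_eq_zero] at h3
    rcases h3 with h3 | h3
    · exact (sub_eq_zero.1 h3).symm
    · exact absurd h3 hZ
  have pos : ∀ g : Γ, 0 < ((g : {x : ℝ // 0 < x}) : ℝ) := fun g => g.1.2
  refine Subtype.ext (Subtype.ext ?_)
  change ((l : {x : ℝ // 0 < x}) : ℝ) * ((b : {x : ℝ // 0 < x}) : ℝ)
    = ((a : {x : ℝ // 0 < x}) : ℝ) * ((m : {x : ℝ // 0 < x}) : ℝ)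
  refine eq_of_forall_cpow (mul_pos (pos _) (pos _)) (mul_pos (pos _) (pos _)) fun t => ?_
  rw [Complex.ofReal_mul, Complex.ofReal_mul, Complex.mul_cpow_ofReal_nonneg (pos _).le (pos _).le,
    Complex.mul_cpow_ofReal_nonneg (pos _).le (pos _).le]
  have inv : ∀ g : Γ, pw g (-t) * pw g t = 1 := by
    intro g
    simp only [pw]
    rw [← Complex.cpow_add _ _ (by exact_mod_cast (pos g).ne')]
    simp
  have hk := key t
  change pw l t * pw b t = pw a t * pw m t
  calc pw l t * pw b t = (pw l t * pw m (-t)) * (pw b t * pw m t) := by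
        linear_combination (-(pw l t * pw b t)) * inv m
    _ = (pw a t * pw b (-t)) * (pw b t * pw m t) := by rw [hk]
    _ = pw a t * pw m t := by linear_combination (pw a t * pw m t) * inv b

theorem cross_comm (h : EigIn hR Γ)
    (hψ : ∀ (t : ℝ) x, imPow hR t * ψ x * imPow hR (-t) = ψ (imPow hR' t * x * imPow hR' (-t)))
    (γ a b : Γ) (x : Matrix κ κ ℂ) :
    eigProj hR ((γ * a : Γ) : {x : ℝ // 0 < x}) *
      ψ (eigProj hR' (a : {x : ℝ // 0 < x}) * x * eigProj hR' (b : {x : ℝ // 0 < x})) =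
    ψ (eigProj hR' (a : {x : ℝ // 0 < x}) * x * eigProj hR' (b : {x : ℝ // 0 < x})) *
      eigProj hR ((γ * b : Γ) : {x : ℝ // 0 < x}) := by
  obtain ⟨E, hE0, hE1⟩ := h.exists_finset
  set Y := ψ (eigProj hR' (a : {x : ℝ // 0 < x}) * x * eigProj hR' (b : {x : ℝ // 0 < x}))
  set M := eigProj hR ((γ * a : Γ) : {x : ℝ // 0 < x}) * Y *
    eigProj hR ((γ * b : Γ) : {x : ℝ // 0 < x})
  trans M
  · calc eigProj hR ((γ * a : Γ) : {x : ℝ // 0 < x}) * Y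
        = eigProj hR ((γ * a : Γ) : {x : ℝ // 0 < x}) * Y *
          ∑ m ∈ E, eigProj hR (m : {x : ℝ // 0 < x}) := by rw [hE1, Matrix.mul_one]
      _ = M := by
        rw [Finset.mul_sum, Finset.sum_eq_single (γ * b)]
        · intro m _ hm
          refine cross_eq_zero hR hR' hψ _ _ _ _ (fun h => hm ?_) x
          rw [mul_comm γ a, mul_assoc] at h
          exact (mul_left_cancel h).symm
        · intro hb
          rw [hE0 _ hb, Matrix.mul_zero]
  · symm
    calc Y * eigProj hR ((γ * b : Γ) : {x : ℝ // 0 < x})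
        = (∑ m ∈ E, eigProj hR (m : {x : ℝ // 0 < x})) *
          (Y * eigProj hR ((γ * b : Γ) : {x : ℝ // 0 < x})) := by rw [hE1, Matrix.one_mul]
      _ = M := by
        rw [Finset.sum_mul, Finset.sum_eq_single (γ * a)]
        · exact (Matrix.mul_assoc _ _ _).symm
        · intro m _ hm
          rw [← Matrix.mul_assoc]
          refine cross_eq_zero hR hR' hψ _ _ _ _ (fun h => hm ?_) x
          rw [← mul_assoc, mul_comm a γ] at h
          exact mul_right_cancel h
        · intro hb
          rw [hE0 _ hb, Matrix.zero_mul]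

theorem crossProj_eq_sum {E : Finset Γ}
    (hE : ∀ a ∉ E, eigProj hR' (a : {x : ℝ // 0 < x}) = 0) (γ : Γ) :
    crossProj hR hR' Γ ψ γ = ∑ a ∈ E, eigProj hR ((γ * a : Γ) : {x : ℝ // 0 < x}) *
      ψ (eigProj hR' (a : {x : ℝ // 0 < x})) := by
  refine finsum_eq_sum_of_support_subset _ fun a ha => ?_
  by_contra h
  apply ha
  simp only [hE a h, map_zero, Matrix.mul_zero]

theorem eigProj_comm (h : EigIn hR Γ)
    (hψ : ∀ (t : ℝ) x, imPow hR t * ψ x * imPow hR (-t) = ψ (imPow hR' t * x * imPow hR' (-t)))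
    (γ a : Γ) :
    eigProj hR ((γ * a : Γ) : {x : ℝ // 0 < x}) * ψ (eigProj hR' (a : {x : ℝ // 0 < x})) =
    ψ (eigProj hR' (a : {x : ℝ // 0 < x})) * eigProj hR ((γ * a : Γ) : {x : ℝ // 0 < x}) := by
  have := cross_comm hR hR' h hψ γ a a 1
  rwa [Matrix.mul_one, eigProj_mul_self] at this

theorem crossProj_comm (h : EigIn hR Γ) (h' : EigIn hR' Γ)
    (hψ : ∀ (t : ℝ) x, imPow hR t * ψ x * imPow hR (-t) = ψ (imPow hR' t * x * imPow hR' (-t)))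
    (γ : Γ) (x : Matrix κ κ ℂ) :
    crossProj hR hR' Γ ψ γ * ψ x = ψ x * crossProj hR hR' Γ ψ γ := by
  obtain ⟨E, hE0, hE1⟩ := h'.exists_finset
  rw [crossProj_eq_sum hR hR' hE0, Finset.sum_mul, Finset.mul_sum]
  have h1 : ∀ a : Γ, eigProj hR ((γ * a : Γ) : {x : ℝ // 0 < x}) *
      ψ (eigProj hR' (a : {x : ℝ // 0 < x})) * ψ x = ∑ b ∈ E,
      eigProj hR ((γ * a : Γ) : {x : ℝ // 0 < x}) *
      ψ (eigProj hR' (a : {x : ℝ // 0 < x}) * x * eigProj hR' (b : {x : ℝ // 0 < x})) := by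
    intro a
    rw [← Finset.mul_sum, ← map_sum, ← Finset.mul_sum, hE1, Matrix.mul_one, map_mul,
      Matrix.mul_assoc]
  have h2 : ∀ b : Γ, ψ x * (eigProj hR ((γ * b : Γ) : {x : ℝ // 0 < x}) *
      ψ (eigProj hR' (b : {x : ℝ // 0 < x}))) = ∑ a ∈ E,
      ψ (eigProj hR' (a : {x : ℝ // 0 < x}) * x * eigProj hR' (b : {x : ℝ // 0 < x})) *
      eigProj hR ((γ * b : Γ) : {x : ℝ // 0 < x}) := by
    intro b
    rw [eigProj_comm hR hR' h hψ, ← Finset.sum_mul, ← map_sum, ← Finset.sum_mul, ← Finset.sum_mul,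
      hE1, Matrix.one_mul, map_mul, Matrix.mul_assoc]
  simp only [h1, h2]
  rw [Finset.sum_comm]
  simp only [cross_comm hR hR' h hψ]

theorem crossProj_mul_self (h : EigIn hR Γ) (h' : EigIn hR' Γ)
    (hψ : ∀ (t : ℝ) x, imPow hR t * ψ x * imPow hR (-t) = ψ (imPow hR' t * x * imPow hR' (-t)))
    (γ : Γ) : crossProj hR hR' Γ ψ γ * crossProj hR hR' Γ ψ γ = crossProj hR hR' Γ ψ γ := by
  obtain ⟨E, hE0, hE1⟩ := h'.exists_finset
  rw [crossProj_eq_sum hR hR' hE0, Finset.sum_mul]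
  refine Finset.sum_congr rfl fun a ha => ?_
  rw [Finset.mul_sum, Finset.sum_eq_single a]
  · rw [Matrix.mul_assoc, ← Matrix.mul_assoc (ψ _), ← eigProj_comm hR hR' h hψ, Matrix.mul_assoc,
      ← map_mul, eigProj_mul_self, ← Matrix.mul_assoc, eigProj_mul_self]
  · intro b _ hb
    rw [eigProj_comm hR hR' h hψ γ a, Matrix.mul_assoc, ← Matrix.mul_assoc (eigProj hR _),
      eigProj_mul_eigProj_of_ne hR (fun h => hb (mul_left_cancel h).symm), Matrix.zero_mul,
      Matrix.mul_zero]
  · exact fun h => absurd ha h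

theorem crossProj_mul_of_ne (h : EigIn hR Γ) (h' : EigIn hR' Γ)
    (hψ : ∀ (t : ℝ) x, imPow hR t * ψ x * imPow hR (-t) = ψ (imPow hR' t * x * imPow hR' (-t)))
    {γ δ : Γ} (hne : γ ≠ δ) :
    crossProj hR hR' Γ ψ γ * crossProj hR hR' Γ ψ δ = 0 := by
  obtain ⟨E, hE0, hE1⟩ := h'.exists_finset
  rw [crossProj_eq_sum hR hR' hE0, crossProj_eq_sum hR hR' hE0, Finset.sum_mul]
  refine Finset.sum_eq_zero fun a _ => ?_
  rw [Finset.mul_sum]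
  refine Finset.sum_eq_zero fun b _ => ?_
  by_cases hab : a = b
  · subst hab
    rw [eigProj_comm hR hR' h hψ γ a, Matrix.mul_assoc, ← Matrix.mul_assoc (eigProj hR _),
      eigProj_mul_eigProj_of_ne hR (fun h => hne (mul_right_cancel h)), Matrix.zero_mul,
      Matrix.mul_zero]
  · rw [eigProj_comm hR hR' h hψ δ b, Matrix.mul_assoc, ← Matrix.mul_assoc (ψ _), ← map_mul,
      eigProj_mul_eigProj_of_ne hR' hab, map_zero, Matrix.zero_mul, Matrix.mul_zero]

theorem crossProj_mul_one (h' : EigIn hR' Γ) (γ : Γ) :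
    crossProj hR hR' Γ ψ γ * ψ 1 = crossProj hR hR' Γ ψ γ := by
  obtain ⟨E, hE0, hE1⟩ := h'.exists_finset
  rw [crossProj_eq_sum hR hR' hE0, Finset.sum_mul]
  refine Finset.sum_congr rfl fun a _ => ?_
  rw [Matrix.mul_assoc, ← map_mul, Matrix.mul_one]

/-- The trace of `q(γ)` is a multiple of the size of the smaller matrix algebra. -/
theorem exists_trace_crossProj [Nonempty κ] (h : EigIn hR Γ) (h' : EigIn hR' Γ)
    (hψ : ∀ (t : ℝ) x, imPow hR t * ψ x * imPow hR (-t) = ψ (imPow hR' t * x * imPow hR' (-t)))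
    (γ : Γ) : ∃ k : ℕ, (crossProj hR hR' Γ ψ γ).trace = k * Fintype.card κ := by
  set q := crossProj hR hR' Γ ψ γ
  have hc : ∀ x, q * ψ x = ψ x * q := crossProj_comm hR hR' h h' hψ γ
  have hq : q * q = q := crossProj_mul_self hR hR' h h' hψ γ
  let o : κ := Classical.arbitrary κ
  let e : κ → κ → Matrix κ κ ℂ := fun i j => Matrix.single i j 1
  have he : ∀ i j k, e i j * e j k = e i k := fun i j k => by simp [e]
  have hid : (q * ψ (e o o)) * (q * ψ (e o o)) = q * ψ (e o o) := by
    rw [Matrix.mul_assoc, ← Matrix.mul_assoc (ψ _), ← hc, Matrix.mul_assoc q, ← map_mul, he,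
      ← Matrix.mul_assoc, hq]
  obtain ⟨k, -, hk⟩ := exists_trace_eq_natCast hid
  refine ⟨k, ?_⟩
  have h1 : ∀ i, (q * ψ (e i i)).trace = k := by
    intro i
    rw [← he i o i, map_mul, ← Matrix.mul_assoc, Matrix.trace_mul_comm, ← Matrix.mul_assoc, ← hc,
      Matrix.mul_assoc, ← map_mul, he, hk]
  have h2 : (1 : Matrix κ κ ℂ) = ∑ i, e i i := by
    ext i j
    rw [Matrix.sum_apply]
    by_cases hij : i = j
    · subst hij
      rw [Finset.sum_eq_single i] <;> simp +contextual [e]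
    · rw [Matrix.one_apply_ne hij]
      refine (Finset.sum_eq_zero fun k _ => ?_).symm
      simp only [e, Matrix.single_apply]
      rw [if_neg]
      rintro ⟨rfl, rfl⟩
      exact hij rfl
  have h3 : q = ∑ i, q * ψ (e i i) := by
    rw [← Finset.mul_sum, ← map_sum, ← h2, crossProj_mul_one hR hR' h']
  rw [h3, Matrix.trace_sum]
  simp only [h1]
  simp [mul_comm]

end Cross

/-! ### Inductive sequences of atomic W*-algebras, their limits, and flows -/

/-- The atomic W*-algebra (unique up to isomorphism) whose minimal central projections are labelled by `Z`, with direct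
summands `B(ℂ^{d(z)})`: all bounded families of matrices (with the operator norms). -/
abbrev BlockAlg {Z : Type u} (d : Z → ℕ+) : Type u :=
  lp (fun z => Matrix (Fin (d z)) (Fin (d z)) ℂ) ∞

open scoped Classical in
/-- The inclusion of the direct summand labelled by `z`. It maps `1` to the minimal central
projection `z`. -/
def summand {Z : Type u} (d : Z → ℕ+) (z : Z) :
    Matrix (Fin (d z)) (Fin (d z)) ℂ →ₙₐ[ℂ] BlockAlg d where
  toFun x := lp.single ∞ z x
  map_smul' c x := lp.single_smul _ _ _ _
  map_zero' := lp.single_zero _ _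
  map_add' x y := lp.single_add _ _ _ _
  map_mul' x y := by
    refine lp.ext (funext fun w => ?_)
    rw [lp.infty_coeFn_mul, Pi.mul_apply]
    by_cases h : w = z
    · subst h; simp only [lp.single_apply_self]
    · simp only [lp.single_apply_ne _ _ _ h, zero_mul]

/-- An inductive sequence `ℂ = A_0 ↪ A_1 ↪ A_2 ↪ ⋯` of atomic W*-algebras with separable preduals
(countably many direct summands), whose direct summands are finite-dimensional, along unital,
normal, injective `*`-homomorphisms. -/
structure AtomicSequence where
  /-- the minimal central projections of `A_n` -/
  Z : ℕ → Type u
  countable_Z : ∀ n, Countable (Z n)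
  /-- `dim z`, for `z` a minimal central projection of `A_n` -/
  dim : ∀ n, Z n → ℕ+
  /-- the only minimal central projection `1` of `A_0 = ℂ 1` -/
  root : Z 0
  eq_root : ∀ z : Z 0, z = root
  dim_root : dim 0 root = 1
  /-- the embedding of `A_n` into `A_{n+1}` -/
  emb : ∀ n, BlockAlg (dim n) →⋆ₐ[ℂ] BlockAlg (dim (n + 1))
  emb_injective : ∀ n, Function.Injective (emb n)
  emb_normal : ∀ n, IsNormalMap (emb n)

namespace AtomicSequence

variable (S : AtomicSequence.{u})

/-- The `n`-th algebra `A_n`. -/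
abbrev Alg (n : ℕ) : Type u := BlockAlg (S.dim n)

/-- The full matrix algebra `z A_n = B(H_z)`. -/
abbrev Mat (n : ℕ) (z : S.Z n) : Type := Matrix (Fin (S.dim n z)) (Fin (S.dim n z)) ℂ

/-- The minimal central projection `z` as an element of `A_n`. -/
def centralProj (n : ℕ) (z : S.Z n) : S.Alg n := summand (S.dim n) z 1

/-- The multiplicative map `x ↦ z x` from `z' A_n` to `z A_{n+1}`. -/
def block (n : ℕ) (z : S.Z (n + 1)) (z' : S.Z n) : S.Mat n z' →ₙₐ[ℂ] S.Mat (n + 1) z where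
  toFun x := S.emb n (summand (S.dim n) z' x) z
  map_smul' c x := by
    rw [map_smul, map_smul, lp.coeFn_smul]; rfl
  map_zero' := by
    rw [map_zero, map_zero, lp.coeFn_zero]; rfl
  map_add' x y := by
    rw [map_add, map_add, lp.coeFn_add]; rfl
  map_mul' x y := by
    rw [map_mul, map_mul, lp.infty_coeFn_mul]; rfl

end AtomicSequence

/-- `A` is the inductive limit C*-algebra of the sequence: the `A_n` are embedded into `A`
compatibly, and their union is dense. (This determines `A` up to a unique isomorphism.) -/
structure CStarLimit (S : AtomicSequence.{u}) (A : Type v) [CStarAlgebra A] where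
  /-- the embedding of `A_n` into `A` -/
  incl : ∀ n, S.Alg n →⋆ₐ[ℂ] A
  incl_injective : ∀ n, Function.Injective (incl n)
  incl_emb : ∀ n a, incl (n + 1) (S.emb n a) = incl n a
  dense_iUnion : Dense (⋃ n, Set.range (incl n))

/-- An inductive flow: a one-parameter group of `*`-automorphisms of `A` that leaves every `A_n`
globally invariant and whose restriction to every `A_n` is continuous in the u-topology, that is,
`t ↦ φ ∘ α_n^t` is norm continuous for every `φ` in the predual of `A_n` (the predual is spanned
by the positive normal functionals). -/
structure InductiveFlow {S : AtomicSequence.{u}} {A : Type v} [CStarAlgebra A]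
    (L : CStarLimit S A) where
  /-- the automorphisms `α^t` of `A` -/
  aut : ℝ → (A ≃⋆ₐ[ℂ] A)
  aut_zero : ∀ a, aut 0 a = a
  aut_add : ∀ s t a, aut (s + t) a = aut s (aut t a)
  /-- the restrictions `α_n^t` to `A_n` -/
  level : ∀ n, ℝ → (S.Alg n ≃⋆ₐ[ℂ] S.Alg n)
  incl_level : ∀ n t a, L.incl n (level n t a) = aut t (L.incl n a)
  u_continuous : ∀ (n : ℕ) (φ : S.Alg n →ₗ[ℂ] ℂ), IsPositiveFunctional φ → IsNormalMap φ →
    ∀ (t₀ ε : ℝ), 0 < ε → ∀ᶠ t in 𝓝 t₀, ∀ a : S.Alg n,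
      ‖φ (level n t a) - φ (level n t₀ a)‖ ≤ ε * ‖a‖

section Flow

variable {S : AtomicSequence.{u}} {A : Type v} [CStarAlgebra A] {L : CStarLimit S A}

/-- A family `ρ = (ρ_z)` of positive invertible matrices with `α_n^t = Ad ρ_z^{it}` on `z A_n`.
As each `ρ_z` is determined by the flow up to a positive factor only, `ρ` is part of the data;
it is normalized by `ρ_1 = 1` at the minimal central projection `1` of `A_0 = ℂ 1` (as is the case
if `Tr ρ_z = Tr ρ_z⁻¹` for all `z`). -/
structure Density (α : InductiveFlow L) where
  /-- the matrix `ρ_z` -/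
  rho : ∀ n (z : S.Z n), S.Mat n z
  posDef : ∀ n z, (rho n z).PosDef
  implements : ∀ n t (a : S.Alg n) (z : S.Z n),
    α.level n t a z = imPow (posDef n z).isHermitian t * a z * imPow (posDef n z).isHermitian (-t)
  rho_root : rho 0 S.root = 1

/-- The strip `{w | Im w between 0 and β}`. -/
def strip (β : ℝ) : Set ℂ := {w | w.im ∈ Set.uIcc 0 β}

/-- The Kubo-Martin-Schwinger condition for `α^t` at inverse temperature `β`. For `β = 0` it says
that `ω` is a trace. -/
def IsKMS (α : InductiveFlow L) (β : ℝ) (ω : A →ₗ[ℂ] ℂ) : Prop :=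
  ∀ a b : A, ∃ F : ℂ → ℂ, ContinuousOn F (strip β) ∧ DifferentiableOn ℂ F (interior (strip β)) ∧
    (∃ C : ℝ, ∀ w ∈ strip β, ‖F w‖ ≤ C) ∧
    ∀ t : ℝ, F t = ω (a * α.aut t b) ∧ F (t + β * Complex.I) = ω (α.aut t b * a)

/-- The set of locally normal `(α^t, β)`-KMS states on `A`. -/
def lnKMSStates (α : InductiveFlow L) (β : ℝ) : Set (A →ₗ[ℂ] ℂ) :=
  {ω | IsState ω ∧ IsKMS α β ω ∧ ∀ n, IsNormalMap fun a : S.Alg n => ω (L.incl n a)}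

end Flow

/-! ### The extended branching graph and its dimension group -/

namespace Density

variable {S : AtomicSequence.{u}} {A : Type v} [CStarAlgebra A] {L : CStarLimit S A}
variable {α : InductiveFlow L} (R : Density α)

/-- `ρ_z` is Hermitian. -/
theorem herm (n : ℕ) (z : S.Z n) : (R.rho n z).IsHermitian := (R.posDef n z).isHermitian

/-- `dim_β z = Tr(ρ_z^{-β})`. -/
def dimBeta (β : ℝ) (n : ℕ) (z : S.Z n) : ℝ := (realPow (R.herm n z) (-β)).trace.re

/-- The group `Γ` generated by all the eigenvalues of all the `ρ_z` in the multiplicative group of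
positive reals. -/
def Gam : Subgroup {x : ℝ // 0 < x} :=
  Subgroup.closure {g | ∃ n z i, (g : ℝ) = (R.herm n z).eigenvalues i}

/-- The real number `γ^β`, for `γ ∈ Γ`. -/
def gpow (γ : R.Gam) (β : ℝ) : ℝ := ((γ : {x : ℝ // 0 < x}) : ℝ) ^ β

theorem eigIn (n : ℕ) (z : S.Z n) : EigIn (R.herm n z) R.Gam := fun i =>
  ⟨⟨⟨(R.herm n z).eigenvalues i, (R.posDef n z).eigenvalues_pos i⟩,
    Subgroup.subset_closure ⟨n, z, i, rfl⟩⟩, rfl⟩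

/-- The projection `q_{(z,z')}(γ) = ∑ γ', p_z(γ γ') p_{z'}(γ')` of `z A_{n+1}` (zero if `z z' = 0`),
where `p_z(γ)` is the spectral projection of `ρ_z` for `γ`. -/
def q (n : ℕ) (z : S.Z (n + 1)) (z' : S.Z n) (γ : R.Gam) : S.Mat (n + 1) z :=
  crossProj (R.herm (n + 1) z) (R.herm n z') R.Gam (S.block n z z') γ

/-- The vertices `(z, γ)` of level `n` of the extended branching graph. -/
abbrev Vert (n : ℕ) : Type u := S.Z n × R.Gam

/-- The standard link `μ((z,γ),(z',γ')) = Tr(q_{(z,z')}(γ⁻¹ γ')) / dim z` of the extended branching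
graph. -/
def link (n : ℕ) (p : R.Vert (n + 1)) (p' : R.Vert n) : ℝ :=
  (R.q n p.1 p'.1 (p.2⁻¹ * p'.2)).trace.re / (S.dim (n + 1) p.1 : ℕ)

theorem emb_level (n : ℕ) (t : ℝ) (a : S.Alg n) :
    S.emb n (α.level n t a) = α.level (n + 1) t (S.emb n a) := by
  apply L.incl_injective (n + 1)
  rw [L.incl_emb, α.incl_level, α.incl_level, L.incl_emb]

theorem level_summand (n : ℕ) (t : ℝ) (z : S.Z n) (x : S.Mat n z) :
    α.level n t (summand (S.dim n) z x) = summand (S.dim n) z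
      (imPow (R.herm n z) t * x * imPow (R.herm n z) (-t)) := by
  classical
  refine lp.ext (funext fun w => ?_)
  rw [R.implements]
  by_cases h : w = z
  · subst h
    simp only [summand, NonUnitalAlgHom.coe_mk, lp.single_apply_self]
  · simp only [summand, NonUnitalAlgHom.coe_mk, lp.single_apply_ne _ _ _ h, mul_zero, zero_mul]

theorem block_imPow (n : ℕ) (z : S.Z (n + 1)) (z' : S.Z n) (t : ℝ) (x : S.Mat n z') :
    imPow (R.herm (n + 1) z) t * S.block n z z' x * imPow (R.herm (n + 1) z) (-t) =
      S.block n z z' (imPow (R.herm n z') t * x * imPow (R.herm n z') (-t)) := by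
  change imPow _ t * S.emb n (summand (S.dim n) z' x) z * imPow _ (-t) =
    S.emb n (summand (S.dim n) z' _) z
  rw [← R.level_summand, emb_level, R.implements]

theorem exists_link_eq (n : ℕ) (p : R.Vert (n + 1)) (p' : R.Vert n) :
    ∃ k : ℕ, R.link n p p' = k * (S.dim n p'.1 : ℕ) / (S.dim (n + 1) p.1 : ℕ) := by
  obtain ⟨k, hk⟩ := exists_trace_crossProj (R.herm (n + 1) p.1) (R.herm n p'.1)
    (R.eigIn _ _) (R.eigIn _ _) (R.block_imPow n p.1 p'.1) (p.2⁻¹ * p'.2)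
  refine ⟨k, ?_⟩
  unfold link q
  rw [hk]
  simp

theorem q_mul_q_of_ne (n : ℕ) (z : S.Z (n + 1)) {z₁ z₂ : S.Z n} {γ₁ γ₂ : R.Gam}
    (h : (z₁, γ₁) ≠ (z₂, γ₂)) : R.q n z z₁ γ₁ * R.q n z z₂ γ₂ = 0 := by
  classical
  by_cases hz : z₁ = z₂
  · subst hz
    exact crossProj_mul_of_ne _ _ (R.eigIn _ _) (R.eigIn _ _) (R.block_imPow n z z₁)
      (fun h' => h (by rw [h']))
  · have h1 : S.block n z z₁ 1 * S.block n z z₂ 1 = 0 := by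
      have : summand (S.dim n) z₁ 1 * summand (S.dim n) z₂ 1 = 0 := by
        refine lp.ext (funext fun w => ?_)
        rw [lp.infty_coeFn_mul, Pi.mul_apply]
        by_cases hw : w = z₁
        · have hw2 : w ≠ z₂ := fun h' => hz (hw.symm.trans h')
          simp only [summand, NonUnitalAlgHom.coe_mk, lp.single_apply_ne _ _ _ hw2, mul_zero]
          rfl
        · simp only [summand, NonUnitalAlgHom.coe_mk, lp.single_apply_ne _ _ _ hw, zero_mul]
          rfl
      change S.emb n _ z * S.emb n _ z = 0
      rw [← Pi.mul_apply, ← lp.infty_coeFn_mul, ← map_mul, this, map_zero, lp.coeFn_zero]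
      rfl
    have e1 : R.q n z z₁ γ₁ = R.q n z z₁ γ₁ * S.block n z z₁ 1 :=
      (crossProj_mul_one _ _ (R.eigIn _ _) _).symm
    have e2 : R.q n z z₂ γ₂ = S.block n z z₂ 1 * R.q n z z₂ γ₂ := by
      unfold q
      rw [← crossProj_comm _ _ (R.eigIn _ _) (R.eigIn _ _) (R.block_imPow n z z₂),
        crossProj_mul_one _ _ (R.eigIn _ _)]
    rw [e1, e2, Matrix.mul_assoc, ← Matrix.mul_assoc (S.block n z z₁ 1), h1, Matrix.zero_mul,
      Matrix.mul_zero]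

theorem link_nonneg (n : ℕ) (p : R.Vert (n + 1)) (p' : R.Vert n) : 0 ≤ R.link n p p' := by
  obtain ⟨k, hk⟩ := R.exists_link_eq n p p'
  rw [hk]
  positivity

theorem sum_link_le_one (n : ℕ) (p : R.Vert (n + 1)) (F : Finset (R.Vert n)) :
    ∑ p' ∈ F, R.link n p p' ≤ 1 := by
  have hid : (∑ p' ∈ F, R.q n p.1 p'.1 (p.2⁻¹ * p'.2)) * (∑ p' ∈ F, R.q n p.1 p'.1 (p.2⁻¹ * p'.2))
      = ∑ p' ∈ F, R.q n p.1 p'.1 (p.2⁻¹ * p'.2) := by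
    rw [Finset.sum_mul]
    refine Finset.sum_congr rfl fun a ha => ?_
    rw [Finset.mul_sum, Finset.sum_eq_single a]
    · exact crossProj_mul_self _ _ (R.eigIn _ _) (R.eigIn _ _) (R.block_imPow n p.1 a.1) _
    · intro b _ hb
      refine R.q_mul_q_of_ne n p.1 fun h => hb ?_
      rw [Prod.mk.injEq] at h
      exact (Prod.ext h.1 (mul_left_cancel h.2)).symm
    · exact fun h => absurd ha h
  obtain ⟨k, hk, htr⟩ := exists_trace_eq_natCast hid
  have hd : (0 : ℝ) < (S.dim (n + 1) p.1 : ℕ) := by exact_mod_cast (S.dim (n + 1) p.1).pos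
  unfold link
  rw [← Finset.sum_div, div_le_one hd, ← Complex.re_sum, ← Matrix.trace_sum, htr]
  simpa using hk

theorem finite_support_link (n : ℕ) (p : R.Vert (n + 1)) :
    (Function.support (R.link n p)).Finite := by
  by_contra hinf
  obtain ⟨F, hF, hcard⟩ := Set.Infinite.exists_subset_card_eq hinf ((S.dim (n + 1) p.1 : ℕ) + 1)
  have hd : (0 : ℝ) < (S.dim (n + 1) p.1 : ℕ) := by exact_mod_cast (S.dim (n + 1) p.1).pos
  have h1 : ∀ p' ∈ F, 1 / ((S.dim (n + 1) p.1 : ℕ) : ℝ) ≤ R.link n p p' := by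
    intro p' hp'
    obtain ⟨k, hk⟩ := R.exists_link_eq n p p'
    have h0 : R.link n p p' ≠ 0 := hF hp'
    have hk0 : k ≠ 0 := by
      rintro rfl
      exact h0 (by rw [hk]; simp)
    rw [hk]
    refine div_le_div_of_nonneg_right ?_ hd.le
    have : 1 ≤ k * (S.dim n p'.1 : ℕ) :=
      Nat.succ_le_of_lt (Nat.mul_pos (Nat.pos_of_ne_zero hk0) (S.dim n p'.1).pos)
    exact_mod_cast this
  have h2 := Finset.card_nsmul_le_sum F _ _ h1
  have h3 := h2.trans (R.sum_link_le_one n p F)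
  rw [hcard, nsmul_eq_mul, mul_one_div, div_le_one hd] at h3
  push_cast at h3
  linarith

/-- The group of bounded functions `f` on the vertices of level `n` with `f(z,γ) ∈ ℤ / dim z`. -/
def levelGroup (n : ℕ) : AddSubgroup (R.Vert n → ℝ) where
  carrier := {f | (∀ p, ∃ k : ℤ, f p = k / (S.dim n p.1 : ℕ)) ∧ ∃ C : ℝ, ∀ p, |f p| ≤ C}
  zero_mem' := ⟨fun p => ⟨0, by simp⟩, 0, fun p => by simp⟩
  add_mem' := by
    rintro f g ⟨hf, C, hC⟩ ⟨hg, D, hD⟩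
    refine ⟨fun p => ?_, C + D, fun p => (abs_add_le _ _).trans (add_le_add (hC p) (hD p))⟩
    obtain ⟨k, hk⟩ := hf p
    obtain ⟨l, hl⟩ := hg p
    exact ⟨k + l, by rw [Pi.add_apply, hk, hl]; push_cast; ring⟩
  neg_mem' := by
    rintro f ⟨hf, C, hC⟩
    refine ⟨fun p => ?_, C, fun p => by rw [Pi.neg_apply, abs_neg]; exact hC p⟩
    obtain ⟨k, hk⟩ := hf p
    exact ⟨-k, by rw [Pi.neg_apply, hk]; push_cast; ring⟩

/-- The connecting map from level `n` to level `n + 1`: multiplication by the matrix `μ`. -/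
def step (n : ℕ) : R.levelGroup n →+ R.levelGroup (n + 1) where
  toFun f := ⟨fun p => ∑ᶠ p', R.link n p p' * f.1 p', by
    obtain ⟨f, hf, C, hC⟩ := f
    have hsum : ∀ p, ∑ᶠ p', R.link n p p' * f p' =
        ∑ p' ∈ (R.finite_support_link n p).toFinset, R.link n p p' * f p' := fun p =>
      finsum_eq_sum_of_support_subset _ fun p' hp' => by
        simp only [Set.Finite.coe_toFinset, Function.mem_support] at hp' ⊢
        exact left_ne_zero_of_mul hp'
    refine ⟨fun p => ?_, |C|, fun p => ?_⟩
    · have hk : ∀ p', ∃ k : ℤ, R.link n p p' * f p' = k / (S.dim (n + 1) p.1 : ℕ) := by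
        intro p'
        obtain ⟨k, hk⟩ := R.exists_link_eq n p p'
        obtain ⟨l, hl⟩ := hf p'
        have hd : ((S.dim n p'.1 : ℕ) : ℝ) ≠ 0 := by exact_mod_cast (S.dim n p'.1).ne_zero
        refine ⟨k * l, ?_⟩
        rw [hk, hl]
        push_cast
        field_simp
      choose k hk using hk
      refine ⟨∑ p' ∈ (R.finite_support_link n p).toFinset, k p', ?_⟩
      simp only [hsum]
      push_cast
      rw [Finset.sum_div]
      exact Finset.sum_congr rfl fun p' _ => hk p'
    · simp only [hsum]
      calc |∑ p' ∈ (R.finite_support_link n p).toFinset, R.link n p p' * f p'|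
          ≤ ∑ p' ∈ (R.finite_support_link n p).toFinset, R.link n p p' * |C| := by
            refine (Finset.abs_sum_le_sum_abs _ _).trans (Finset.sum_le_sum fun p' _ => ?_)
            rw [abs_mul, abs_of_nonneg (R.link_nonneg n p p')]
            exact mul_le_mul_of_nonneg_left ((hC p').trans (le_abs_self C)) (R.link_nonneg n p p')
        _ ≤ 1 * |C| := by
            rw [← Finset.sum_mul]
            exact mul_le_mul_of_nonneg_right (R.sum_link_le_one n p _) (abs_nonneg C)
        _ = |C| := one_mul _⟩
  map_zero' := Subtype.ext (funext fun p => by simp)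
  map_add' f g := Subtype.ext (funext fun p => by
    change ∑ᶠ p', R.link n p p' * (f.1 p' + g.1 p') =
      (∑ᶠ p', R.link n p p' * f.1 p') + ∑ᶠ p', R.link n p p' * g.1 p'
    rw [← finsum_add_distrib]
    · exact finsum_congr fun p' => mul_add _ _ _
    · exact (R.finite_support_link n p).subset fun p' hp' => left_ne_zero_of_mul hp'
    · exact (R.finite_support_link n p).subset fun p' hp' => left_ne_zero_of_mul hp')

/-- The connecting map from level `m` to level `n`, for `m ≤ n`: the composition of the steps. -/
def trans (m n : ℕ) (h : m ≤ n) : R.levelGroup m →+ R.levelGroup n :=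
  Nat.leRecOn (C := fun k => R.levelGroup m →+ R.levelGroup k) h
    (fun {k} g => (R.step k).comp g) (AddMonoidHom.id _)

theorem trans_self (m : ℕ) : R.trans m m le_rfl = AddMonoidHom.id _ := Nat.leRecOn_self _

theorem trans_succ (m n : ℕ) (h : m ≤ n) :
    R.trans m (n + 1) (h.trans n.le_succ) = (R.step n).comp (R.trans m n h) :=
  Nat.leRecOn_succ _ _

/-- The dimension group `𝔇` of the extended branching graph, the inductive limit of the level groups along the connecting maps. -/
abbrev DimGroup : Type u :=
  AddCommGroup.DirectLimit (fun n => R.levelGroup n) R.trans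

/-- The canonical homomorphism from the `n`-th level group to `𝔇`. -/
def toDim (n : ℕ) : R.levelGroup n →+ R.DimGroup :=
  AddCommGroup.DirectLimit.of (fun n => R.levelGroup n) R.trans n

theorem step_nonneg (n : ℕ) {f : R.levelGroup n} (hf : ∀ p, 0 ≤ f.1 p) (p : R.Vert (n + 1)) :
    0 ≤ (R.step n f).1 p :=
  finsum_nonneg fun p' => mul_nonneg (R.link_nonneg n p p') (hf p')

theorem trans_nonneg (m n : ℕ) (h : m ≤ n) {f : R.levelGroup m} (hf : ∀ p, 0 ≤ f.1 p) :
    ∀ p, 0 ≤ (R.trans m n h f).1 p := by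
  induction n, h using Nat.le_induction with
  | base => rw [trans_self]; exact hf
  | succ n h ih => rw [trans_succ _ _ _ h]; exact R.step_nonneg n ih

theorem toDim_trans (m n : ℕ) (h : m ≤ n) (f : R.levelGroup m) :
    R.toDim n (R.trans m n h f) = R.toDim m f :=
  AddCommGroup.DirectLimit.of_f (G := fun n => R.levelGroup n) (f := R.trans) h f

/-- The positive cone of the `n`-th level group: the pointwise nonnegative functions. -/
def levelPos (n : ℕ) : AddSubmonoid (R.levelGroup n) where
  carrier := {f | ∀ p, 0 ≤ f.1 p}
  zero_mem' := fun _ => le_rfl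
  add_mem' := fun hf hg p => add_nonneg (hf p) (hg p)

/-- The positive cone `𝔇_+`, the inductive limit of the positive cones of the level groups. -/
def dimPos : AddSubmonoid R.DimGroup where
  carrier := {x | ∃ n, ∃ f ∈ R.levelPos n, R.toDim n f = x}
  zero_mem' := ⟨0, 0, zero_mem _, map_zero _⟩
  add_mem' := by
    rintro _ _ ⟨m, f, hf, rfl⟩ ⟨n, g, hg, rfl⟩
    refine ⟨max m n, R.trans m _ (le_max_left m n) f + R.trans n _ (le_max_right m n) g,
      add_mem (R.trans_nonneg _ _ _ hf) (R.trans_nonneg _ _ _ hg), ?_⟩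
    rw [map_add, toDim_trans, toDim_trans]

/-- The canonical map from the positive cone of the `n`-th level group to `𝔇_+`. -/
def toDimPos (n : ℕ) : R.levelPos n →+ R.dimPos where
  toFun f := ⟨R.toDim n f, n, f, f.2, rfl⟩
  map_zero' := Subtype.ext (map_zero (R.toDim n))
  map_add' _ _ := Subtype.ext (map_add (R.toDim n) _ _)

open scoped Classical in
/-- The Dirac function at a vertex of level `n`, as an element of the positive cone. -/
def dirac (n : ℕ) (p : R.Vert n) : R.levelPos n :=
  ⟨⟨Pi.single p 1, fun p' => by
      by_cases h : p' = p
      · subst h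
        refine ⟨(S.dim n p'.1 : ℕ), ?_⟩
        have hd : ((S.dim n p'.1 : ℕ) : ℝ) ≠ 0 := by exact_mod_cast (S.dim n p'.1).ne_zero
        rw [Pi.single_eq_same, Int.cast_natCast, div_self hd]
      · exact ⟨0, by rw [Pi.single_eq_of_ne h]; simp⟩,
    1, fun p' => by
      by_cases h : p' = p
      · subst h; simp
      · rw [Pi.single_eq_of_ne h]; simp⟩,
    fun p' => by
      change 0 ≤ (Pi.single p 1 : R.Vert n → ℝ) p'
      by_cases h : p' = p
      · subst h; simp
      · rw [Pi.single_eq_of_ne h]⟩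

/-- The action of `γ ∈ Γ` on the `n`-th level group, `f ↦ f ∘ T_γ⁻¹` with
`T_γ(z,γ') = (z, γ γ')`. -/
def levelAct (γ : R.Gam) (n : ℕ) : R.levelGroup n →+ R.levelGroup n where
  toFun f := ⟨fun p => f.1 (p.1, γ⁻¹ * p.2), fun p => f.2.1 (p.1, γ⁻¹ * p.2),
    f.2.2.imp fun _ hC p => hC (p.1, γ⁻¹ * p.2)⟩
  map_zero' := Subtype.ext rfl
  map_add' _ _ := Subtype.ext rfl

theorem link_translate (n : ℕ) (γ : R.Gam) (p : R.Vert (n + 1)) (p' : R.Vert n) :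
    R.link n (p.1, γ * p.2) (p'.1, γ * p'.2) = R.link n p p' := by
  unfold link
  have : (γ * p.2)⁻¹ * (γ * p'.2) = p.2⁻¹ * p'.2 := by group
  simp only [this]

theorem step_levelAct (γ : R.Gam) (n : ℕ) (f : R.levelGroup n) :
    R.step n (R.levelAct γ n f) = R.levelAct γ (n + 1) (R.step n f) := by
  refine Subtype.ext (funext fun p => ?_)
  change ∑ᶠ p' : R.Vert n, R.link n p p' * f.1 (p'.1, γ⁻¹ * p'.2) =
    ∑ᶠ p' : R.Vert n, R.link n (p.1, γ⁻¹ * p.2) p' * f.1 p'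
  rw [← finsum_comp_equiv (f := fun p' => R.link n (p.1, γ⁻¹ * p.2) p' * f.1 p')
    ((Equiv.refl (S.Z n)).prodCongr (Equiv.mulLeft γ⁻¹))]
  refine finsum_congr fun p' => ?_
  rw [← R.link_translate n γ⁻¹ p p']
  rfl

theorem trans_levelAct (γ : R.Gam) (m n : ℕ) (h : m ≤ n) :
    (R.levelAct γ n).comp (R.trans m n h) = (R.trans m n h).comp (R.levelAct γ m) := by
  induction n, h using Nat.le_induction with
  | base => rw [trans_self]; rfl
  | succ n h ih =>
    rw [trans_succ _ _ _ h, AddMonoidHom.comp_assoc, ← ih]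
    ext f : 1
    exact (R.step_levelAct γ n _).symm

/-- The action of `Γ` on the dimension group `𝔇` obtained in the limit. -/
def dimAct (γ : R.Gam) : R.DimGroup →+ R.DimGroup :=
  AddCommGroup.DirectLimit.map (fun n => R.levelAct γ n) fun m n h => R.trans_levelAct γ m n h

theorem dimAct_toDim (γ : R.Gam) (n : ℕ) (f : R.levelGroup n) :
    R.dimAct γ (R.toDim n f) = R.toDim n (R.levelAct γ n f) :=
  AddCommGroup.DirectLimit.map_apply_of (G := fun n => R.levelGroup n) (f := R.trans)
    (G' := fun n => R.levelGroup n) (f' := R.trans) (fun n => R.levelAct γ n)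
    (fun m n h => R.trans_levelAct γ m n h) f

/-- The action of `Γ` on the positive cone `𝔇_+`. -/
def dimPosAct (γ : R.Gam) : R.dimPos →+ R.dimPos :=
  ((R.dimAct γ).comp R.dimPos.subtype).codRestrict R.dimPos (by
    rintro ⟨_, n, f, hf, rfl⟩
    exact ⟨n, R.levelAct γ n f, fun p => hf _, (R.dimAct_toDim γ n f).symm⟩)

/-- The additive maps `ψ : 𝔇_+ → [0,∞]` that are `β`-scaling under the action of `Γ`, normal on
every level, and normalized. -/
def lnWeights (β : ℝ) : Set (R.dimPos →+ ℝ≥0∞) :=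
  {ψ | (∀ γ x, ψ (R.dimPosAct γ x) = ENNReal.ofReal (R.gpow γ β) * ψ x) ∧
    (∀ (n : ℕ) (f : ℕ → R.levelPos n) (g : R.levelPos n),
      (∀ p, Monotone fun k => (f k).1.1 p) →
      (∀ p, Tendsto (fun k => (f k).1.1 p) atTop (𝓝 (g.1.1 p))) →
      Monotone (fun k => ψ (R.toDimPos n (f k))) ∧
        Tendsto (fun k => ψ (R.toDimPos n (f k))) atTop (𝓝 (ψ (R.toDimPos n g)))) ∧
    ψ (R.toDimPos 0 (R.dirac 0 (S.root, 1))) = 1}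

end Density

end LimitFlow

end

/-!
# Locally normal KMS states and weights on the dimension group

Both sides are parametrized by the same objects: families `c = (c_z)` of numbers `c_z ≥ 0`, indexed
by the minimal central projections of all levels, with `c_1 = 1` at the root and
`c_{z'} = ∑_z c_z κ(z,z')`, where `κ(z,z') = ∑_γ μ̃((z,γ),(z',1)) γ^β` is the link averaged over the
fibre (`Density.kernel`, `Density.IsHarmonic`). The correspondence `ω ↔ ψ` sends a state to the weight
with the same family, and all the asserted formulas express `c_z` in terms of `ω` or of `ψ`.

*States.* On a full matrix summand `z A_n` the flow is `Ad ρ_z^{it}`, and the matrix units of the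
eigenbasis of `ρ_z` are eigenvectors of it. Uniqueness of bounded analytic functions on the strip
turns the KMS condition into a commutation rule for these matrix units, which forces a KMS state to be
`c_z Tr(ρ_z^{-β} ·) / dim(z)` there (`apply_summand_of_isKMS`). Normality means that the value of the
state is the sum of its values on the summands (`hasSum_of_isNormalMap`, `isNormalMap_of_hasSum`).
The level formulas for `n` and `n + 1` are compatible exactly if `c` is harmonic, because pulling
`Tr(ρ_z^{-β} ·)` back to `z' A_n` gives `κ(z,z') (dim(z) / dim(z')) Tr(ρ_{z'}^{-β} ·)`
(`Density.trace_realPow_mul_block`): the projections `q(γ)` commute with the image of `z' A_n` and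
`ρ_z` is `γ ρ_{z'}` on the range of `q(γ)`. Conversely, for a harmonic family the functionals of the
levels are compatible states (`levelState_emb`, `levelState_one`), they satisfy the KMS condition as
uniform limits of explicit finite sums, and they extend to the limit by density
(`exists_state_of_harmonic`).

*Weights.* By normality, a weight is determined by its values at the Dirac functions, and by the
scaling property by its values `c_z` at `δ_(z,1)` (`Density.apply_toDimPos`, `Density.apply_dirac`).
Applying it to the image of `δ_(z',1)` in the next level shows that `c` is harmonic; finiteness of
`c_z` propagates from the root, because every `z` has a predecessor `z'` with `κ(z,z') > 0`
(`Density.exists_harmonic_of_weight`). Conversely a harmonic family defines compatible weights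
`f ↦ ∑ f(z,γ) c_z γ^β` on the levels (`Density.exists_weight_of_harmonic`).
-/

noncomputable section

namespace LimitFlow

/-! ### Bounded analytic functions on a strip -/

section Strip

variable {β : ℝ}

/-- Bounded continuous functions on the strip between `0` and `β` that are analytic in its
interior. -/
def IsStripFun (β : ℝ) (F : ℂ → ℂ) : Prop :=
  ContinuousOn F (strip β) ∧ DifferentiableOn ℂ F (interior (strip β)) ∧
    ∃ C : ℝ, ∀ w ∈ strip β, ‖F w‖ ≤ C

theorem ofReal_mem_strip (β t : ℝ) : (t : ℂ) ∈ strip β := by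
  simp [strip]

theorem add_mul_I_mem_strip (β t : ℝ) : (t + β * Complex.I : ℂ) ∈ strip β := by
  simp [strip]

theorem interior_strip (β : ℝ) :
    interior (strip β) = {w | w.im ∈ interior (Set.uIcc 0 β)} := by
  change interior (Complex.im ⁻¹' _) = _
  rw [Complex.interior_preimage_im]
  rfl

/-- The maximum principle on the strip, from the three lines theorem; for `β = 0` the strip is the
real line and there is nothing to prove. -/
theorem IsStripFun.norm_le {F : ℂ → ℂ} (hF : IsStripFun β F) {M : ℝ}
    (h0 : ∀ t : ℝ, ‖F t‖ ≤ M) (h1 : ∀ t : ℝ, ‖F (t + β * Complex.I)‖ ≤ M) :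
    ∀ w ∈ strip β, ‖F w‖ ≤ M := by
  intro w hw
  by_cases hβ : β = 0
  · subst hβ
    have : w = (w.re : ℂ) := by
      apply Complex.ext
      · simp
      · simpa [strip] using hw
    rw [this]
    exact h0 _
  have hβ' : (β : ℂ) ≠ 0 := by exact_mod_cast hβ
  -- `s ↦ iβ s` maps the vertical strip `0 ≤ Re s ≤ 1` onto the given one, for either sign of `β`
  have hmaps : Set.MapsTo (fun s : ℂ => β * Complex.I * s)
      (Complex.HadamardThreeLines.verticalClosedStrip 0 1) (strip β) := by
    intro s hs
    have hs' : 0 ≤ s.re ∧ s.re ≤ 1 := by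
      simpa [Complex.HadamardThreeLines.verticalClosedStrip] using hs
    have : (β * Complex.I * s).im = β * s.re := by simp
    change (β * Complex.I * s).im ∈ Set.uIcc 0 β
    rw [this]
    rcases le_total 0 β with h | h
    · rw [Set.uIcc_of_le h]
      exact ⟨mul_nonneg h hs'.1, mul_le_of_le_one_right h hs'.2⟩
    · rw [Set.uIcc_of_ge h]
      exact ⟨by nlinarith [hs'.1, hs'.2], mul_nonpos_of_nonpos_of_nonneg h hs'.1⟩
  have hmaps' : Set.MapsTo (fun s : ℂ => β * Complex.I * s)
      (Complex.HadamardThreeLines.verticalStrip 0 1) (interior (strip β)) := by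
    intro s hs
    have hs' : 0 < s.re ∧ s.re < 1 := by
      simpa [Complex.HadamardThreeLines.verticalStrip] using hs
    rw [interior_strip, Set.mem_ofPred_eq]
    have : (β * Complex.I * s).im = β * s.re := by simp
    rw [this]
    rcases lt_or_gt_of_ne hβ with h | h
    · rw [Set.uIcc_of_ge h.le, interior_Icc]
      exact ⟨by nlinarith [hs'.1, hs'.2], mul_neg_of_neg_of_pos h hs'.1⟩
    · rw [Set.uIcc_of_le h.le, interior_Icc]
      exact ⟨mul_pos h hs'.1, mul_lt_of_lt_one_right h hs'.2⟩
  obtain ⟨hc, hd, C, hC⟩ := hF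
  set G : ℂ → ℂ := fun s => F (β * Complex.I * s)
  have hcl : closure (Complex.HadamardThreeLines.verticalStrip 0 1) =
      Complex.HadamardThreeLines.verticalClosedStrip 0 1 := by
    rw [Complex.HadamardThreeLines.verticalClosedStrip, ← closure_Ioo zero_ne_one,
      ← Complex.closure_preimage_re]
    rfl
  have hG : DiffContOnCl ℂ G (Complex.HadamardThreeLines.verticalStrip 0 1) := by
    refine ⟨hd.comp (by fun_prop) hmaps', ?_⟩
    rw [hcl]
    exact hc.comp (by fun_prop) hmaps
  have hB : BddAbove ((norm ∘ G) '' Complex.HadamardThreeLines.verticalClosedStrip 0 1) := by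
    refine ⟨C, ?_⟩
    rintro _ ⟨s, hs, rfl⟩
    exact hC _ (hmaps hs)
  have hM : 0 ≤ M := (norm_nonneg _).trans (h0 0)
  -- with `M + ε > 0` the interpolated bound `(M + ε)^(1 - Re s) (M + ε)^(Re s)` is `M + ε`
  refine le_of_forall_pos_le_add fun ε hε => ?_
  set s : ℂ := w / (β * Complex.I)
  have hws : β * Complex.I * s = w := by
    simp only [s]
    field_simp [Complex.I_ne_zero]
  have hsre : β * s.re = w.im := by rw [← hws]; simp
  have hs : s ∈ Complex.HadamardThreeLines.verticalClosedStrip 0 1 := by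
    change s.re ∈ Set.Icc 0 1
    have hw' : w.im ∈ Set.uIcc 0 β := hw
    rw [← hsre] at hw'
    rcases lt_or_gt_of_ne hβ with h | h
    · rw [Set.uIcc_of_ge h.le] at hw'
      exact ⟨by nlinarith [hw'.2], by nlinarith [hw'.1]⟩
    · rw [Set.uIcc_of_le h.le] at hw'
      exact ⟨by nlinarith [hw'.1], by nlinarith [hw'.2]⟩
  have key := Complex.HadamardThreeLines.norm_le_interp_of_mem_verticalClosedStrip₀₁' G
    (a := M + ε) (b := M + ε) hs hG hB (by
      intro x hx
      have hx' : x.re = 0 := hx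
      have : (β * Complex.I * x : ℂ) = ((-(β * x.im) : ℝ) : ℂ) := by
        apply Complex.ext <;> simp [hx']
      simp only [G]
      rw [this]
      exact (h0 _).trans (by linarith)) (by
      intro x hx
      have hx' : x.re = 1 := hx
      have : (β * Complex.I * x : ℂ) = ((-(β * x.im) : ℝ) : ℂ) + β * Complex.I := by
        apply Complex.ext <;> simp [hx']
      simp only [G]
      rw [this]
      exact (h1 _).trans (by linarith))
  rw [← Real.rpow_add (by linarith)] at key
  simp only [G, hws, sub_add_cancel, Real.rpow_one] at key
  exact key

theorem IsStripFun.add {F G : ℂ → ℂ} (hF : IsStripFun β F) (hG : IsStripFun β G) :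
    IsStripFun β (fun w => F w + G w) := by
  obtain ⟨hc, hd, C, hC⟩ := hF
  obtain ⟨hc', hd', C', hC'⟩ := hG
  exact ⟨hc.add hc', hd.add hd', C + C', fun w hw =>
    (norm_add_le _ _).trans (add_le_add (hC w hw) (hC' w hw))⟩

theorem IsStripFun.const_mul {F : ℂ → ℂ} (hF : IsStripFun β F) (c : ℂ) :
    IsStripFun β (fun w => c * F w) := by
  obtain ⟨hc, hd, C, hC⟩ := hF
  exact ⟨continuousOn_const.mul hc, hd.const_mul c, ‖c‖ * C, fun w hw => by
    rw [norm_mul]; exact mul_le_mul_of_nonneg_left (hC w hw) (norm_nonneg c)⟩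

theorem IsStripFun.sub {F G : ℂ → ℂ} (hF : IsStripFun β F) (hG : IsStripFun β G) :
    IsStripFun β (fun w => F w - G w) := by
  have := hF.add (hG.const_mul (-1))
  simpa [sub_eq_add_neg] using this

/-- A function on the strip is determined by its values on the real line. -/
theorem IsStripFun.eq_of_eq_real {F G : ℂ → ℂ} (hF : IsStripFun β F) (hG : IsStripFun β G)
    (h : ∀ t : ℝ, F t = G t) (t : ℝ) : F (t + β * Complex.I) = G (t + β * Complex.I) := by
  -- `e^{iNw} (F - G)` vanishes on the real line and is `O(e^{-Nβ})` on the other boundary line.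
  obtain ⟨hc, hd, C, hC⟩ := hF.sub hG
  have hC0 : 0 ≤ C := (norm_nonneg _).trans (hC _ (ofReal_mem_strip β 0))
  by_cases hβ : β = 0
  · subst hβ
    simpa using h t
  have hbase : ∀ w ∈ strip β, |w.im| ≤ |β| := by
    intro w hw
    have hw' : w.im ∈ Set.uIcc 0 β := hw
    rcases le_total 0 β with h | h
    · rw [Set.uIcc_of_le h] at hw'
      rw [abs_of_nonneg hw'.1, abs_of_nonneg h]; exact hw'.2
    · rw [Set.uIcc_of_ge h] at hw'
      rw [abs_of_nonpos hw'.2, abs_of_nonpos h]; linarith [hw'.1]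
  have hbd : ∀ (N : ℝ), ∀ w ∈ strip β, ‖Complex.exp (Complex.I * (N * β) * w) * (F w - G w)‖ ≤
      Real.exp (-(N * β ^ 2)) * C := by
    intro N
    refine IsStripFun.norm_le (β := β)
      (F := fun w => Complex.exp (Complex.I * (N * β) * w) * (F w - G w))
      ⟨ContinuousOn.mul (by fun_prop) hc,
        DifferentiableOn.mul (by fun_prop) hd, Real.exp (|N * β| * |β|) * C, fun w hw => ?_⟩ ?_ ?_
    · rw [norm_mul, Complex.norm_exp]
      refine mul_le_mul (Real.exp_le_exp.2 ?_) (hC w hw) (norm_nonneg _) (Real.exp_pos _).le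
      have : (Complex.I * (N * β) * w).re = -(N * β * w.im) := by simp
      rw [this]
      calc _ ≤ |N * β * w.im| := neg_le_abs _
        _ = |N * β| * |w.im| := abs_mul _ _
        _ ≤ _ := mul_le_mul_of_nonneg_left (hbase w hw) (abs_nonneg _)
    · intro t
      simp only [h t, sub_self, mul_zero, norm_zero]
      positivity
    · intro t
      rw [norm_mul, Complex.norm_exp]
      refine mul_le_mul (Real.exp_le_exp.2 ?_) (hC _ (add_mul_I_mem_strip β t)) (norm_nonneg _)
        (Real.exp_pos _).le
      have : (Complex.I * (N * β) * (t + β * Complex.I)).re = -(N * β * β) := by simp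
      rw [this]
      nlinarith
  -- hence `F = G` below the second boundary line, and on it by continuity
  have hzero : ∀ s : ℝ, s ∈ Set.Ico (0 : ℝ) 1 →
      F (t + (s * β : ℝ) * Complex.I) - G (t + (s * β : ℝ) * Complex.I) = 0 := by
    intro s hs
    have hw : (t + (s * β : ℝ) * Complex.I : ℂ) ∈ strip β := by
      change (t + (s * β : ℝ) * Complex.I : ℂ).im ∈ Set.uIcc 0 β
      have : (t + (s * β : ℝ) * Complex.I : ℂ).im = s * β := by simp
      rw [this]
      rcases le_total 0 β with h | h
      · rw [Set.uIcc_of_le h]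
        exact ⟨mul_nonneg hs.1 h, mul_le_of_le_one_left h hs.2.le⟩
      · rw [Set.uIcc_of_ge h]
        exact ⟨by nlinarith [hs.1, hs.2], mul_nonpos_of_nonneg_of_nonpos hs.1 h⟩
    rw [← norm_eq_zero]
    refine le_antisymm ?_ (norm_nonneg _)
    have hlim : Tendsto (fun N : ℝ => Real.exp (-(N * (β ^ 2 * (1 - s)))) * C) atTop (𝓝 (0 * C)) := by
      refine Tendsto.mul_const _ (Real.tendsto_exp_neg_atTop_nhds_zero.comp ?_)
      refine Tendsto.atTop_mul_const ?_ tendsto_id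
      have := hs.2
      have hb : 0 < β ^ 2 := by positivity
      nlinarith
    rw [zero_mul] at hlim
    refine ge_of_tendsto hlim (Eventually.of_forall fun N => ?_)
    have h1 := hbd N _ hw
    rw [norm_mul, Complex.norm_exp] at h1
    have : (Complex.I * (N * β) * (t + (s * β : ℝ) * Complex.I)).re = -(N * β * (s * β)) := by simp
    rw [this, Real.exp_neg, ← div_eq_inv_mul, div_le_iff₀ (Real.exp_pos _)] at h1
    refine h1.trans (le_of_eq ?_)
    rw [mul_right_comm, ← Real.exp_add]
    ring_nf
  have hcont : Tendsto (fun s : ℝ => F (t + (s * β : ℝ) * Complex.I) -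
      G (t + (s * β : ℝ) * Complex.I)) (𝓝[Set.Ico 0 1] 1)
      (𝓝 (F (t + β * Complex.I) - G (t + β * Complex.I))) := by
    have h2 := hc _ (add_mul_I_mem_strip β t)
    refine h2.tendsto.comp (tendsto_nhdsWithin_iff.2 ⟨?_, ?_⟩)
    · have : Continuous fun s : ℝ => (t + (s * β : ℝ) * Complex.I : ℂ) := by fun_prop
      have h3 := this.tendsto 1
      simp only [one_mul] at h3
      exact h3.mono_left nhdsWithin_le_nhds
    · filter_upwards [self_mem_nhdsWithin] with s hs
      change (t + (s * β : ℝ) * Complex.I : ℂ).im ∈ Set.uIcc 0 β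
      have : (t + (s * β : ℝ) * Complex.I : ℂ).im = s * β := by simp
      rw [this]
      rcases le_total 0 β with h | h
      · rw [Set.uIcc_of_le h]
        exact ⟨mul_nonneg hs.1 h, mul_le_of_le_one_left h hs.2.le⟩
      · rw [Set.uIcc_of_ge h]
        exact ⟨by nlinarith [hs.1, hs.2], mul_nonpos_of_nonneg_of_nonpos hs.1 h⟩
  have hne : (𝓝[Set.Ico (0 : ℝ) 1] 1).NeBot := by
    rw [← mem_closure_iff_nhdsWithin_neBot, closure_Ico zero_ne_one]
    simp
  rw [← sub_eq_zero]
  refine tendsto_nhds_unique hcont (tendsto_const_nhds.congr' ?_)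
  filter_upwards [self_mem_nhdsWithin] with s hs using (hzero s hs).symm

/-- `g` and `h` are the values on the real line and on `ℝ + iβ` of a bounded continuous function on
the strip that is analytic inside. -/
def HasStripExt (β : ℝ) (g h : ℝ → ℂ) : Prop :=
  ∃ F : ℂ → ℂ, IsStripFun β F ∧ ∀ t : ℝ, F t = g t ∧ F (t + β * Complex.I) = h t

theorem isKMS_iff {S : AtomicSequence.{u}} {A : Type v} [CStarAlgebra A] {L : CStarLimit S A}
    {α : InductiveFlow L} {ω : A →ₗ[ℂ] ℂ} : IsKMS α β ω ↔
      ∀ a b, HasStripExt β (fun t => ω (a * α.aut t b)) (fun t => ω (α.aut t b * a)) := by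
  refine forall₂_congr fun a b => exists_congr fun F => ?_
  unfold IsStripFun
  tauto

theorem HasStripExt.add {g h g' h' : ℝ → ℂ} (H : HasStripExt β g h) (H' : HasStripExt β g' h') :
    HasStripExt β (fun t => g t + g' t) (fun t => h t + h' t) := by
  obtain ⟨F, hF, h1⟩ := H
  obtain ⟨F', hF', h1'⟩ := H'
  exact ⟨_, hF.add hF', fun t => by simp only [(h1 t).1, (h1 t).2, (h1' t).1, (h1' t).2, and_self]⟩

theorem HasStripExt.const_mul {g h : ℝ → ℂ} (H : HasStripExt β g h) (c : ℂ) :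
    HasStripExt β (fun t => c * g t) (fun t => c * h t) := by
  obtain ⟨F, hF, h1⟩ := H
  exact ⟨_, hF.const_mul c, fun t => by simp only [(h1 t).1, (h1 t).2, and_self]⟩

theorem HasStripExt.zero : HasStripExt β (fun _ => 0) (fun _ => 0) :=
  ⟨fun _ => 0, ⟨continuousOn_const, differentiableOn_const 0, 0, by simp⟩, by simp⟩

theorem HasStripExt.sum {κ : Type*} (E : Finset κ) {g h : κ → ℝ → ℂ}
    (H : ∀ k ∈ E, HasStripExt β (g k) (h k)) :
    HasStripExt β (fun t => ∑ k ∈ E, g k t) (fun t => ∑ k ∈ E, h k t) := by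
  classical
  induction E using Finset.induction_on with
  | empty => simpa using HasStripExt.zero
  | insert k E hk ih =>
    simp only [Finset.sum_insert hk]
    exact (H k (Finset.mem_insert_self _ _)).add
      (ih fun j hj => H j (Finset.mem_insert_of_mem hj))

/-- The extension is `w ↦ r^{iw}`, which is `r^{-β} r^{it}` at `t + iβ`. -/
theorem HasStripExt.cpow {r : ℝ} (hr : 0 < r) :
    HasStripExt β (fun t => (r : ℂ) ^ ((t : ℂ) * Complex.I))
      (fun t => ((r ^ (-β) : ℝ) : ℂ) * (r : ℂ) ^ ((t : ℂ) * Complex.I)) := by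
  have hr' : (r : ℂ) ≠ 0 := by exact_mod_cast hr.ne'
  have hd : Differentiable ℂ fun w : ℂ => (r : ℂ) ^ (w * Complex.I) := by
    intro w
    exact DifferentiableAt.const_cpow (by fun_prop) (Or.inl hr')
  refine ⟨fun w => (r : ℂ) ^ (w * Complex.I), ⟨hd.continuous.continuousOn, hd.differentiableOn,
    ?_⟩, fun t => ⟨rfl, ?_⟩⟩
  · have hK : IsCompact (Set.uIcc 0 β) := isCompact_uIcc
    obtain ⟨C, hC⟩ := hK.exists_bound_of_continuousOn (f := fun y : ℝ => r ^ (-y))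
      (Continuous.continuousOn (by
        have := hr.ne'
        exact Continuous.rpow continuous_const continuous_neg (fun _ => Or.inl this)))
    refine ⟨C, fun w hw => ?_⟩
    rw [Complex.norm_cpow_eq_rpow_re_of_pos hr]
    have := hC w.im hw
    rw [Real.norm_of_nonneg (Real.rpow_nonneg hr.le _)] at this
    simpa using this
  · simp only []
    rw [add_mul, Complex.cpow_add _ _ hr', Complex.ofReal_cpow hr.le, mul_comm]
    congr 2
    rw [mul_assoc, Complex.I_mul_I]
    push_cast
    ring

/-- Uniform limits of pairs of boundary values are pairs of boundary values. -/
theorem HasStripExt.of_approx {g h : ℝ → ℂ} (H : ∀ ε > 0, ∃ g' h', HasStripExt β g' h' ∧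
    ∀ t, ‖g' t - g t‖ ≤ ε ∧ ‖h' t - h t‖ ≤ ε) : HasStripExt β g h := by
  have hpos : ∀ k : ℕ, (0 : ℝ) < 1 / (k + 1) := fun k => by positivity
  choose g' h' hext hclose using fun k : ℕ => H (1 / (k + 1)) (hpos k)
  choose F hF hFv using hext
  have hdist : ∀ k l : ℕ, ∀ w ∈ strip β, ‖F k w - F l w‖ ≤ 1 / (k + 1) + 1 / (l + 1) := by
    intro k l
    refine ((hF k).sub (hF l)).norm_le (fun t => ?_) (fun t => ?_)
    · simp only [(hFv k t).1, (hFv l t).1]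
      calc ‖g' k t - g' l t‖ = ‖(g' k t - g t) - (g' l t - g t)‖ := by congr 1; ring
        _ ≤ _ := (norm_sub_le _ _).trans (add_le_add (hclose k t).1 (hclose l t).1)
    · simp only [(hFv k t).2, (hFv l t).2]
      calc ‖h' k t - h' l t‖ = ‖(h' k t - h t) - (h' l t - h t)‖ := by congr 1; ring
        _ ≤ _ := (norm_sub_le _ _).trans (add_le_add (hclose k t).2 (hclose l t).2)
  have h0 : Tendsto (fun k : ℕ => (1 : ℝ) / (k + 1)) atTop (𝓝 0) :=
    tendsto_one_div_add_atTop_nhds_zero_nat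
  have hcau : ∀ w ∈ strip β, CauchySeq fun k => F k w := by
    intro w hw
    refine cauchySeq_of_le_tendsto_0' (fun k : ℕ => (1 : ℝ) / (k + 1) + 1 / (k + 1))
      (fun k l hkl => ?_) (by simpa using h0.add h0)
    rw [dist_eq_norm]
    refine (hdist k l w hw).trans (add_le_add le_rfl ?_)
    exact Nat.one_div_le_one_div hkl
  choose! G hG using fun w hw => cauchySeq_tendsto_of_complete (hcau w hw)
  have hle : ∀ k : ℕ, ∀ w ∈ strip β, ‖F k w - G w‖ ≤ 1 / (k + 1) := by
    intro k w hw
    have h1 : Tendsto (fun l : ℕ => ‖F k w - F l w‖) atTop (𝓝 ‖F k w - G w‖) :=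
      ((hG w hw).const_sub _).norm
    have h2 : Tendsto (fun l : ℕ => (1 : ℝ) / (k + 1) + 1 / (l + 1)) atTop
        (𝓝 (1 / (k + 1) + 0)) := h0.const_add _
    rw [add_zero] at h2
    exact le_of_tendsto_of_tendsto' h1 h2 fun l => hdist k l w hw
  have hunif : TendstoUniformlyOn F G atTop (strip β) := by
    rw [Metric.tendstoUniformlyOn_iff]
    intro ε hε
    filter_upwards [h0.eventually_lt_const hε] with k hk w hw
    rw [dist_comm, dist_eq_norm]
    exact (hle k w hw).trans_lt hk
  refine ⟨G, ⟨hunif.continuousOn (Eventually.of_forall fun k => (hF k).1).frequently, ?_, ?_⟩,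
    fun t => ⟨?_, ?_⟩⟩
  · exact ((hunif.mono interior_subset).tendstoLocallyUniformlyOn).differentiableOn
      (Eventually.of_forall fun k => (hF k).2.1) isOpen_interior
  · obtain ⟨C, hC⟩ := (hF 0).2.2
    refine ⟨C + 1, fun w hw => ?_⟩
    have h3 := hle 0 w hw
    simp only [Nat.cast_zero, zero_add, div_one] at h3
    calc ‖G w‖ = ‖F 0 w - (F 0 w - G w)‖ := by congr 1; ring
      _ ≤ _ := (norm_sub_le _ _).trans (add_le_add (hC w hw) h3)
  · refine tendsto_nhds_unique (hG _ (ofReal_mem_strip β t)) ?_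
    simp only [(hFv _ t).1]
    exact tendsto_iff_norm_sub_tendsto_zero.2
      (squeeze_zero (fun _ => norm_nonneg _) (fun k => (hclose k t).1) h0)
  · refine tendsto_nhds_unique (hG _ (add_mul_I_mem_strip β t)) ?_
    simp only [(hFv _ t).2]
    exact tendsto_iff_norm_sub_tendsto_zero.2
      (squeeze_zero (fun _ => norm_nonneg _) (fun k => (hclose k t).2) h0)

end Strip

/-! ### Powers of positive definite matrices and their traces -/

section Trace

variable {ι κ : Type*} [Fintype ι] [DecidableEq ι] [Fintype κ] [DecidableEq κ]

/-- Every trace on a full matrix algebra is a multiple of the standard one. -/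
theorem eq_trace_of_forall_mul_comm [Nonempty κ] (f : Matrix κ κ ℂ →ₗ[ℂ] ℂ)
    (hf : ∀ x y, f (x * y) = f (y * x)) (x : Matrix κ κ ℂ) :
    f x = f 1 / Fintype.card κ * x.trace := by
  let o : κ := Classical.arbitrary κ
  have hoff : ∀ i j, i ≠ j → f (Matrix.single i j 1) = 0 := by
    intro i j hij
    have h1 : (Matrix.single i j 1 : Matrix κ κ ℂ) = Matrix.single i j 1 * Matrix.single j j 1 := by
      simp
    rw [h1, hf, Matrix.single_mul_single_of_ne _ _ _ _ hij.symm, map_zero]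
  have hdiag : ∀ i, f (Matrix.single i i 1) = f (Matrix.single o o 1) := by
    intro i
    have h1 : (Matrix.single i i 1 : Matrix κ κ ℂ) = Matrix.single i o 1 * Matrix.single o i 1 := by
      simp
    have h2 : (Matrix.single o o 1 : Matrix κ κ ℂ) = Matrix.single o i 1 * Matrix.single i o 1 := by
      simp
    rw [h1, hf, ← h2]
  have hform : ∀ y : Matrix κ κ ℂ, f y = f (Matrix.single o o 1) * y.trace := by
    intro y
    conv_lhs => rw [Matrix.matrix_eq_sum_single y]
    rw [map_sum, Matrix.trace, Finset.mul_sum]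
    refine Finset.sum_congr rfl fun i _ => ?_
    rw [map_sum, Finset.sum_eq_single i]
    · rw [← mul_one (y i i), ← smul_eq_mul, ← Matrix.smul_single, map_smul, hdiag, smul_eq_mul,
        mul_comm]
      rfl
    · intro j _ hj
      rw [← mul_one (y i j), ← smul_eq_mul, ← Matrix.smul_single, map_smul, hoff i j hj.symm,
        smul_zero]
    · simp
  have hc : (Fintype.card κ : ℂ) ≠ 0 := by simp
  rw [hform x, hform 1, Matrix.trace_one, mul_div_assoc, div_self hc, mul_one]

variable {R : Matrix ι ι ℂ} (hR : R.IsHermitian)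

/-- The coordinates of a matrix in the eigenbasis of `R`. -/
def eigCoord : Matrix ι ι ℂ ≃⋆ₐ[ℂ] Matrix ι ι ℂ :=
  (Unitary.conjStarAlgAut ℂ (Matrix ι ι ℂ) hR.eigenvectorUnitary).symm

theorem eigCoord_apply (x : Matrix ι ι ℂ) : eigCoord hR x =
    star (hR.eigenvectorUnitary : Matrix ι ι ℂ) * x * (hR.eigenvectorUnitary : Matrix ι ι ℂ) := by
  rw [eigCoord, Unitary.conjStarAlgAut_symm_apply]

theorem trace_eigCoord (x : Matrix ι ι ℂ) : (eigCoord hR x).trace = x.trace := by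
  rw [eigCoord_apply, Matrix.trace_mul_comm, ← Matrix.mul_assoc]
  have h : (hR.eigenvectorUnitary : Matrix ι ι ℂ) * star (hR.eigenvectorUnitary : Matrix ι ι ℂ) = 1 :=
    Unitary.coe_mul_star_self _
  rw [h, Matrix.one_mul]

theorem eigCoord_funCalc (f : ℝ → ℂ) :
    eigCoord hR (funCalc hR f) = Matrix.diagonal fun i => f (hR.eigenvalues i) := by
  have h := Unitary.coe_star_mul_self hR.eigenvectorUnitary
  rw [eigCoord_apply, funCalc, Matrix.mul_assoc, Matrix.mul_assoc, Matrix.mul_assoc, h,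
    Matrix.mul_one, ← Matrix.mul_assoc, h, Matrix.one_mul]

theorem trace_funCalc_mul (f : ℝ → ℂ) (x : Matrix ι ι ℂ) :
    (funCalc hR f * x).trace = ∑ i, f (hR.eigenvalues i) * eigCoord hR x i i := by
  rw [← trace_eigCoord hR, map_mul, eigCoord_funCalc, Matrix.trace]
  simp [Matrix.diagonal_mul]

theorem trace_realPow_mul (s : ℝ) (x : Matrix ι ι ℂ) :
    (realPow hR s * x).trace = ∑ i, ((hR.eigenvalues i ^ s : ℝ) : ℂ) * eigCoord hR x i i :=
  trace_funCalc_mul hR _ x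

theorem trace_realPow (s : ℝ) :
    (realPow hR s).trace = ((∑ i, hR.eigenvalues i ^ s : ℝ) : ℂ) := by
  have := trace_realPow_mul hR s 1
  rw [Matrix.mul_one, map_one] at this
  rw [this]
  simp

theorem posSemidef_eigCoord {x : Matrix ι ι ℂ} (hx : x.PosSemidef) :
    (eigCoord hR x).PosSemidef := by
  rw [eigCoord_apply]
  exact hx.conjTranspose_mul_mul_same _

theorem trace_realPow_mul_nonneg (hpos : R.PosDef) (s : ℝ) {x : Matrix ι ι ℂ}
    (hx : x.PosSemidef) : 0 ≤ (realPow hpos.isHermitian s * x).trace := by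
  rw [trace_realPow_mul]
  refine Finset.sum_nonneg fun i _ => mul_nonneg ?_ (posSemidef_eigCoord _ hx).diag_nonneg
  exact_mod_cast Real.rpow_nonneg (hpos.eigenvalues_pos i).le s

theorem norm_entry_le_norm (x : Matrix ι ι ℂ) (i j : ι) : ‖x i j‖ ≤ ‖x‖ := by
  have h := Matrix.l2_opNorm_mulVec x (EuclideanSpace.single j 1)
  rw [PiLp.norm_single, norm_one, mul_one] at h
  refine le_trans ?_ h
  have h2 := PiLp.norm_apply_le ((EuclideanSpace.equiv ι ℂ).symm
    (x.mulVec (EuclideanSpace.single j (1 : ℂ)))) i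
  refine le_trans (le_of_eq ?_) h2
  simp

theorem norm_trace_realPow_mul_le (hpos : R.PosDef) (s : ℝ) (x : Matrix ι ι ℂ) :
    ‖(realPow hpos.isHermitian s * x).trace‖ ≤ (realPow hpos.isHermitian s).trace.re * ‖x‖ := by
  rw [trace_realPow_mul, trace_realPow, Complex.ofReal_re, Finset.sum_mul]
  refine (norm_sum_le _ _).trans (Finset.sum_le_sum fun i _ => ?_)
  rw [norm_mul, Complex.norm_real,
    Real.norm_of_nonneg (Real.rpow_nonneg (hpos.eigenvalues_pos i).le s)]
  refine mul_le_mul_of_nonneg_left ?_ (Real.rpow_nonneg (hpos.eigenvalues_pos i).le s)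
  refine (norm_entry_le_norm _ i i).trans (le_of_eq ?_)
  exact NonUnitalStarAlgHom.norm_map (eigCoord hpos.isHermitian)
    (eigCoord hpos.isHermitian).injective x

theorem trace_realPow_re_pos [Nonempty ι] (hpos : R.PosDef) (s : ℝ) :
    0 < (realPow hpos.isHermitian s).trace.re := by
  rw [trace_realPow, Complex.ofReal_re]
  exact Finset.sum_pos (fun i _ => Real.rpow_pos_of_pos (hpos.eigenvalues_pos i) s)
    Finset.univ_nonempty

theorem div_cpow_mul_I {a b : ℝ} (ha : 0 < a) (hb : 0 < b) (t : ℝ) :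
    ((a / b : ℝ) : ℂ) ^ ((t : ℂ) * Complex.I) =
      (a : ℂ) ^ ((t : ℂ) * Complex.I) * (b : ℂ) ^ (((-t : ℝ) : ℂ) * Complex.I) := by
  rw [div_eq_mul_inv, Complex.ofReal_mul, Complex.mul_cpow_ofReal_nonneg ha.le (inv_pos.2 hb).le,
    Complex.ofReal_inv, Complex.inv_cpow, ← Complex.cpow_neg]
  · push_cast
    rw [neg_mul]
  · rw [Complex.arg_ofReal_of_nonneg hb.le]
    exact Real.pi_pos.ne

/-- The functional `x ↦ Tr(R^{-β} x)` satisfies the KMS condition for `Ad R^{it}`. -/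
theorem hasStripExt_trace (hpos : R.PosDef) (β : ℝ) (x y : Matrix ι ι ℂ) :
    HasStripExt β
      (fun t => (realPow hpos.isHermitian (-β) *
        (x * (imPow hpos.isHermitian t * y * imPow hpos.isHermitian (-t)))).trace)
      (fun t => (realPow hpos.isHermitian (-β) *
        (imPow hpos.isHermitian t * y * imPow hpos.isHermitian (-t) * x)).trace) := by
  set hR := hpos.isHermitian
  have hl : ∀ i, 0 < hR.eigenvalues i := hpos.eigenvalues_pos
  set X := eigCoord hR x
  set Y := eigCoord hR y
  have hZ : ∀ t i j, eigCoord hR (imPow hR t * y * imPow hR (-t)) i j =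
      Y i j * ((hR.eigenvalues i / hR.eigenvalues j : ℝ) : ℂ) ^ ((t : ℂ) * Complex.I) := by
    intro t i j
    rw [map_mul, map_mul, imPow, imPow, eigCoord_funCalc, eigCoord_funCalc, Matrix.mul_diagonal,
      Matrix.diagonal_mul, div_cpow_mul_I (hl i) (hl j)]
    ring
  have e1 : (fun t => (realPow hR (-β) * (x * (imPow hR t * y * imPow hR (-t)))).trace) =
      fun t : ℝ => ∑ i, ∑ j, (((hR.eigenvalues i ^ (-β) : ℝ) : ℂ) * X i j * Y j i) *
        ((hR.eigenvalues j / hR.eigenvalues i : ℝ) : ℂ) ^ ((t : ℂ) * Complex.I) := by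
    funext t
    rw [trace_realPow_mul]
    refine Finset.sum_congr rfl fun i _ => ?_
    rw [map_mul, Matrix.mul_apply, Finset.mul_sum]
    refine Finset.sum_congr rfl fun j _ => ?_
    rw [hZ]
    ring
  have e2 : (fun t => (realPow hR (-β) * (imPow hR t * y * imPow hR (-t) * x)).trace) =
      fun t : ℝ => ∑ i, ∑ j, (((hR.eigenvalues i ^ (-β) : ℝ) : ℂ) * X i j * Y j i) *
        ((((hR.eigenvalues j / hR.eigenvalues i) ^ (-β) : ℝ) : ℂ) *
        ((hR.eigenvalues j / hR.eigenvalues i : ℝ) : ℂ) ^ ((t : ℂ) * Complex.I)) := by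
    funext t
    rw [trace_realPow_mul, Finset.sum_comm]
    refine Finset.sum_congr rfl fun j _ => ?_
    rw [map_mul, Matrix.mul_apply, Finset.mul_sum]
    refine Finset.sum_congr rfl fun i _ => ?_
    rw [hZ, Real.div_rpow (hl j).le (hl i).le]
    have : ((hR.eigenvalues i ^ (-β) : ℝ) : ℂ) ≠ 0 := by
      exact_mod_cast (Real.rpow_pos_of_pos (hl i) _).ne'
    push_cast
    field_simp
    ring
  rw [e1, e2]
  exact HasStripExt.sum _ fun i _ => HasStripExt.sum _ fun j _ =>
    (HasStripExt.cpow (div_pos (hl j) (hl i))).const_mul _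

end Trace

section CrossTrace

variable {ι κ : Type*} [Fintype ι] [DecidableEq ι] [Fintype κ] [DecidableEq κ]
variable {R : Matrix ι ι ℂ} {R' : Matrix κ κ ℂ} {Γ : Subgroup {x : ℝ // 0 < x}}
variable (hR : R.IsHermitian) (hR' : R'.IsHermitian)
variable {ψ : Matrix κ κ ℂ →ₙₐ[ℂ] Matrix ι ι ℂ}

/-- Only finitely many `q(γ)` are nonzero, and they sum up to the unit of the image of `ψ`. -/
theorem exists_sum_crossProj (h : EigIn hR Γ) (h' : EigIn hR' Γ) :
    ∃ G : Finset Γ, (∀ γ ∉ G, crossProj hR hR' Γ ψ γ = 0) ∧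
      ∑ γ ∈ G, crossProj hR hR' Γ ψ γ = ψ 1 := by
  classical
  obtain ⟨E, hE0, hE1⟩ := h.exists_finset
  obtain ⟨E', hE0', hE1'⟩ := h'.exists_finset
  have hmem : ∀ b ∈ E, ∀ a ∈ E', b * a⁻¹ ∈ Finset.image₂ (fun b a => b * a⁻¹) E E' :=
    fun b hb a ha => Finset.mem_image₂_of_mem hb ha
  refine ⟨Finset.image₂ (fun b a => b * a⁻¹) E E', fun γ hγ => ?_, ?_⟩
  · rw [crossProj_eq_sum hR hR' hE0']
    refine Finset.sum_eq_zero fun a ha => ?_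
    rw [hE0, Matrix.zero_mul]
    intro hb
    exact hγ (by simpa using hmem _ hb a ha)
  · simp only [crossProj_eq_sum hR hR' hE0']
    rw [Finset.sum_comm, ← hE1', map_sum]
    refine Finset.sum_congr rfl fun a ha => ?_
    have h1 : ∑ γ ∈ Finset.image₂ (fun b a => b * a⁻¹) E E',
        eigProj hR ((γ * a : Γ) : {x : ℝ // 0 < x}) = 1 := by
      rw [← hE1]
      symm
      refine Finset.sum_of_injOn (fun b => b * a⁻¹) (fun b _ c _ hbc => mul_right_cancel hbc)
        (fun b hb => hmem b hb a ha) (fun γ _ hγ => hE0 _ fun hγ' => hγ ?_) (fun b _ => ?_)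
      · exact ⟨γ * a, hγ', by simp⟩
      · simp
    rw [← Finset.sum_mul, h1, Matrix.one_mul]

/-- On the range of `q(γ)` the matrix `R` is `γ` times the image of `R'`. -/
theorem realPow_mul_crossProj (h' : EigIn hR' Γ) (s : ℝ) (γ : Γ) :
    realPow hR s * crossProj hR hR' Γ ψ γ = ((((γ : {x : ℝ // 0 < x}) : ℝ) ^ s : ℝ) : ℂ) •
      (crossProj hR hR' Γ ψ γ * ψ (realPow hR' s)) := by
  obtain ⟨E', hE0', -⟩ := h'.exists_finset
  rw [crossProj_eq_sum hR hR' hE0', Finset.mul_sum, Finset.sum_mul, Finset.smul_sum]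
  refine Finset.sum_congr rfl fun a _ => ?_
  rw [Matrix.mul_assoc (eigProj _ _), ← map_mul, realPow, realPow, eigProj_mul_funCalc,
    ← Matrix.mul_assoc, funCalc_mul_eigProj, map_smul, Matrix.mul_smul, Matrix.smul_mul, smul_smul,
    ← Complex.ofReal_mul, ← Real.mul_rpow γ.1.2.le a.1.2.le]
  rfl

/-- As `q(γ)` commutes with the image of `ψ`, the functional `x ↦ Tr(q(γ) ψ(x))` is a trace. -/
theorem trace_crossProj_mul [Nonempty κ] (h : EigIn hR Γ) (h' : EigIn hR' Γ)
    (hψ : ∀ (t : ℝ) x, imPow hR t * ψ x * imPow hR (-t) = ψ (imPow hR' t * x * imPow hR' (-t)))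
    (γ : Γ) (x : Matrix κ κ ℂ) : (crossProj hR hR' Γ ψ γ * ψ x).trace =
      (crossProj hR hR' Γ ψ γ).trace / Fintype.card κ * x.trace := by
  let f : Matrix κ κ ℂ →ₗ[ℂ] ℂ :=
    { toFun := fun x => (crossProj hR hR' Γ ψ γ * ψ x).trace
      map_add' := fun x y => by rw [map_add, Matrix.mul_add, Matrix.trace_add]
      map_smul' := fun c x => by rw [map_smul, Matrix.mul_smul, Matrix.trace_smul]; rfl }
  have hf := eq_trace_of_forall_mul_comm f (fun x y => by
    change (crossProj hR hR' Γ ψ γ * ψ (x * y)).trace = (crossProj hR hR' Γ ψ γ * ψ (y * x)).trace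
    rw [map_mul, map_mul, ← Matrix.mul_assoc, Matrix.trace_mul_comm, ← Matrix.mul_assoc,
      ← crossProj_comm hR hR' h h' hψ, Matrix.mul_assoc]) x
  change (crossProj hR hR' Γ ψ γ * ψ x).trace =
    (crossProj hR hR' Γ ψ γ * ψ 1).trace / Fintype.card κ * x.trace at hf
  rwa [crossProj_mul_one hR hR' h'] at hf

/-- Pulling `Tr(R^s ·)` back along `ψ` gives a multiple of `Tr(R'^s ·)`. -/
theorem trace_realPow_mul_map [Nonempty κ] (h : EigIn hR Γ) (h' : EigIn hR' Γ)
    (hψ : ∀ (t : ℝ) x, imPow hR t * ψ x * imPow hR (-t) = ψ (imPow hR' t * x * imPow hR' (-t)))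
    (s : ℝ) (x : Matrix κ κ ℂ) {G : Finset Γ} (hG : ∑ γ ∈ G, crossProj hR hR' Γ ψ γ = ψ 1) :
    (realPow hR s * ψ x).trace =
      (∑ γ ∈ G, ((((γ : {x : ℝ // 0 < x}) : ℝ) ^ s : ℝ) : ℂ) * (crossProj hR hR' Γ ψ γ).trace) /
        Fintype.card κ * (realPow hR' s * x).trace := by
  have h1 : realPow hR s * ψ x = ∑ γ ∈ G, ((((γ : {x : ℝ // 0 < x}) : ℝ) ^ s : ℝ) : ℂ) •
      (crossProj hR hR' Γ ψ γ * ψ (realPow hR' s * x)) := by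
    calc realPow hR s * ψ x = realPow hR s * ψ 1 * ψ x := by
          rw [Matrix.mul_assoc, ← map_mul, Matrix.one_mul]
      _ = _ := by
        rw [← hG, Finset.mul_sum, Finset.sum_mul]
        refine Finset.sum_congr rfl fun γ _ => ?_
        rw [realPow_mul_crossProj hR hR' h', Matrix.smul_mul, Matrix.mul_assoc, ← map_mul]
  rw [h1, Matrix.trace_sum, Finset.sum_div, Finset.sum_mul]
  refine Finset.sum_congr rfl fun γ _ => ?_
  rw [Matrix.trace_smul, trace_crossProj_mul hR hR' h h' hψ, smul_eq_mul]
  ring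

end CrossTrace

/-! ### Order and normality in algebras of bounded families of matrices -/

section MatrixConvergence

open scoped MatrixOrder

variable {ι : Type*} [Fintype ι] [DecidableEq ι]

theorem starLE_matrix_iff {a b : Matrix ι ι ℂ} : StarLE a b ↔ a ≤ b := by
  rw [← sub_nonneg, CStarAlgebra.nonneg_iff_eq_star_mul_self]
  rfl

theorem starLE_complex_iff {a b : ℂ} : StarLE a b ↔ a ≤ b := by
  rw [← sub_nonneg, CStarAlgebra.nonneg_iff_eq_star_mul_self, StarLE]

theorem eigCoord_self {a : Matrix ι ι ℂ} (ha : a.IsHermitian) :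
    eigCoord ha a = Matrix.diagonal (RCLike.ofReal ∘ ha.eigenvalues) := by
  have := ha.conjStarAlgAut_star_eigenvectorUnitary
  rw [Unitary.conjStarAlgAut_star_apply] at this
  rw [eigCoord_apply, ← this]

theorem norm_le_trace_of_nonneg {a : Matrix ι ι ℂ} (ha : 0 ≤ a) : ‖a‖ ≤ a.trace.re := by
  have hps : a.PosSemidef := Matrix.nonneg_iff_posSemidef.1 ha
  have h1 := eigCoord_self hps.isHermitian
  have h2 : ‖eigCoord hps.isHermitian a‖ = ‖a‖ :=
    NonUnitalStarAlgHom.norm_map (eigCoord hps.isHermitian) (eigCoord hps.isHermitian).injective a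
  have hnn := hps.eigenvalues_nonneg
  have h3 : a.trace.re = ∑ i, hps.isHermitian.eigenvalues i := by
    rw [hps.isHermitian.trace_eq_sum_eigenvalues]
    simp
  rw [← h2, h1, Matrix.l2_opNorm_diagonal, h3]
  refine (pi_norm_le_iff_of_nonneg (Finset.sum_nonneg fun i _ => hnn i)).2 fun i => ?_
  rw [Function.comp_apply, RCLike.norm_ofReal, abs_of_nonneg (hnn i)]
  exact Finset.single_le_sum (fun j _ => hnn j) (Finset.mem_univ i)

/-- An increasing bounded net of Hermitian matrices converges: the norms of the increments are
bounded by the increments of the trace. -/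
theorem exists_tendsto_of_monotone {I : Type*} [Preorder I] [IsDirectedOrder I] [Nonempty I]
    {x : I → Matrix ι ι ℂ} (hx : Monotone x) {a : Matrix ι ι ℂ} (ha : ∀ i, x i ≤ a) :
    ∃ m, Tendsto x atTop (𝓝 m) ∧ (∀ i, x i ≤ m) ∧ m ≤ a := by
  have htr : ∀ y z : Matrix ι ι ℂ, y ≤ z → ‖z - y‖ ≤ z.trace.re - y.trace.re := by
    intro y z hyz
    have := norm_le_trace_of_nonneg (sub_nonneg.2 hyz)
    rwa [Matrix.trace_sub, Complex.sub_re] at this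
  have hmono : Monotone fun i => (x i).trace.re := fun i j hij => by
    have := (norm_nonneg _).trans (htr _ _ (hx hij))
    exact sub_nonneg.1 this
  have hbdd : BddAbove (Set.range fun i => (x i).trace.re) := by
    refine ⟨a.trace.re, ?_⟩
    rintro _ ⟨i, rfl⟩
    exact sub_nonneg.1 ((norm_nonneg _).trans (htr _ _ (ha i)))
  have hC : Cauchy (map x atTop) := by
    refine Metric.cauchy_iff.2 ⟨inferInstance, fun ε hε => ?_⟩
    have hT := tendsto_atTop_ciSup hmono hbdd
    obtain ⟨i, hi⟩ := (hT.eventually (lt_mem_nhds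
      (sub_lt_self (⨆ i, (x i).trace.re) (half_pos hε)))).exists
    have hclose : ∀ j, i ≤ j → ‖x j - x i‖ < ε / 2 := by
      intro j hj
      refine (htr _ _ (hx hj)).trans_lt ?_
      have := le_ciSup hbdd j
      linarith
    refine ⟨x '' Set.Ici i, image_mem_map (Ici_mem_atTop i), ?_⟩
    rintro _ ⟨j, hj, rfl⟩ _ ⟨k, hk, rfl⟩
    rw [dist_eq_norm]
    calc ‖x j - x k‖ = ‖(x j - x i) - (x k - x i)‖ := by rw [sub_sub_sub_cancel_right]
      _ ≤ ‖x j - x i‖ + ‖x k - x i‖ := norm_sub_le _ _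
      _ < ε / 2 + ε / 2 := add_lt_add (hclose j hj) (hclose k hk)
      _ = ε := add_halves ε
  obtain ⟨m, hm⟩ := CompleteSpace.complete hC
  have hm' : Tendsto x atTop (𝓝 m) := hm
  exact ⟨m, hm', fun i => ge_of_tendsto hm' ((eventually_ge_atTop i).mono fun j hj => hx hj),
    le_of_tendsto' hm' ha⟩

end MatrixConvergence

section Block

open scoped MatrixOrder

variable {Z : Type u} {d : Z → ℕ+}

open scoped Classical in
theorem summand_apply (z w : Z) (x : Matrix (Fin (d z)) (Fin (d z)) ℂ) :
    (summand d z x : BlockAlg d) w = (Pi.single z x : ∀ w, Matrix (Fin (d w)) (Fin (d w)) ℂ) w :=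
  rfl

theorem summand_apply_self (z : Z) (x : Matrix (Fin (d z)) (Fin (d z)) ℂ) :
    (summand d z x : BlockAlg d) z = x := by
  classical
  rw [summand_apply, Pi.single_eq_same]

theorem summand_apply_ne {z w : Z} (h : w ≠ z) (x : Matrix (Fin (d z)) (Fin (d z)) ℂ) :
    (summand d z x : BlockAlg d) w = 0 := by
  classical
  rw [summand_apply, Pi.single_eq_of_ne h]

theorem summand_star (z : Z) (x : Matrix (Fin (d z)) (Fin (d z)) ℂ) :
    summand d z (star x) = star (summand d z x) := by
  refine lp.ext (funext fun w => ?_)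
  rw [lp.coeFn_star, Pi.star_apply]
  by_cases h : w = z
  · subst h; rw [summand_apply_self, summand_apply_self]
  · rw [summand_apply_ne h, summand_apply_ne h, star_zero]

theorem summand_mul_left (z : Z) (x : Matrix (Fin (d z)) (Fin (d z)) ℂ) (a : BlockAlg d) :
    summand d z x * a = summand d z (x * a z) := by
  refine lp.ext (funext fun w => ?_)
  rw [lp.infty_coeFn_mul, Pi.mul_apply]
  by_cases h : w = z
  · subst h; rw [summand_apply_self, summand_apply_self]
  · rw [summand_apply_ne h, summand_apply_ne h, zero_mul]

open scoped Classical in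
theorem sum_summand_apply (F : Finset Z) (a : ∀ z, Matrix (Fin (d z)) (Fin (d z)) ℂ) (w : Z) :
    (∑ z ∈ F, summand d z (a z) : BlockAlg d) w = if w ∈ F then a w else 0 := by
  rw [lp.coeFn_sum, Finset.sum_apply]
  by_cases h : w ∈ F
  · rw [if_pos h, Finset.sum_eq_single w, summand_apply_self]
    · exact fun z _ hz => summand_apply_ne hz.symm _
    · exact fun h' => absurd h h'
  · rw [if_neg h]
    exact Finset.sum_eq_zero fun z hz => summand_apply_ne (by rintro rfl; exact h hz) _

theorem one_apply (z : Z) : (1 : BlockAlg d) z = 1 := by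
  rw [lp.infty_coeFn_one]; rfl

/-- The order of the algebra is the componentwise order. -/
theorem starLE_iff {a b : BlockAlg d} : StarLE a b ↔ ∀ z, a z ≤ b z := by
  constructor
  · rintro ⟨c, hc⟩ z
    rw [← starLE_matrix_iff]
    refine ⟨c z, ?_⟩
    have := congrArg (fun x : BlockAlg d => x z) hc
    simpa only [lp.coeFn_sub, Pi.sub_apply, lp.infty_coeFn_mul, Pi.mul_apply, lp.coeFn_star,
      Pi.star_apply] using this
  · intro h
    choose c hc using fun z => starLE_matrix_iff.2 (h z)
    have hbd : Memℓp c ∞ := by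
      refine memℓp_infty ⟨‖b - a‖ + 1, ?_⟩
      rintro _ ⟨z, rfl⟩
      have h1 : ‖c z‖ * ‖c z‖ ≤ ‖b - a‖ := by
        rw [← CStarRing.norm_star_mul_self, ← hc z]
        exact lp.norm_apply_le_norm ENNReal.top_ne_zero (b - a) z
      have h2 := norm_nonneg (c z)
      change ‖c z‖ ≤ _
      nlinarith
    refine ⟨⟨c, hbd⟩, lp.ext (funext fun z => ?_)⟩
    rw [lp.coeFn_sub, Pi.sub_apply, lp.infty_coeFn_mul, Pi.mul_apply, lp.coeFn_star,
      Pi.star_apply]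
    exact hc z

theorem isSelfAdjoint_iff {a : BlockAlg d} : IsSelfAdjoint a ↔ ∀ z, IsSelfAdjoint (a z) :=
  ⟨fun h z =>
    congrArg (fun x : BlockAlg d => x z) h,
  fun h => lp.ext (funext fun z => h z)⟩

/-- A positive element is the supremum of its finite partial sums. -/
theorem isStarLUB_partialSums {a : BlockAlg d} (ha : ∀ z, 0 ≤ a z) :
    IsStarLUB (Set.range fun F : Finset Z => ∑ z ∈ F, summand d z (a z)) a := by
  classical
  refine ⟨?_, fun b hb => starLE_iff.2 fun z => ?_⟩
  · rintro _ ⟨F, rfl⟩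
    refine starLE_iff.2 fun z => ?_
    simp only [sum_summand_apply]
    split_ifs
    · exact le_rfl
    · exact ha z
  · have := starLE_iff.1 (hb _ ⟨{z}, rfl⟩) z
    simpa only [sum_summand_apply, Finset.mem_singleton, if_true] using this

theorem directedOn_partialSums {a : BlockAlg d} (ha : ∀ z, 0 ≤ a z) :
    DirectedOn StarLE (Set.range fun F : Finset Z => ∑ z ∈ F, summand d z (a z)) := by
  classical
  have key : ∀ F G : Finset Z, F ⊆ G →
      StarLE (∑ z ∈ F, summand d z (a z)) (∑ z ∈ G, summand d z (a z)) := by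
    intro F G hFG
    refine starLE_iff.2 fun z => ?_
    simp only [sum_summand_apply]
    by_cases h : z ∈ F
    · rw [if_pos h, if_pos (hFG h)]
    · rw [if_neg h]
      split_ifs
      · exact ha z
      · exact le_rfl
  rintro _ ⟨F, rfl⟩ _ ⟨G, rfl⟩
  exact ⟨_, ⟨F ∪ G, rfl⟩, key _ _ Finset.subset_union_left, key _ _ Finset.subset_union_right⟩

theorem isSelfAdjoint_partialSums {a : BlockAlg d} (ha : ∀ z, 0 ≤ a z) :
    ∀ x ∈ Set.range fun F : Finset Z => ∑ z ∈ F, summand d z (a z), IsSelfAdjoint x := by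
  classical
  rintro _ ⟨F, rfl⟩
  refine isSelfAdjoint_iff.2 fun z => ?_
  simp only [sum_summand_apply]
  split_ifs
  · exact (ha z).isSelfAdjoint
  · exact .zero _

/-- Under a normal map, the image of a positive element is the supremum of the images of its finite
partial sums. -/
theorem IsNormalMap.isStarLUB_partialSums {N : Type*} [Ring N] [StarRing N] {φ : BlockAlg d → N}
    (hφ : IsNormalMap φ) {a : BlockAlg d} (ha : ∀ z, 0 ≤ a z) :
    IsStarLUB (Set.range fun F : Finset Z => φ (∑ z ∈ F, summand d z (a z))) (φ a) := by
  have := hφ _ a (Set.range_nonempty _) (isSelfAdjoint_partialSums ha) (directedOn_partialSums ha)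
    (LimitFlow.isStarLUB_partialSums ha)
  rwa [← Set.range_comp] at this

theorem IsPositiveFunctional.mono {φ : BlockAlg d →ₗ[ℂ] ℂ} (hφ : IsPositiveFunctional φ)
    {a b : BlockAlg d} (h : ∀ z, a z ≤ b z) : φ a ≤ φ b := by
  obtain ⟨c, hc⟩ := starLE_iff.2 h
  rw [← sub_nonneg, ← map_sub, hc]
  exact starLE_complex_iff.1 (hφ c)

/-- Every element of a unital `*`-algebra over `ℂ` is a combination of elements `c* c`. -/
theorem star_mul_self_induction {M : Type*} [Ring M] [StarRing M] [Algebra ℂ M] [StarModule ℂ M]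
    {P : M → Prop} (hsq : ∀ c, P (star c * c)) (hadd : ∀ a b, P a → P b → P (a + b))
    (hsmul : ∀ (c : ℂ) a, P a → P (c • a)) (a : M) : P a := by
  have hI : star Complex.I = -Complex.I := Complex.conj_I
  -- polarization
  have key : a = (1 / 4 : ℂ) • (star (a + 1) * (a + 1) + (-1 : ℂ) • (star (a - 1) * (a - 1)) +
      Complex.I • (star (a + Complex.I • 1) * (a + Complex.I • 1)) +
      (-Complex.I) • (star (a - Complex.I • 1) * (a - Complex.I • 1))) := by
    have hII : ∀ x : M, Complex.I • Complex.I • x = -x := fun x => by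
      rw [smul_smul, Complex.I_mul_I, neg_one_smul]
    simp only [star_add, star_sub, star_smul, star_one, hI, mul_add, add_mul, mul_sub, sub_mul,
      mul_one, one_mul, smul_mul_assoc, mul_smul_comm, smul_add, smul_sub, neg_smul, hII,
      one_smul, smul_neg, neg_mul, neg_neg]
    module
  rw [key]
  exact hsmul _ _ (hadd _ _ (hadd _ _ (hadd _ _ (hsq _) (hsmul _ _ (hsq _)))
    (hsmul _ _ (hsq _))) (hsmul _ _ (hsq _)))

/-- A normal positive functional is the sum of its restrictions to the direct summands. -/
theorem hasSum_of_isNormalMap {φ : BlockAlg d →ₗ[ℂ] ℂ} (hpos : IsPositiveFunctional φ)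
    (hφ : IsNormalMap φ) (a : BlockAlg d) : HasSum (fun z => φ (summand d z (a z))) (φ a) := by
  classical
  refine star_mul_self_induction (P := fun a : BlockAlg d =>
    HasSum (fun z => φ (summand d z (a z))) (φ a)) (fun c => ?_) (fun a b ha hb => ?_)
    (fun k a ha => ?_) a
  · set a := star c * c with ha_def
    have ha : ∀ z, 0 ≤ a z := by
      have h0 := starLE_iff.1 (show StarLE 0 a from ⟨c, by rw [sub_zero]⟩)
      intro z
      simpa using h0 z
    have hnn : ∀ z, 0 ≤ φ (summand d z (a z)) := by
      intro z
      have h1 := hpos.mono (a := 0) (b := summand d z (a z)) (fun w => by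
        by_cases h : w = z
        · subst h; rw [summand_apply_self]; exact ha w
        · rw [summand_apply_ne h]; exact le_rfl)
      rwa [map_zero] at h1
    have hlub := hφ.isStarLUB_partialSums ha
    have hreal : ∀ w : ℂ, 0 ≤ w → ((w.re : ℝ) : ℂ) = w := fun w hw =>
      Complex.ext rfl (by simpa using (Complex.le_def.1 hw).2)
    have ha0 : 0 ≤ φ a := by
      have := starLE_complex_iff.1 (hlub.1 _ ⟨∅, rfl⟩)
      simpa using this
    have hsumre : HasSum (fun z => (φ (summand d z (a z))).re) (φ a).re := by
      refine hasSum_of_isLUB_of_nonneg _ (fun z => (Complex.le_def.1 (hnn z)).1) ⟨?_, ?_⟩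
      · rintro _ ⟨F, rfl⟩
        have := (Complex.le_def.1 (starLE_complex_iff.1 (hlub.1 _ ⟨F, rfl⟩))).1
        simpa only [map_sum, Complex.re_sum] using this
      · intro b hb
        have hb' : φ a ≤ (b : ℂ) := by
          refine starLE_complex_iff.1 (hlub.2 _ ?_)
          rintro _ ⟨F, rfl⟩
          simp only [starLE_complex_iff, map_sum]
          rw [Finset.sum_congr rfl fun z _ => (hreal _ (hnn z)).symm, ← Complex.ofReal_sum]
          exact Complex.real_le_real.2 (hb ⟨F, rfl⟩)
        simpa using (Complex.le_def.1 hb').1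
    have := Complex.hasSum_ofReal.2 hsumre
    simpa only [hreal _ ha0, hreal _ (hnn _)] using this
  · simpa only [lp.coeFn_add, Pi.add_apply, map_add] using ha.add hb
  · simpa only [lp.coeFn_smul, Pi.smul_apply, map_smul] using ha.const_smul k

/-- In a directed family with a supremum, every component converges to that of the supremum. -/
theorem tendsto_apply_of_isStarLUB {I : Type*} [Preorder I] [IsDirectedOrder I] [Nonempty I]
    {x : I → BlockAlg d} (hx : ∀ i j, i ≤ j → ∀ z, x i z ≤ x j z) {a : BlockAlg d}
    (ha : IsStarLUB (Set.range x) a) (z : Z) : Tendsto (fun i => x i z) atTop (𝓝 (a z)) := by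
  have hle : ∀ i w, x i w ≤ a w := fun i => starLE_iff.1 (ha.1 _ ⟨i, rfl⟩)
  obtain ⟨m, hm, hxm, hma⟩ := exists_tendsto_of_monotone (x := fun i => x i z)
    (fun i j hij => hx i j hij z) (fun i => hle i z)
  -- replacing the component at `z` of `a` by the limit gives an upper bound
  have h1 : StarLE a (a + summand d z (m - a z)) := by
    refine ha.2 _ ?_
    rintro _ ⟨i, rfl⟩
    refine starLE_iff.2 fun w => ?_
    rw [lp.coeFn_add, Pi.add_apply]
    by_cases h : w = z
    · subst h
      rw [summand_apply_self, add_sub_cancel]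
      exact hxm i
    · rw [summand_apply_ne h, add_zero]
      exact hle i w
  have h2 := starLE_iff.1 h1 z
  rw [lp.coeFn_add, Pi.add_apply, summand_apply_self, add_sub_cancel] at h2
  rwa [le_antisymm h2 hma]

/-- A positive functional that is the sum of its restrictions to the direct summands is normal. -/
theorem isNormalMap_of_hasSum {φ : BlockAlg d →ₗ[ℂ] ℂ} (hpos : IsPositiveFunctional φ)
    (hφ : ∀ a, HasSum (fun z => φ (summand d z (a z))) (φ a)) : IsNormalMap φ := by
  intro D a hne _ hdir hlub
  have hmono : ∀ x y, StarLE x y → φ x ≤ φ y := fun x y h => hpos.mono (starLE_iff.1 h)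
  refine ⟨?_, fun b hb => ?_⟩
  · rintro _ ⟨x, hx, rfl⟩
    exact starLE_complex_iff.2 (hmono _ _ (hlub.1 x hx))
  let _ : Preorder D :=
    { le := fun x y => StarLE x.1 y.1
      le_refl := fun x => starLE_iff.2 fun _ => le_rfl
      le_trans := fun x y z h1 h2 => starLE_iff.2 fun w =>
        (starLE_iff.1 h1 w).trans (starLE_iff.1 h2 w) }
  have hneD : Nonempty D := hne.to_subtype
  have : IsDirectedOrder D := ⟨fun x y => by
    obtain ⟨w, hw, h1, h2⟩ := hdir x.1 x.2 y.1 y.2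
    exact ⟨⟨w, hw⟩, h1, h2⟩⟩
  have hcomp : ∀ z, Tendsto (fun x : D => x.1 z) atTop (𝓝 (a z)) := fun z =>
    tendsto_apply_of_isStarLUB (x := fun x : D => x.1) (fun i j hij => starLE_iff.1 hij)
      (by rwa [Subtype.range_coe]) z
  have hsum : ∀ x : D, HasSum (fun z => φ (summand d z (a z - x.1 z))) (φ a - φ x.1) := by
    intro x
    have := hφ (a - x.1)
    simpa only [map_sub, lp.coeFn_sub, Pi.sub_apply] using this
  -- dominated convergence: beyond `x₀` the terms are bounded by those of `x₀`
  have x₀ : D := Classical.arbitrary D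
  have hlim : Tendsto (fun x : D => ∑' z, φ (summand d z (a z - x.1 z))) atTop
      (𝓝 (∑' z : Z, (0 : ℂ))) := by
    refine tendsto_tsum_of_dominated_convergence
      (bound := fun z => ‖φ (summand d z (a z - x₀.1 z))‖) (hsum x₀).summable.norm (fun z => ?_) ?_
    · have hc : Continuous fun y : Matrix (Fin (d z)) (Fin (d z)) ℂ => φ (summand d z y) :=
        LinearMap.continuous_of_finiteDimensional
          (φ ∘ₗ (LinearMapClass.linearMap (summand d z)))
      have h0 := (hc.tendsto 0).comp (by simpa using (hcomp z).const_sub (a z))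
      simp only [map_zero] at h0
      exact h0
    · filter_upwards [eventually_ge_atTop x₀] with x hx z
      have hnn : ∀ {y y' : Matrix (Fin (d z)) (Fin (d z)) ℂ}, y ≤ y' →
          φ (summand d z y) ≤ φ (summand d z y') := fun {y y'} hy => hpos.mono fun w => by
        by_cases h : w = z
        · subst h; rw [summand_apply_self, summand_apply_self]; exact hy
        · rw [summand_apply_ne h, summand_apply_ne h]
      have h1 : 0 ≤ φ (summand d z (a z - x.1 z)) := by
        have := hnn (sub_nonneg.2 (starLE_iff.1 (hlub.1 _ x.2) z))
        rwa [map_zero, map_zero] at this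
      exact CStarAlgebra.norm_le_norm_of_nonneg_of_le h1
        (hnn (sub_le_sub_left (starLE_iff.1 hx z) _))
  rw [tsum_zero] at hlim
  simp only [(hsum _).tsum_eq] at hlim
  have hlim' : Tendsto (fun x : D => φ x.1) atTop (𝓝 (φ a)) := by
    have := hlim.const_sub (φ a)
    simpa using this
  exact starLE_complex_iff.2 (le_of_tendsto' hlim' fun x => starLE_complex_iff.1 (hb _ ⟨x, x.2, rfl⟩))

end Block

/-! ### The embeddings in terms of their blocks -/

namespace AtomicSequence

open scoped MatrixOrder

variable (S : AtomicSequence.{u}) (n : ℕ)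

instance nonempty_fin_dim (z : S.Z n) : Nonempty (Fin (S.dim n z)) := ⟨⟨0, (S.dim n z).pos⟩⟩

theorem block_apply (z : S.Z (n + 1)) (z' : S.Z n) (x : S.Mat n z') :
    S.block n z z' x = S.emb n (summand (S.dim n) z' x) z := rfl

theorem block_star (z : S.Z (n + 1)) (z' : S.Z n) (x : S.Mat n z') :
    S.block n z z' (star x) = star (S.block n z z' x) := by
  rw [block_apply, block_apply, summand_star, map_star, lp.coeFn_star, Pi.star_apply]

theorem block_mul_block_of_ne (z : S.Z (n + 1)) {z₁ z₂ : S.Z n} (h : z₁ ≠ z₂) (x : S.Mat n z₁)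
    (y : S.Mat n z₂) : S.block n z z₁ x * S.block n z z₂ y = 0 := by
  rw [block_apply, block_apply, ← Pi.mul_apply, ← lp.infty_coeFn_mul, ← map_mul, summand_mul_left,
    summand_apply_ne h, mul_zero, map_zero, map_zero, lp.coeFn_zero]
  rfl

theorem block_one_nonneg (z : S.Z (n + 1)) (z' : S.Z n) : 0 ≤ S.block n z z' 1 := by
  have h : S.block n z z' 1 = star (S.block n z z' 1) * S.block n z z' 1 := by
    rw [← block_star, star_one, ← map_mul, mul_one]
  rw [h]
  exact star_mul_self_nonneg _

theorem sum_block_one_mul_self (z : S.Z (n + 1)) (F : Finset (S.Z n)) :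
    (∑ z' ∈ F, S.block n z z' 1) * (∑ z' ∈ F, S.block n z z' 1) =
      ∑ z' ∈ F, S.block n z z' 1 := by
  rw [Finset.sum_mul]
  refine Finset.sum_congr rfl fun a ha => ?_
  rw [Finset.mul_sum, Finset.sum_eq_single a]
  · rw [← map_mul, mul_one]
  · exact fun b _ hb => S.block_mul_block_of_ne n z hb.symm 1 1
  · exact fun h => absurd ha h

/-- The projections `z z'` are orthogonal, and the nonzero ones have trace at least `1`, so that there
are at most `dim(z)` of them. -/
theorem finite_support_block (z : S.Z (n + 1)) :
    (Function.support fun z' => S.block n z z' 1).Finite := by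
  by_contra hinf
  obtain ⟨F, hF, hcard⟩ := Set.Infinite.exists_subset_card_eq hinf ((S.dim (n + 1) z : ℕ) + 1)
  obtain ⟨k, hk, htr⟩ := exists_trace_eq_natCast (S.sum_block_one_mul_self n z F)
  have h1 : ∀ z' ∈ F, 1 ≤ (S.block n z z' 1).trace.re := by
    intro z' hz'
    obtain ⟨l, -, hl⟩ := exists_trace_eq_natCast
      (e := S.block n z z' 1) (by rw [← map_mul, mul_one])
    rw [hl, Complex.natCast_re]
    have hl0 : l ≠ 0 := by
      rintro rfl
      refine hF hz' ?_
      rw [Nat.cast_zero] at hl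
      exact (Matrix.PosSemidef.trace_eq_zero_iff
        (Matrix.nonneg_iff_posSemidef.1 (S.block_one_nonneg n z z'))).1 hl
    exact_mod_cast Nat.one_le_iff_ne_zero.2 hl0
  have h2 := Finset.card_nsmul_le_sum F _ _ h1
  rw [← Complex.re_sum, ← Matrix.trace_sum, htr, hcard, Complex.natCast_re] at h2
  rw [Fintype.card_fin] at hk
  have h3 : (S.dim (n + 1) z : ℕ) + 1 ≤ k := by
    rw [nsmul_eq_mul, mul_one] at h2
    exact_mod_cast h2
  omega

/-- The finitely many `z'` with `z z' ≠ 0`. -/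
def preds (z : S.Z (n + 1)) : Finset (S.Z n) := (S.finite_support_block n z).toFinset

theorem block_one_eq_zero {z : S.Z (n + 1)} {z' : S.Z n} (h : z' ∉ S.preds n z) :
    S.block n z z' 1 = 0 := by
  by_contra h'
  exact h (by simpa [preds] using h')

theorem emb_partialSum_apply (z : S.Z (n + 1)) (F : Finset (S.Z n)) :
    S.emb n (∑ z' ∈ F, summand (S.dim n) z' ((1 : S.Alg n) z')) z =
      ∑ z' ∈ F, S.block n z z' 1 := by
  rw [map_sum, lp.coeFn_sum, Finset.sum_apply]
  refine Finset.sum_congr rfl fun z' _ => ?_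
  rw [one_apply]
  rfl

/-- By normality of the embedding, the projections `z z'` add up to `z`. -/
theorem sum_block_one (z : S.Z (n + 1)) : ∑ z' ∈ S.preds n z, S.block n z z' 1 = 1 := by
  classical
  set e := ∑ z' ∈ S.preds n z, S.block n z z' 1 with he
  have hone : ∀ z', (0 : S.Mat n z') ≤ (1 : S.Alg n) z' := fun z' => by
    rw [one_apply]; exact zero_le_one
  have hlub := (S.emb_normal n).isStarLUB_partialSums (a := (1 : S.Alg n)) hone
  rw [map_one] at hlub
  have hle : ∀ (F : Finset (S.Z n)) w,
      S.emb n (∑ z' ∈ F, summand (S.dim n) z' ((1 : S.Alg n) z')) w ≤ 1 := by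
    intro F w
    have := starLE_iff.1 (hlub.1 _ ⟨F, rfl⟩) w
    rwa [one_apply] at this
  -- `1 - (z - e)` is an upper bound of the images of the partial sums
  have hub : StarLE 1 (1 - summand (S.dim (n + 1)) z (1 - e)) := by
    refine hlub.2 _ ?_
    rintro _ ⟨F, rfl⟩
    refine starLE_iff.2 fun w => ?_
    rw [lp.coeFn_sub, Pi.sub_apply, one_apply]
    by_cases h : w = z
    · subst h
      rw [summand_apply_self, sub_sub_cancel]
      change S.emb n (∑ z' ∈ F, summand (S.dim n) z' ((1 : S.Alg n) z')) w ≤ e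
      rw [emb_partialSum_apply, ← Finset.sum_filter_of_ne (p := fun z' => z' ∈ S.preds n w)]
      · refine Finset.sum_le_sum_of_subset_of_nonneg (fun z' hz' => (Finset.mem_filter.1 hz').2)
          fun z' _ _ => S.block_one_nonneg n w z'
      · intro z' _ hz'
        by_contra h
        exact hz' (S.block_one_eq_zero n h)
    · rw [summand_apply_ne h, sub_zero]
      exact hle F w
  have h1 := starLE_iff.1 hub z
  rw [lp.coeFn_sub, Pi.sub_apply, one_apply, summand_apply_self, sub_sub_cancel] at h1
  refine le_antisymm ?_ h1
  have h2 := hle (S.preds n z) z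
  rwa [emb_partialSum_apply] at h2

theorem emb_starLE {a b : S.Alg n} (h : StarLE a b) : StarLE (S.emb n a) (S.emb n b) := by
  obtain ⟨c, hc⟩ := h
  exact ⟨S.emb n c, by rw [← map_sub, hc, map_mul, map_star]⟩

theorem isNormalMap_comp_emb {N : Type*} [Ring N] [StarRing N] {φ : S.Alg (n + 1) → N}
    (hφ : IsNormalMap φ) : IsNormalMap fun a => φ (S.emb n a) := by
  intro D a hne hsa hdir hlub
  have := hφ (S.emb n '' D) (S.emb n a) (hne.image _) ?_ ?_ (S.emb_normal n D a hne hsa hdir hlub)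
  · rwa [Set.image_image] at this
  · rintro _ ⟨x, hx, rfl⟩
    exact (hsa x hx).map (S.emb n)
  · rintro _ ⟨x, hx, rfl⟩ _ ⟨y, hy, rfl⟩
    obtain ⟨w, hw, h1, h2⟩ := hdir x hx y hy
    exact ⟨_, ⟨w, hw, rfl⟩, S.emb_starLE n h1, S.emb_starLE n h2⟩

end AtomicSequence

namespace Density

variable {S : AtomicSequence.{u}} {A : Type v} [CStarAlgebra A] {L : CStarLimit S A}
variable {α : InductiveFlow L} (R : Density α) (β : ℝ)

/-! ### The link averaged over the group, and harmonic families -/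

theorem gpow_pos (γ : R.Gam) : 0 < R.gpow γ β := Real.rpow_pos_of_pos γ.1.2 β

theorem gpow_mul (γ δ : R.Gam) : R.gpow (γ * δ) β = R.gpow γ β * R.gpow δ β :=
  Real.mul_rpow γ.1.2.le δ.1.2.le

theorem gpow_one : R.gpow 1 β = 1 := Real.one_rpow β

theorem gpow_inv (γ : R.Gam) :
    R.gpow γ⁻¹ β = (((γ : {x : ℝ // 0 < x}) : ℝ) ^ (-β)) := by
  rw [Real.rpow_neg γ.1.2.le]
  exact Real.inv_rpow γ.1.2.le β

theorem dimBeta_pos (n : ℕ) (z : S.Z n) : 0 < R.dimBeta β n z :=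
  trace_realPow_re_pos (R.posDef n z) (-β)

theorem trace_realPow_eq_dimBeta (n : ℕ) (z : S.Z n) :
    (realPow (R.herm n z) (-β)).trace = R.dimBeta β n z := by
  rw [dimBeta, trace_realPow, Complex.ofReal_re]

theorem dim_pos (n : ℕ) (z : S.Z n) : (0 : ℝ) < (S.dim n z : ℕ) := by
  exact_mod_cast (S.dim n z).pos

theorem dimBeta_root : R.dimBeta β 0 S.root = 1 := by
  have hev : ∀ i, (R.herm 0 S.root).eigenvalues i = 1 := by
    intro i
    have h1 := eigCoord_self (R.herm 0 S.root)
    have h2 : eigCoord (R.herm 0 S.root) (R.rho 0 S.root) = 1 := by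
      rw [show eigCoord (R.herm 0 S.root) (R.rho 0 S.root) = eigCoord (R.herm 0 S.root) 1 from
        congrArg _ R.rho_root, map_one]
    rw [h2] at h1
    have h3 := congrFun (congrFun h1 i) i
    rw [Matrix.one_apply_eq, Matrix.diagonal_apply_eq, Function.comp_apply] at h3
    have h4 := congrArg Complex.re h3
    simpa using h4.symm
  rw [dimBeta, trace_realPow, Complex.ofReal_re]
  simp only [hev, Real.one_rpow, Finset.sum_const, Finset.card_univ, Fintype.card_fin, S.dim_root]
  simp

/-- The link from `z'` to `z`, averaged over the fibre `Γ` with the weights `γ^β`. -/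
def kernel (n : ℕ) (z : S.Z (n + 1)) (z' : S.Z n) : ℝ :=
  ∑ᶠ γ : R.Gam, R.link n (z, γ) (z', 1) * R.gpow γ β

theorem kernel_nonneg (n : ℕ) (z : S.Z (n + 1)) (z' : S.Z n) : 0 ≤ R.kernel β n z z' :=
  finsum_nonneg fun γ => mul_nonneg (R.link_nonneg n _ _) (R.gpow_pos β γ).le

theorem link_eq (n : ℕ) (z : S.Z (n + 1)) (z' : S.Z n) (γ : R.Gam) :
    R.link n (z, γ) (z', 1) = (R.q n z z' γ⁻¹).trace.re / (S.dim (n + 1) z : ℕ) := by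
  rw [link, mul_one]

theorem q_trace_eq_re (n : ℕ) (z : S.Z (n + 1)) (z' : S.Z n) (γ : R.Gam) :
    (R.q n z z' γ).trace = ((R.q n z z' γ).trace.re : ℂ) := by
  obtain ⟨k, hk⟩ := exists_trace_crossProj (R.herm (n + 1) z) (R.herm n z')
    (R.eigIn _ _) (R.eigIn _ _) (R.block_imPow n z z') γ
  rw [q, hk]
  simp

theorem finite_support_link_fibre (n : ℕ) (z : S.Z (n + 1)) (z' : S.Z n) (δ : R.Gam) :
    (Function.support fun γ : R.Gam => R.link n (z, γ) (z', δ)).Finite := by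
  refine Set.Finite.of_injOn (f := fun γ : R.Gam => ((z', γ⁻¹ * δ) : R.Vert n)) ?_ ?_
    (R.finite_support_link n (z, 1))
  · intro γ hγ
    have h : R.link n (z, γ) (z', δ) ≠ 0 := hγ
    rw [← R.link_translate n γ⁻¹] at h
    simpa using h
  · intro γ _ γ' _ h
    simpa using h

/-- The pull-back of `Tr(ρ_z^{-β} ·)` to `z' A_n`. -/
theorem trace_realPow_mul_block (n : ℕ) (z : S.Z (n + 1)) (z' : S.Z n) (x : S.Mat n z') :
    (realPow (R.herm (n + 1) z) (-β) * S.block n z z' x).trace =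
      R.kernel β n z z' * ((S.dim (n + 1) z : ℕ) / (S.dim n z' : ℕ)) *
        (realPow (R.herm n z') (-β) * x).trace := by
  classical
  -- `link (z, γ) (z', 1)` involves `q(γ⁻¹)`, so the factor `γ^β` becomes `γ^{-β}` at `q(γ)`
  obtain ⟨G, hG0, hG1⟩ := exists_sum_crossProj (ψ := S.block n z z') (R.herm (n + 1) z)
    (R.herm n z') (R.eigIn _ _) (R.eigIn _ _)
  have hd := (dim_pos (n + 1) z).ne'
  have hk : R.kernel β n z z' = (∑ γ ∈ G, (((γ : {x : ℝ // 0 < x}) : ℝ) ^ (-β)) *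
      (R.q n z z' γ).trace.re) / (S.dim (n + 1) z : ℕ) := by
    rw [kernel, ← finsum_comp_equiv (Equiv.inv R.Gam), finsum_eq_sum_of_support_subset (s := G),
      Finset.sum_div]
    · refine Finset.sum_congr rfl fun γ _ => ?_
      rw [Equiv.inv_apply, link_eq, inv_inv, gpow_inv]
      ring
    · intro γ hγ
      by_contra h
      refine hγ ?_
      change R.link n (z, γ⁻¹) (z', 1) * _ = 0
      rw [link_eq, inv_inv, q, hG0 γ h]
      simp
  rw [trace_realPow_mul_map (R.herm (n + 1) z) (R.herm n z') (R.eigIn _ _) (R.eigIn _ _)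
    (R.block_imPow n z z') (-β) x hG1, Fintype.card_fin, hk]
  congr 1
  push_cast
  have hq : ∀ γ, (crossProj (R.herm (n + 1) z) (R.herm n z') R.Gam (S.block n z z') γ).trace =
      ((R.q n z z' γ).trace.re : ℂ) := R.q_trace_eq_re n z z'
  simp only [hq]
  have hd' : ((S.dim (n + 1) z : ℕ) : ℂ) ≠ 0 := by exact_mod_cast hd
  field_simp

/-- `dim_β / dim` is an eigenfunction of the averaged link. -/
theorem sum_kernel_mul (n : ℕ) (z : S.Z (n + 1)) :
    ∑ z' ∈ S.preds n z, R.kernel β n z z' * (R.dimBeta β n z' / (S.dim n z' : ℕ)) =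
      R.dimBeta β (n + 1) z / (S.dim (n + 1) z : ℕ) := by
  have hd := (dim_pos (n + 1) z).ne'
  have h1 : (realPow (R.herm (n + 1) z) (-β)).trace =
      ∑ z' ∈ S.preds n z, (realPow (R.herm (n + 1) z) (-β) * S.block n z z' 1).trace := by
    rw [← Matrix.trace_sum, ← Finset.mul_sum, S.sum_block_one, mul_one]
  simp only [trace_realPow_mul_block, mul_one, trace_realPow_eq_dimBeta] at h1
  rw [eq_div_iff hd, Finset.sum_mul]
  have h2 : ((∑ z' ∈ S.preds n z, R.kernel β n z z' * (R.dimBeta β n z' / (S.dim n z' : ℕ)) *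
      (S.dim (n + 1) z : ℕ) : ℝ) : ℂ) = R.dimBeta β (n + 1) z := by
    rw [h1]
    push_cast
    refine Finset.sum_congr rfl fun z' _ => ?_
    ring
  exact_mod_cast h2

theorem kernel_eq_zero {n : ℕ} {z : S.Z (n + 1)} {z' : S.Z n} (h : z' ∉ S.preds n z) :
    R.kernel β n z z' = 0 := by
  have h1 := R.trace_realPow_mul_block β n z z' 1
  rw [S.block_one_eq_zero n h, mul_zero, Matrix.trace_zero, mul_one, trace_realPow_eq_dimBeta] at h1
  have h2 : R.kernel β n z z' * ((S.dim (n + 1) z : ℕ) / (S.dim n z' : ℕ)) *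
      R.dimBeta β n z' = 0 := by
    apply Complex.ofReal_injective
    push_cast
    exact h1.symm
  have h3 : 0 < ((S.dim (n + 1) z : ℕ) / (S.dim n z' : ℕ) : ℝ) * R.dimBeta β n z' :=
    mul_pos (div_pos (dim_pos _ _) (dim_pos _ _)) (R.dimBeta_pos β n z')
  rw [mul_assoc] at h2
  exact (mul_eq_zero.1 h2).resolve_right h3.ne'

/-- Every `z` has a predecessor, since `dim_β(z) / dim(z)` is not zero. -/
theorem exists_kernel_pos (n : ℕ) (z : S.Z (n + 1)) : ∃ z', 0 < R.kernel β n z z' := by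
  by_contra! h
  have h1 := R.sum_kernel_mul β n z
  have h2 : 0 < R.dimBeta β (n + 1) z / (S.dim (n + 1) z : ℕ) :=
    div_pos (R.dimBeta_pos β _ _) (dim_pos _ _)
  rw [← h1, Finset.sum_eq_zero] at h2
  · exact lt_irrefl _ h2
  · intro z' _
    rw [le_antisymm (h z') (R.kernel_nonneg β n z z'), zero_mul]

/-- The link is invariant under translation by `Γ`, so that averaging it over the fibre above another
point `δ` only introduces the factor `δ^β`. -/
theorem tsum_link_mul_gpow (n : ℕ) (z : S.Z (n + 1)) (z' : S.Z n) (δ : R.Gam) :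
    ∑' γ : R.Gam, ENNReal.ofReal (R.link n (z, γ) (z', δ)) * ENNReal.ofReal (R.gpow γ β) =
      ENNReal.ofReal (R.gpow δ β) * ENNReal.ofReal (R.kernel β n z z') := by
  have h1 : ∑' γ : R.Gam, ENNReal.ofReal (R.link n (z, γ) (z', 1)) * ENNReal.ofReal (R.gpow γ β) =
      ENNReal.ofReal (R.kernel β n z z') := by
    have hfin := R.finite_support_link_fibre n z z' 1
    rw [kernel, finsum_eq_sum_of_support_subset (s := hfin.toFinset), ENNReal.ofReal_sum_of_nonneg,
      tsum_eq_sum (s := hfin.toFinset)]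
    · exact Finset.sum_congr rfl fun γ _ => (ENNReal.ofReal_mul (R.link_nonneg n _ _)).symm
    · intro γ hγ
      have : R.link n (z, γ) (z', 1) = 0 := by simpa using hγ
      rw [this, ENNReal.ofReal_zero, zero_mul]
    · exact fun γ _ => mul_nonneg (R.link_nonneg n _ _) (R.gpow_pos β γ).le
    · intro γ hγ
      simp only [Set.Finite.coe_toFinset, Function.mem_support] at hγ ⊢
      exact left_ne_zero_of_mul hγ
  rw [← h1, ← ENNReal.tsum_mul_left, ← (Equiv.mulLeft δ).tsum_eq]
  refine tsum_congr fun γ => ?_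
  have h2 := R.link_translate n δ (z, γ) (z', 1)
  simp only [mul_one] at h2
  rw [Equiv.coe_mulLeft, h2, gpow_mul, ENNReal.ofReal_mul (R.gpow_pos β δ).le]
  ring

/-- Families `c = (c_z)` with `c_1 = 1` at the root that are harmonic for the averaged link. They
parametrize both the locally normal KMS states and the elements of `lnWeights`. -/
def IsHarmonic (c : ∀ n, S.Z n → ℝ≥0) : Prop :=
  c 0 S.root = 1 ∧ ∀ n z', (c n z' : ℝ≥0∞) =
    ∑' z, (c (n + 1) z : ℝ≥0∞) * ENNReal.ofReal (R.kernel β n z z')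

variable {R β}

/-- The state values `c_z dim_β(z) / dim(z)` of the minimal central projections add up to `1`. -/
theorem IsHarmonic.tsum_mul_eq_one {c : ∀ n, S.Z n → ℝ≥0} (hc : R.IsHarmonic β c) (n : ℕ) :
    ∑' z, (c n z : ℝ≥0∞) * ENNReal.ofReal (R.dimBeta β n z / (S.dim n z : ℕ)) = 1 := by
  induction n with
  | zero =>
    rw [tsum_eq_single S.root fun z hz => absurd (S.eq_root z) hz, hc.1, R.dimBeta_root, S.dim_root]
    simp
  | succ n ih =>
    rw [← ih]
    simp only [hc.2 n, ← ENNReal.tsum_mul_right]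
    rw [ENNReal.tsum_comm]
    refine tsum_congr fun z => ?_
    rw [← R.sum_kernel_mul β n z, ENNReal.ofReal_sum_of_nonneg, tsum_eq_sum (s := S.preds n z),
      Finset.mul_sum]
    · refine Finset.sum_congr rfl fun z' _ => ?_
      rw [ENNReal.ofReal_mul (R.kernel_nonneg β n z z'), mul_assoc]
    · intro z' hz'
      rw [R.kernel_eq_zero β hz', ENNReal.ofReal_zero, mul_zero, zero_mul]
    · exact fun z' _ => mul_nonneg (R.kernel_nonneg β n z z')
        (div_pos (R.dimBeta_pos β _ _) (dim_pos _ _)).le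

end Density

/-! ### From KMS states to harmonic families -/

section MatrixKMS

variable {ι : Type*} [Fintype ι] [DecidableEq ι] {R : Matrix ι ι ℂ} (hR : R.IsHermitian)

/-- The matrix units of the eigenbasis of `R`. -/
def eigUnit (i j : ι) : Matrix ι ι ℂ := (eigCoord hR).symm (Matrix.single i j 1)

theorem imPow_mul_eigUnit (hpos : R.PosDef) (t : ℝ) (i j : ι) :
    imPow hpos.isHermitian t * eigUnit hpos.isHermitian i j * imPow hpos.isHermitian (-t) =
      (((hpos.isHermitian.eigenvalues i / hpos.isHermitian.eigenvalues j : ℝ) : ℂ) ^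
        ((t : ℂ) * Complex.I)) • eigUnit hpos.isHermitian i j := by
  apply EquivLike.injective (eigCoord hpos.isHermitian)
  rw [div_cpow_mul_I (hpos.eigenvalues_pos i) (hpos.eigenvalues_pos j), map_mul, map_mul, map_smul,
    imPow, imPow, eigCoord_funCalc, eigCoord_funCalc, eigUnit, StarAlgEquiv.apply_symm_apply]
  ext k l
  rw [Matrix.mul_diagonal, Matrix.diagonal_mul, Matrix.smul_apply, Matrix.single_apply]
  split_ifs with h
  · rw [h.1, h.2, smul_eq_mul]
    ring
  · simp

/-- A functional is a multiple of `Tr(R^{-β} ·)` if moving the matrix unit `e_ij` of the eigenbasis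
from the left to the right of its argument costs the factor `(r_i / r_j)^{-β}`. -/
theorem eq_mul_trace_realPow [Nonempty ι] (hpos : R.PosDef) (β : ℝ) (f : Matrix ι ι ℂ →ₗ[ℂ] ℂ)
    (hf : ∀ i j y, f (eigUnit hpos.isHermitian i j * y) =
      (((hpos.isHermitian.eigenvalues i / hpos.isHermitian.eigenvalues j) ^ (-β) : ℝ) : ℂ) *
        f (y * eigUnit hpos.isHermitian i j)) (x : Matrix ι ι ℂ) :
    f x = f 1 / (realPow hpos.isHermitian (-β)).trace *
      (realPow hpos.isHermitian (-β) * x).trace := by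
  set hR := hpos.isHermitian
  have hl : ∀ i, 0 < hR.eigenvalues i := hpos.eigenvalues_pos
  have hmul : ∀ i j k, eigUnit hR i j * eigUnit hR j k = eigUnit hR i k := by
    intro i j k
    rw [eigUnit, eigUnit, ← map_mul]
    simp [eigUnit]
  have hmul0 : ∀ i j k l, j ≠ k → eigUnit hR i j * eigUnit hR k l = 0 := by
    intro i j k l h
    rw [eigUnit, eigUnit, ← map_mul, Matrix.single_mul_single_of_ne _ _ _ _ h, map_zero]
  let o : ι := Classical.arbitrary ι
  set C : ℂ := ((hR.eigenvalues o ^ β : ℝ) : ℂ) * f (eigUnit hR o o)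
  have hoff : ∀ i j, i ≠ j → f (eigUnit hR i j) = 0 := by
    intro i j hij
    have h := hf i j (eigUnit hR j j)
    rwa [hmul, hmul0 _ _ _ _ hij.symm, map_zero, mul_zero] at h
  have hdiag : ∀ i, f (eigUnit hR i i) = ((hR.eigenvalues i ^ (-β) : ℝ) : ℂ) * C := by
    intro i
    have h := hf i o (eigUnit hR o i)
    rw [hmul, hmul, Real.div_rpow (hl i).le (hl o).le, Real.rpow_neg (hl o).le β, div_inv_eq_mul]
      at h
    rw [h]
    push_cast
    ring
  have hform : ∀ y, f y = C * (realPow hR (-β) * y).trace := by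
    intro y
    have hy : y = ∑ i, ∑ j, eigCoord hR y i j • eigUnit hR i j := by
      apply EquivLike.injective (eigCoord hR)
      conv_lhs => rw [Matrix.matrix_eq_sum_single (eigCoord hR y)]
      simp only [map_sum, map_smul, eigUnit, StarAlgEquiv.apply_symm_apply, Matrix.smul_single,
        smul_eq_mul, mul_one]
    conv_lhs => rw [hy]
    rw [trace_realPow_mul, map_sum, Finset.mul_sum]
    refine Finset.sum_congr rfl fun i _ => ?_
    rw [map_sum, Finset.sum_eq_single i]
    · rw [map_smul, hdiag, smul_eq_mul]
      ring
    · intro j _ hj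
      rw [map_smul, hoff i j hj.symm, smul_zero]
    · simp
  have htr : (realPow hR (-β)).trace ≠ 0 := fun h => by
    have := trace_realPow_re_pos hpos (-β)
    rw [h] at this
    simp at this
  rw [hform x, hform 1, Matrix.mul_one, mul_div_assoc, div_self htr, mul_one]

end MatrixKMS

section States

variable {S : AtomicSequence.{u}} {A : Type v} [CStarAlgebra A] {L : CStarLimit S A}
variable {α : InductiveFlow L} (R : Density α) (β : ℝ)

/-- The restriction of a functional to the `n`-th algebra. -/
def restrict (L : CStarLimit S A) (ω : A →ₗ[ℂ] ℂ) (n : ℕ) : S.Alg n →ₗ[ℂ] ℂ :=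
  ω ∘ₗ (LinearMapClass.linearMap (L.incl n))

theorem restrict_apply (ω : A →ₗ[ℂ] ℂ) (n : ℕ) (a : S.Alg n) :
    restrict L ω n a = ω (L.incl n a) := rfl

theorem isPositiveFunctional_restrict {ω : A →ₗ[ℂ] ℂ} (hω : IsPositiveFunctional ω) (n : ℕ) :
    IsPositiveFunctional (restrict L ω n) := by
  intro a
  rw [restrict_apply, map_mul, map_star]
  exact hω _

/-- `ω` is given on every level by the family `c`: on `A_n` it is the sum of the functionals
`c_z Tr(ρ_z^{-β} z ·) / dim(z)`. -/
def Represents (c : ∀ n, S.Z n → ℝ≥0) (ω : A →ₗ[ℂ] ℂ) : Prop :=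
  ∀ (n : ℕ) (a : S.Alg n), HasSum (fun z : S.Z n =>
    ((c n z : ℝ) : ℂ) * ((realPow (R.herm n z) (-β) * a z).trace / (S.dim n z : ℕ)))
    (ω (L.incl n a))

variable {R β}

theorem Represents.apply_summand {c : ∀ n, S.Z n → ℝ≥0} {ω : A →ₗ[ℂ] ℂ}
    (h : Represents R β c ω) (n : ℕ) (z : S.Z n) (x : S.Mat n z) :
    ω (L.incl n (summand (S.dim n) z x)) =
      ((c n z : ℝ) : ℂ) * ((realPow (R.herm n z) (-β) * x).trace / (S.dim n z : ℕ)) := by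
  refine (h n (summand (S.dim n) z x)).unique ?_
  convert hasSum_single z fun w hw => ?_ using 1
  · rw [summand_apply_self]
  · rw [summand_apply_ne hw, Matrix.mul_zero, Matrix.trace_zero, zero_div, mul_zero]

theorem Represents.coe_eq {c : ∀ n, S.Z n → ℝ≥0} {ω : A →ₗ[ℂ] ℂ}
    (h : Represents R β c ω) (n : ℕ) (z : S.Z n) :
    (c n z : ℝ) = (S.dim n z : ℕ) / R.dimBeta β n z * (ω (L.incl n (S.centralProj n z))).re := by
  have h1 := h.apply_summand n z 1
  rw [Matrix.mul_one, R.trace_realPow_eq_dimBeta] at h1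
  rw [AtomicSequence.centralProj, h1]
  have hd := (Density.dim_pos n z).ne'
  have hb := (R.dimBeta_pos β n z).ne'
  have : ((c n z : ℝ) : ℂ) * ((R.dimBeta β n z : ℂ) / ((S.dim n z : ℕ) : ℂ)) =
      (((c n z : ℝ) * (R.dimBeta β n z / (S.dim n z : ℕ)) : ℝ) : ℂ) := by push_cast; ring
  rw [this, Complex.ofReal_re]
  field_simp

theorem Represents.family_unique {c c' : ∀ n, S.Z n → ℝ≥0} {ω : A →ₗ[ℂ] ℂ}
    (h : Represents R β c ω) (h' : Represents R β c' ω) : c = c' := by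
  funext n z
  apply NNReal.coe_injective
  rw [h.coe_eq, h'.coe_eq]

/-- Positive functionals on a C*-algebra are continuous. -/
theorem IsPositiveFunctional.continuous {ω : A →ₗ[ℂ] ℂ} (hω : IsPositiveFunctional ω) :
    Continuous ω := by
  let _ := CStarAlgebra.spectralOrder A
  have := CStarAlgebra.spectralOrderedRing A
  let f : A →ₚ[ℂ] ℂ := PositiveLinearMap.mk₀ ω fun x hx => by
    obtain ⟨c, rfl⟩ := CStarAlgebra.nonneg_iff_eq_star_mul_self.1 hx
    exact starLE_complex_iff.1 (hω c)
  exact map_continuous f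

/-- The formula determines `ω` on the union of the algebras `A_n`, hence everywhere. -/
theorem Represents.state_unique {c : ∀ n, S.Z n → ℝ≥0} {ω ω' : A →ₗ[ℂ] ℂ}
    (h : Represents R β c ω) (h' : Represents R β c ω') (hω : IsPositiveFunctional ω)
    (hω' : IsPositiveFunctional ω') : ω = ω' := by
  refine LinearMap.coe_injective (Continuous.ext_on L.dense_iUnion hω.continuous hω'.continuous ?_)
  intro a ha
  obtain ⟨n, b, rfl⟩ := Set.mem_iUnion.1 ha
  exact (h n b).unique (h' n b)

variable (R) in
/-- On a full matrix summand, a KMS state is a multiple of `Tr(ρ_z^{-β} ·)`. -/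
theorem apply_summand_of_isKMS {ω : A →ₗ[ℂ] ℂ} (hω : IsKMS α β ω) (n : ℕ) (z : S.Z n)
    (x : S.Mat n z) : ω (L.incl n (summand (S.dim n) z x)) =
      ω (L.incl n (S.centralProj n z)) / R.dimBeta β n z *
        (realPow (R.herm n z) (-β) * x).trace := by
  rw [← R.trace_realPow_eq_dimBeta]
  refine eq_mul_trace_realPow (R.posDef n z) β
    (restrict L ω n ∘ₗ LinearMapClass.linearMap (summand (S.dim n) z)) (fun i j y => ?_) x
  change ω (L.incl n (summand (S.dim n) z (eigUnit (R.herm n z) i j * y))) =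
    _ * ω (L.incl n (summand (S.dim n) z (y * eigUnit (R.herm n z) i j)))
  have hr : 0 < (R.herm n z).eigenvalues i / (R.herm n z).eigenvalues j :=
    div_pos ((R.posDef n z).eigenvalues_pos i) ((R.posDef n z).eigenvalues_pos j)
  set b := L.incl n (summand (S.dim n) z (eigUnit (R.herm n z) i j)) with hb
  set a := L.incl n (summand (S.dim n) z y)
  have hα : ∀ t : ℝ, α.aut t b = ((((R.herm n z).eigenvalues i / (R.herm n z).eigenvalues j : ℝ) :
      ℂ) ^ ((t : ℂ) * Complex.I)) • b := by
    intro t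
    rw [hb, ← α.incl_level, R.level_summand]
    erw [imPow_mul_eigUnit (R.posDef n z)]
    rw [map_smul, map_smul]
  -- `b` is an eigenvector of the flow, so `ω(a α^t(b))` extends as `r^{iw} ω(a b)`, which is
  -- `r^{-β} ω(a b)` at `w = iβ`; by the KMS condition the value there is also `ω(b a)`
  obtain ⟨F, hF, hFv⟩ := isKMS_iff.1 hω a b
  obtain ⟨G, hG, hGv⟩ := (HasStripExt.cpow (β := β) hr).const_mul (ω (a * b))
  have h0 := hF.eq_of_eq_real hG (fun t => by
    rw [(hFv t).1, (hGv t).1]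
    beta_reduce
    rw [hα, mul_smul_comm, map_smul, smul_eq_mul, mul_comm]) 0
  have h1 := (hFv 0).2
  have h2 := (hGv 0).2
  simp only [α.aut_zero] at h1
  rw [h1, h2] at h0
  rw [map_mul (summand (S.dim n) z), map_mul (L.incl n), map_mul (summand (S.dim n) z),
    map_mul (L.incl n)]
  change ω (b * a) = _ * ω (a * b)
  rw [h0]
  simp [mul_comm]

variable (R) in
/-- Every locally normal KMS state comes from a harmonic family. -/
theorem exists_harmonic_of_state {ω : A →ₗ[ℂ] ℂ} (hω : ω ∈ lnKMSStates α β) :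
    ∃ c, R.IsHarmonic β c ∧ Represents R β c ω := by
  obtain ⟨⟨hpos, hone⟩, hkms, hnorm⟩ := hω
  have hsum : ∀ n (a : S.Alg n),
      HasSum (fun z => ω (L.incl n (summand (S.dim n) z (a z)))) (ω (L.incl n a)) := fun n a =>
    hasSum_of_isNormalMap (isPositiveFunctional_restrict hpos n) (hnorm n) a
  have hp : ∀ n z, 0 ≤ ω (L.incl n (S.centralProj n z)) := by
    intro n z
    have h := hpos (L.incl n (S.centralProj n z))
    rw [← map_star, ← map_mul, AtomicSequence.centralProj, ← summand_star, ← map_mul, star_one,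
      one_mul] at h
    exact starLE_complex_iff.1 h
  have hre : ∀ n z, ω (L.incl n (S.centralProj n z)) =
      ((ω (L.incl n (S.centralProj n z))).re : ℂ) := fun n z =>
    Complex.ext rfl (by simpa using (Complex.le_def.1 (hp n z)).2.symm)
  let c : ∀ n, S.Z n → ℝ≥0 := fun n z =>
    ⟨(S.dim n z : ℕ) / R.dimBeta β n z * (ω (L.incl n (S.centralProj n z))).re,
      mul_nonneg (div_pos (Density.dim_pos n z) (R.dimBeta_pos β n z)).le
        (Complex.le_def.1 (hp n z)).1⟩
  have hc : ∀ n z, (c n z : ℝ) =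
      (S.dim n z : ℕ) / R.dimBeta β n z * (ω (L.incl n (S.centralProj n z))).re := fun n z => rfl
  have hval : ∀ n (z : S.Z n) x, ω (L.incl n (summand (S.dim n) z x)) =
      ((c n z : ℝ) : ℂ) * ((realPow (R.herm n z) (-β) * x).trace / (S.dim n z : ℕ)) := by
    intro n z x
    rw [apply_summand_of_isKMS R hkms, hre, hc]
    have hd : ((S.dim n z : ℕ) : ℂ) ≠ 0 := by exact_mod_cast (Density.dim_pos n z).ne'
    push_cast
    field_simp
  have hrep : Represents R β c ω := fun n a => by
    simpa only [hval] using hsum n a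
  refine ⟨c, ⟨?_, fun n z' => ?_⟩, hrep⟩
  · apply NNReal.coe_injective
    rw [hc, R.dimBeta_root, S.dim_root]
    have h1 : S.centralProj 0 S.root = 1 := by
      refine lp.ext (funext fun z => ?_)
      rw [S.eq_root z, AtomicSequence.centralProj, summand_apply_self, one_apply]
    rw [h1, map_one, hone]
    simp
  · -- evaluate `ω` at the projection `z'`, decomposed in the next algebra
    have h1 := hsum (n + 1) (S.emb n (S.centralProj n z'))
    have hd' := Density.dim_pos n z'
    have hb' := R.dimBeta_pos β n z'
    rw [L.incl_emb] at h1
    have h2 : ∀ z, ω (L.incl (n + 1) (summand (S.dim (n + 1)) z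
        (S.emb n (S.centralProj n z') z))) =
        ((c (n + 1) z * R.kernel β n z z' * (R.dimBeta β n z' / (S.dim n z' : ℕ)) : ℝ) : ℂ) := by
      intro z
      have h3 := R.trace_realPow_mul_block β n z z' 1
      rw [mul_one, R.trace_realPow_eq_dimBeta] at h3
      change (realPow _ _ * S.emb n (S.centralProj n z') z).trace = _ at h3
      rw [hval, h3]
      have hd : ((S.dim (n + 1) z : ℕ) : ℂ) ≠ 0 := by
        exact_mod_cast (Density.dim_pos (n + 1) z).ne'
      push_cast
      field_simp
    simp only [h2] at h1
    rw [hre, Complex.hasSum_ofReal] at h1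
    have h4 := h1.mul_right ((S.dim n z' : ℕ) / R.dimBeta β n z')
    have h5 : ∀ z, (c (n + 1) z * R.kernel β n z z' * (R.dimBeta β n z' / (S.dim n z' : ℕ)) : ℝ) *
        ((S.dim n z' : ℕ) / R.dimBeta β n z') = c (n + 1) z * R.kernel β n z z' := by
      intro z
      field_simp
    simp only [h5] at h4
    rw [mul_comm, ← hc] at h4
    have hnn : ∀ z, 0 ≤ (c (n + 1) z : ℝ) * R.kernel β n z z' := fun z =>
      mul_nonneg (c (n + 1) z).2 (R.kernel_nonneg β n z z')
    have h6 := ENNReal.ofReal_tsum_of_nonneg hnn h4.summable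
    rw [h4.tsum_eq, ENNReal.ofReal_coe_nnreal] at h6
    rw [h6]
    refine tsum_congr fun z => ?_
    rw [ENNReal.ofReal_mul (NNReal.coe_nonneg (c (n + 1) z)), ENNReal.ofReal_coe_nnreal]

end States

/-! ### From harmonic families to KMS states -/

section LevelState

open scoped MatrixOrder

variable {S : AtomicSequence.{u}} {A : Type v} [CStarAlgebra A] {L : CStarLimit S A}
variable {α : InductiveFlow L} {R : Density α} {β : ℝ} {c : ∀ n, S.Z n → ℝ≥0}

/-- The identity `∑_z c_z dim_β(z) / dim(z) = 1` in the reals. -/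
theorem Density.IsHarmonic.hasSum_mass (hc : R.IsHarmonic β c) (n : ℕ) :
    HasSum (fun z => (c n z : ℝ) * (R.dimBeta β n z / (S.dim n z : ℕ))) 1 := by
  have h := hc.tsum_mul_eq_one n
  have hnn : ∀ z, 0 ≤ R.dimBeta β n z / (S.dim n z : ℕ) := fun z =>
    (div_pos (R.dimBeta_pos β n z) (Density.dim_pos n z)).le
  have h1 : ∀ z, (c n z : ℝ≥0∞) * ENNReal.ofReal (R.dimBeta β n z / (S.dim n z : ℕ)) =
      ENNReal.ofReal ((c n z : ℝ) * (R.dimBeta β n z / (S.dim n z : ℕ))) := fun z => by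
    rw [ENNReal.ofReal_mul (NNReal.coe_nonneg _), ENNReal.ofReal_coe_nnreal]
  simp only [h1] at h
  have h2 : Summable fun z => (c n z : ℝ) * (R.dimBeta β n z / (S.dim n z : ℕ)) := by
    have := ENNReal.summable_toReal (h.trans_ne ENNReal.one_ne_top)
    refine this.congr fun z => ?_
    rw [ENNReal.toReal_ofReal (mul_nonneg (NNReal.coe_nonneg _) (hnn z))]
  have h3 := ENNReal.ofReal_tsum_of_nonneg
    (fun z => mul_nonneg (NNReal.coe_nonneg (c n z)) (hnn z)) h2
  rw [h, ENNReal.ofReal_eq_one] at h3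
  rw [← h3]
  exact h2.hasSum

theorem norm_levelTerm_le (n : ℕ) (z : S.Z n) (x : S.Mat n z) :
    ‖((c n z : ℝ) : ℂ) * ((realPow (R.herm n z) (-β) * x).trace / (S.dim n z : ℕ))‖ ≤
      (c n z : ℝ) * (R.dimBeta β n z / (S.dim n z : ℕ)) * ‖x‖ := by
  rw [norm_mul, norm_div, Complex.norm_real, Complex.norm_natCast,
    Real.norm_of_nonneg (NNReal.coe_nonneg _), mul_assoc, div_mul_eq_mul_div]
  refine mul_le_mul_of_nonneg_left (div_le_div_of_nonneg_right ?_ (Nat.cast_nonneg _))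
    (NNReal.coe_nonneg _)
  exact norm_trace_realPow_mul_le (R.posDef n z) (-β) x

theorem norm_apply_le (n : ℕ) (a : S.Alg n) (z : S.Z n) : ‖a z‖ ≤ ‖a‖ :=
  lp.norm_apply_le_norm ENNReal.top_ne_zero a z

theorem norm_levelTerm_le' (n : ℕ) (z : S.Z n) (a : S.Alg n) :
    ‖((c n z : ℝ) : ℂ) * ((realPow (R.herm n z) (-β) * a z).trace / (S.dim n z : ℕ))‖ ≤
      (c n z : ℝ) * (R.dimBeta β n z / (S.dim n z : ℕ)) * ‖a‖ :=
  (norm_levelTerm_le n z (a z)).trans (mul_le_mul_of_nonneg_left (norm_apply_le n a z)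
    (mul_nonneg (NNReal.coe_nonneg _) (div_pos (R.dimBeta_pos β n z) (Density.dim_pos n z)).le))

theorem Density.IsHarmonic.summable (hc : R.IsHarmonic β c) (n : ℕ) (a : S.Alg n) :
    Summable fun z : S.Z n =>
      ((c n z : ℝ) : ℂ) * ((realPow (R.herm n z) (-β) * a z).trace / (S.dim n z : ℕ)) :=
  Summable.of_norm_bounded ((hc.hasSum_mass n).summable.mul_right ‖a‖) fun z =>
    norm_levelTerm_le' n z a

/-- The state of the `n`-th algebra given by a harmonic family. -/
def levelState (hc : R.IsHarmonic β c) (n : ℕ) : S.Alg n →ₗ[ℂ] ℂ where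
  toFun a := ∑' z : S.Z n,
    ((c n z : ℝ) : ℂ) * ((realPow (R.herm n z) (-β) * a z).trace / (S.dim n z : ℕ))
  map_add' a b := by
    rw [← (hc.summable n a).tsum_add (hc.summable n b)]
    refine tsum_congr fun z => ?_
    rw [lp.coeFn_add, Pi.add_apply, Matrix.mul_add, Matrix.trace_add]
    ring
  map_smul' k a := by
    rw [RingHom.id_apply, smul_eq_mul, ← tsum_mul_left]
    refine tsum_congr fun z => ?_
    rw [lp.coeFn_smul, Pi.smul_apply, Matrix.mul_smul, Matrix.trace_smul, smul_eq_mul]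
    ring

theorem hasSum_levelState (hc : R.IsHarmonic β c) (n : ℕ) (a : S.Alg n) :
    HasSum (fun z : S.Z n =>
      ((c n z : ℝ) : ℂ) * ((realPow (R.herm n z) (-β) * a z).trace / (S.dim n z : ℕ)))
      (levelState hc n a) :=
  (hc.summable n a).hasSum

theorem levelState_summand (hc : R.IsHarmonic β c) (n : ℕ) (z : S.Z n) (x : S.Mat n z) :
    levelState hc n (summand (S.dim n) z x) =
      ((c n z : ℝ) : ℂ) * ((realPow (R.herm n z) (-β) * x).trace / (S.dim n z : ℕ)) := by
  refine (hasSum_levelState hc n _).unique ?_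
  convert hasSum_single z fun w hw => ?_ using 1
  · rw [summand_apply_self]
  · rw [summand_apply_ne hw, Matrix.mul_zero, Matrix.trace_zero, zero_div, mul_zero]

theorem levelState_one (hc : R.IsHarmonic β c) (n : ℕ) : levelState hc n 1 = 1 := by
  refine (hasSum_levelState hc n 1).unique ?_
  have h := Complex.hasSum_ofReal.2 (hc.hasSum_mass n)
  rw [Complex.ofReal_one] at h
  convert h using 2 with z
  rw [one_apply, Matrix.mul_one, R.trace_realPow_eq_dimBeta]
  push_cast
  rfl

theorem norm_levelState_le (hc : R.IsHarmonic β c) (n : ℕ) (a : S.Alg n) :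
    ‖levelState hc n a‖ ≤ ‖a‖ := by
  have h := (hc.hasSum_mass n).mul_right ‖a‖
  rw [one_mul] at h
  rw [← (hasSum_levelState hc n a).tsum_eq]
  exact tsum_of_norm_bounded h fun z => norm_levelTerm_le' n z a

theorem isPositiveFunctional_levelState (hc : R.IsHarmonic β c) (n : ℕ) :
    IsPositiveFunctional (levelState hc n) := by
  intro a
  rw [starLE_complex_iff]
  refine (hasSum_levelState hc n (star a * a)).nonneg fun z => ?_
  refine mul_nonneg (by exact_mod_cast NNReal.coe_nonneg _) (div_nonneg ?_ (Nat.cast_nonneg _))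
  refine trace_realPow_mul_nonneg (R.posDef n z) (-β) ?_
  rw [lp.infty_coeFn_mul, Pi.mul_apply, lp.coeFn_star, Pi.star_apply]
  exact Matrix.posSemidef_conjTranspose_mul_self _

theorem isNormalMap_levelState (hc : R.IsHarmonic β c) (n : ℕ) :
    IsNormalMap (levelState hc n) :=
  isNormalMap_of_hasSum (isPositiveFunctional_levelState hc n) fun a => by
    simpa only [levelState_summand] using hasSum_levelState hc n a

/-- Harmonicity makes the states of the levels compatible. Both sides are normal, so that it
suffices to compare them on the direct summands. -/
theorem levelState_emb (hc : R.IsHarmonic β c) (n : ℕ) (a : S.Alg n) :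
    levelState hc (n + 1) (S.emb n a) = levelState hc n a := by
  let f : S.Alg n →ₗ[ℂ] ℂ := levelState hc (n + 1) ∘ₗ LinearMapClass.linearMap (S.emb n)
  have hf : IsPositiveFunctional f := fun b => by
    change StarLE 0 (levelState hc (n + 1) (S.emb n (star b * b)))
    rw [map_mul, map_star]
    exact isPositiveFunctional_levelState hc (n + 1) _
  have h1 : HasSum (fun z' => f (summand (S.dim n) z' (a z'))) (f a) :=
    hasSum_of_isNormalMap hf (S.isNormalMap_comp_emb n (isNormalMap_levelState hc (n + 1))) a
  refine h1.unique ?_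
  convert hasSum_levelState hc n a using 2 with z'
  refine (hasSum_levelState hc (n + 1) (S.emb n (summand (S.dim n) z' (a z')))).unique ?_
  have hk : HasSum (fun z => (c (n + 1) z : ℝ) * R.kernel β n z z') (c n z') := by
    have h2 := hc.2 n z'
    have h3 : ∀ z, (c (n + 1) z : ℝ≥0∞) * ENNReal.ofReal (R.kernel β n z z') =
        ((c (n + 1) z * (R.kernel β n z z').toNNReal : ℝ≥0) : ℝ≥0∞) := fun z => by
      rw [ENNReal.coe_mul, ENNReal.ofReal]
    simp only [h3] at h2
    have hs : Summable fun z => c (n + 1) z * (R.kernel β n z z').toNNReal :=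
      ENNReal.tsum_coe_ne_top_iff_summable.1 (h2.symm.trans_ne ENNReal.coe_ne_top)
    rw [← ENNReal.coe_tsum hs, ENNReal.coe_inj] at h2
    rw [h2]
    have h4 := NNReal.hasSum_coe.2 hs.hasSum
    simpa only [NNReal.coe_mul, Real.coe_toNNReal _ (R.kernel_nonneg β n _ z')] using h4
  have h5 := (Complex.hasSum_ofReal.2 hk).mul_right
    ((realPow (R.herm n z') (-β) * a z').trace / (S.dim n z' : ℕ))
  have h6 : ∀ z, ((c (n + 1) z : ℝ) : ℂ) * ((realPow (R.herm (n + 1) z) (-β) *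
      S.emb n (summand (S.dim n) z' (a z')) z).trace / (S.dim (n + 1) z : ℕ)) =
      (((c (n + 1) z : ℝ) * R.kernel β n z z' : ℝ) : ℂ) *
        ((realPow (R.herm n z') (-β) * a z').trace / (S.dim n z' : ℕ)) := by
    intro z
    rw [← S.block_apply, R.trace_realPow_mul_block β n z z' (a z')]
    have hd : ((S.dim (n + 1) z : ℕ) : ℂ) ≠ 0 := by
      exact_mod_cast (Density.dim_pos (n + 1) z).ne'
    push_cast
    field_simp
  simp only [h6]
  exact h5

theorem level_apply (R : Density α) (n : ℕ) (t : ℝ) (a : S.Alg n) (z : S.Z n) :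
    α.level n t a z = imPow (R.herm n z) t * a z * imPow (R.herm n z) (-t) := R.implements n t a z

theorem norm_level (n : ℕ) (t : ℝ) (a : S.Alg n) : ‖α.level n t a‖ = ‖a‖ :=
  NonUnitalStarAlgHom.norm_map (α.level n t) (EquivLike.injective _) a

/-- The states of the levels satisfy the KMS condition; finite partial sums are explicit and
converge uniformly on the boundary. -/
theorem hasStripExt_levelState (hc : R.IsHarmonic β c) (n : ℕ) (a b : S.Alg n) :
    HasStripExt β (fun t => levelState hc n (a * α.level n t b))
      (fun t => levelState hc n (α.level n t b * a)) := by
  refine HasStripExt.of_approx fun ε hε => ?_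
  set m : S.Z n → ℝ := fun z => (c n z : ℝ) * (R.dimBeta β n z / (S.dim n z : ℕ)) with hm
  have hmass : Summable fun z => m z * (‖a‖ * ‖b‖) :=
    (hc.hasSum_mass n).summable.mul_right _
  obtain ⟨F, hF⟩ := (hmass.hasSum.eventually (Metric.ball_mem_nhds _ hε)).exists
  let T : (z : S.Z n) → S.Mat n z → ℂ := fun z x =>
    ((c n z : ℝ) : ℂ) * ((realPow (R.herm n z) (-β) * x).trace / (S.dim n z : ℕ))
  -- the error made by restricting the sum to `F`
  have herr : ∀ x : S.Alg n, ‖x‖ ≤ ‖a‖ * ‖b‖ →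
      ‖∑ z ∈ F, T z (x z) - levelState hc n x‖ ≤ ε := by
    intro x hx
    have h1 : HasSum (fun z : {z // z ∉ F} => T z (x z))
        (levelState hc n x - ∑ z ∈ F, T z (x z)) := by
      rw [F.hasSum_compl_iff (f := fun z => T z (x z)), sub_add_cancel]
      exact hasSum_levelState hc n x
    have h2 : HasSum (fun z : {z // z ∉ F} => m z * (‖a‖ * ‖b‖))
        ((∑' z, m z * (‖a‖ * ‖b‖)) - ∑ z ∈ F, m z * (‖a‖ * ‖b‖)) := by
      rw [F.hasSum_compl_iff (f := fun z => m z * (‖a‖ * ‖b‖)), sub_add_cancel]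
      exact hmass.hasSum
    rw [norm_sub_rev, ← h1.tsum_eq]
    refine (tsum_of_norm_bounded h2 fun z => ?_).trans ?_
    · refine (norm_levelTerm_le' n z.1 x).trans (mul_le_mul_of_nonneg_left hx ?_)
      exact mul_nonneg (NNReal.coe_nonneg _)
        (div_pos (R.dimBeta_pos β n z.1) (Density.dim_pos n z.1)).le
    · rw [dist_comm, Real.dist_eq] at hF
      exact (le_abs_self _).trans hF.le
  refine ⟨fun t => ∑ z ∈ F, T z ((a * α.level n t b) z),
    fun t => ∑ z ∈ F, T z ((α.level n t b * a) z), HasStripExt.sum F fun z _ => ?_,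
    fun t => ⟨herr _ ?_, herr _ ?_⟩⟩
  · have h := (hasStripExt_trace (R.posDef n z) β (a z) (b z)).const_mul
      ((c n z : ℝ) / (S.dim n z : ℕ) : ℂ)
    convert h using 2 with t t
    · change ((c n z : ℝ) : ℂ) * ((realPow (R.herm n z) (-β) * (a * α.level n t b) z).trace /
        (S.dim n z : ℕ)) = _
      rw [lp.infty_coeFn_mul, Pi.mul_apply, level_apply R, div_mul_eq_mul_div, mul_div_assoc]
    · change ((c n z : ℝ) : ℂ) * ((realPow (R.herm n z) (-β) * (α.level n t b * a) z).trace /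
        (S.dim n z : ℕ)) = _
      rw [lp.infty_coeFn_mul, Pi.mul_apply, level_apply R, div_mul_eq_mul_div, mul_div_assoc]
  · exact (norm_mul_le _ _).trans (by rw [norm_level])
  · exact (norm_mul_le _ _).trans (by rw [norm_level, mul_comm])

end LevelState

section Extension

variable {S : AtomicSequence.{u}} {A : Type v} [CStarAlgebra A] (L : CStarLimit S A)

theorem norm_incl (n : ℕ) (a : S.Alg n) : ‖L.incl n a‖ = ‖a‖ :=
  NonUnitalStarAlgHom.norm_map (L.incl n) (L.incl_injective n) a

/-- An element of `A_m`, seen in the limit, comes from every later `A_n`, and compatible functionals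
take the same value on both. -/
theorem exists_lift {φ : ∀ n, S.Alg n →ₗ[ℂ] ℂ} (hφ : ∀ n a, φ (n + 1) (S.emb n a) = φ n a)
    {m n : ℕ} (h : m ≤ n) (a : S.Alg m) : ∃ b, L.incl n b = L.incl m a ∧ φ n b = φ m a := by
  induction n, h using Nat.le_induction with
  | base => exact ⟨a, rfl, rfl⟩
  | succ n _ ih =>
    obtain ⟨b, hb, hb'⟩ := ih
    exact ⟨S.emb n b, by rw [L.incl_emb, hb], by rw [hφ, hb']⟩

/-- Compatible contractive functionals on the algebras `A_n` extend to the inductive limit. -/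
theorem exists_extension {φ : ∀ n, S.Alg n →ₗ[ℂ] ℂ} (hφ : ∀ n a, φ (n + 1) (S.emb n a) = φ n a)
    (hle : ∀ n a, ‖φ n a‖ ≤ ‖a‖) :
    ∃ ω : A →L[ℂ] ℂ, (∀ a, ‖ω a‖ ≤ ‖a‖) ∧ ∀ n a, ω (L.incl n a) = φ n a := by
  let U : Submodule ℂ A :=
    { carrier := ⋃ n, Set.range (L.incl n)
      zero_mem' := Set.mem_iUnion.2 ⟨0, 0, map_zero _⟩
      add_mem' := by
        intro x y hx hy
        obtain ⟨m, a, rfl⟩ := Set.mem_iUnion.1 hx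
        obtain ⟨n, b, rfl⟩ := Set.mem_iUnion.1 hy
        obtain ⟨a', ha', -⟩ := exists_lift L hφ (le_max_left m n) a
        obtain ⟨b', hb', -⟩ := exists_lift L hφ (le_max_right m n) b
        exact Set.mem_iUnion.2 ⟨max m n, a' + b', by rw [map_add, ha', hb']⟩
      smul_mem' := by
        intro k x hx
        obtain ⟨m, a, rfl⟩ := Set.mem_iUnion.1 hx
        exact Set.mem_iUnion.2 ⟨m, k • a, map_smul _ _ _⟩ }
  have hmem : ∀ n a, L.incl n a ∈ U := fun n a => Set.mem_iUnion.2 ⟨n, a, rfl⟩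
  have hwd : ∀ m n a b, L.incl m a = L.incl n b → φ m a = φ n b := by
    intro m n a b hab
    obtain ⟨a', ha', h1⟩ := exists_lift L hφ (le_max_left m n) a
    obtain ⟨b', hb', h2⟩ := exists_lift L hφ (le_max_right m n) b
    have : a' = b' := L.incl_injective _ (by rw [ha', hb', hab])
    rw [← h1, ← h2, this]
  choose N a ha using fun x : U => Set.mem_iUnion.1 x.2
  have hval : ∀ (x : U) n b, L.incl n b = x.1 → φ (N x) (a x) = φ n b := fun x n b hb =>
    hwd _ _ _ _ ((ha x).trans hb.symm)
  let f : U →ₗ[ℂ] ℂ :=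
    { toFun := fun x => φ (N x) (a x)
      map_add' := by
        rintro ⟨x, hx⟩ ⟨y, hy⟩
        obtain ⟨m, b, rfl⟩ := Set.mem_iUnion.1 hx
        obtain ⟨n, d, rfl⟩ := Set.mem_iUnion.1 hy
        obtain ⟨b', hb', h1⟩ := exists_lift L hφ (le_max_left m n) b
        obtain ⟨d', hd', h2⟩ := exists_lift L hφ (le_max_right m n) d
        rw [hval ⟨_, hx⟩ m b rfl, hval ⟨_, hy⟩ n d rfl, ← h1, ← h2, ← map_add]
        exact hval _ _ _ (by rw [map_add, hb', hd']; rfl)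
      map_smul' := by
        rintro k ⟨x, hx⟩
        obtain ⟨m, b, rfl⟩ := Set.mem_iUnion.1 hx
        rw [hval ⟨_, hx⟩ m b rfl, RingHom.id_apply, ← map_smul]
        exact hval _ _ _ (by rw [map_smul]; rfl) }
  have hf : ∀ x : U, ‖f x‖ ≤ 1 * ‖U.subtype x‖ := by
    rintro ⟨x, hx⟩
    obtain ⟨m, b, rfl⟩ := Set.mem_iUnion.1 hx
    change ‖φ _ _‖ ≤ 1 * ‖L.incl m b‖
    rw [hval _ m b rfl, norm_incl, one_mul]
    exact hle m b
  have hdense : DenseRange U.subtype := by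
    rw [DenseRange, Submodule.coe_subtype, Subtype.range_coe]
    exact L.dense_iUnion
  refine ⟨f.extendOfNorm U.subtype, fun x => ?_, fun n b => ?_⟩
  · have := LinearMap.norm_extendOfNorm_apply_le hdense 1 hf x
    rwa [one_mul] at this
  · have := LinearMap.extendOfNorm_eq hdense ⟨1, hf⟩ ⟨L.incl n b, hmem n b⟩
    rw [Submodule.subtype_apply] at this
    rw [this]
    exact hval _ n b rfl

variable {L}

/-- Two elements of the limit are approximated by elements of one and the same `A_n`. -/
theorem exists_close_pair (a b : A) {ε : ℝ} (hε : 0 < ε) :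
    ∃ n, ∃ a' b' : S.Alg n, ‖a - L.incl n a'‖ < ε ∧ ‖b - L.incl n b'‖ < ε := by
  obtain ⟨x, hx, hxa⟩ := Metric.mem_closure_iff.1 (L.dense_iUnion a) ε hε
  obtain ⟨y, hy, hyb⟩ := Metric.mem_closure_iff.1 (L.dense_iUnion b) ε hε
  obtain ⟨m, a₀, rfl⟩ := Set.mem_iUnion.1 hx
  obtain ⟨n, b₀, rfl⟩ := Set.mem_iUnion.1 hy
  obtain ⟨a', ha', -⟩ := exists_lift L (φ := fun _ => 0) (by simp) (le_max_left m n) a₀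
  obtain ⟨b', hb', -⟩ := exists_lift L (φ := fun _ => 0) (by simp) (le_max_right m n) b₀
  refine ⟨max m n, a', b', ?_, ?_⟩
  · rwa [ha', ← dist_eq_norm]
  · rwa [hb', ← dist_eq_norm]

/-- The KMS condition of a contractive functional has to be checked on the algebras `A_n` only. -/
theorem isKMS_of_level {α : InductiveFlow L} {β : ℝ} {ω : A →L[ℂ] ℂ} (hω : ∀ a, ‖ω a‖ ≤ ‖a‖)
    (h : ∀ n (a b : S.Alg n), HasStripExt β (fun t => ω (L.incl n (a * α.level n t b)))
      (fun t => ω (L.incl n (α.level n t b * a)))) : IsKMS α β (ω : A →ₗ[ℂ] ℂ) := by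
  rw [isKMS_iff]
  intro a b
  refine HasStripExt.of_approx fun ε hε => ?_
  obtain ⟨δ, hδ, hδ1, hδ2⟩ : ∃ δ : ℝ, 0 < δ ∧ δ ≤ 1 ∧ δ * (‖a‖ + ‖b‖ + 1) ≤ ε := by
    have hp : 0 < ‖a‖ + ‖b‖ + 1 := by positivity
    refine ⟨min 1 (ε / (‖a‖ + ‖b‖ + 1)), lt_min one_pos (div_pos hε hp), min_le_left _ _, ?_⟩
    calc _ ≤ ε / (‖a‖ + ‖b‖ + 1) * (‖a‖ + ‖b‖ + 1) :=
          mul_le_mul_of_nonneg_right (min_le_right _ _) hp.le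
      _ = ε := div_mul_cancel₀ _ hp.ne'
  obtain ⟨n, a', b', ha', hb'⟩ := exists_close_pair (L := L) a b hδ
  refine ⟨_, _, h n a' b', fun t => ?_⟩
  have hnorm : ∀ x, ‖α.aut t x‖ = ‖x‖ := fun x =>
    NonUnitalStarAlgHom.norm_map (α.aut t) (EquivLike.injective _) x
  set x := L.incl n a'
  set y := α.aut t (L.incl n b')
  have hy : L.incl n (α.level n t b') = y := α.incl_level n t b'
  have hyb : ‖α.aut t b - y‖ ≤ δ := by
    rw [← map_sub, hnorm]
    exact hb'.le
  have hxa : ‖a - x‖ ≤ δ := ha'.le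
  have hxn : ‖x‖ ≤ ‖a‖ + 1 := by
    calc ‖x‖ = ‖a - (a - x)‖ := by rw [sub_sub_cancel]
      _ ≤ ‖a‖ + ‖a - x‖ := norm_sub_le _ _
      _ ≤ ‖a‖ + 1 := by linarith
  have hbn : ‖α.aut t b‖ = ‖b‖ := hnorm b
  have hprod : ‖a - x‖ * ‖α.aut t b‖ + ‖x‖ * ‖α.aut t b - y‖ ≤ ε := by
    refine le_trans ?_ hδ2
    have h1 : ‖a - x‖ * ‖α.aut t b‖ ≤ δ * ‖b‖ := by
      rw [hbn]; exact mul_le_mul_of_nonneg_right hxa (norm_nonneg _)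
    have h2 : ‖x‖ * ‖α.aut t b - y‖ ≤ (‖a‖ + 1) * δ :=
      mul_le_mul hxn hyb (norm_nonneg _) (by positivity)
    linarith
  constructor
  · change ‖ω (L.incl n (a' * α.level n t b')) - ω (a * α.aut t b)‖ ≤ ε
    rw [map_mul, hy, ← map_sub]
    refine (hω _).trans ?_
    calc ‖x * y - a * α.aut t b‖ = ‖(a - x) * α.aut t b + x * (α.aut t b - y)‖ := by
          rw [norm_sub_rev]; congr 1; noncomm_ring
      _ ≤ ‖a - x‖ * ‖α.aut t b‖ + ‖x‖ * ‖α.aut t b - y‖ :=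
          (norm_add_le _ _).trans (add_le_add (norm_mul_le _ _) (norm_mul_le _ _))
      _ ≤ ε := hprod
  · change ‖ω (L.incl n (α.level n t b' * a')) - ω (α.aut t b * a)‖ ≤ ε
    rw [map_mul, hy, ← map_sub]
    refine (hω _).trans ?_
    calc ‖y * x - α.aut t b * a‖ = ‖α.aut t b * (a - x) + (α.aut t b - y) * x‖ := by
          rw [norm_sub_rev]; congr 1; noncomm_ring
      _ ≤ ‖α.aut t b‖ * ‖a - x‖ + ‖α.aut t b - y‖ * ‖x‖ :=
          (norm_add_le _ _).trans (add_le_add (norm_mul_le _ _) (norm_mul_le _ _))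
      _ ≤ ε := by rwa [mul_comm, mul_comm ‖_ - y‖]

/-- Every harmonic family comes from a locally normal KMS state. -/
theorem exists_state_of_harmonic {α : InductiveFlow L} {R : Density α} {β : ℝ}
    {c : ∀ n, S.Z n → ℝ≥0} (hc : R.IsHarmonic β c) :
    ∃ ω ∈ lnKMSStates α β, Represents R β c ω := by
  obtain ⟨ω, hω, hval⟩ := exists_extension L (levelState_emb hc) (norm_levelState_le hc)
  refine ⟨(ω : A →ₗ[ℂ] ℂ), ⟨⟨fun a => ?_, ?_⟩, isKMS_of_level hω fun n a b => ?_, fun n => ?_⟩,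
    fun n a => ?_⟩
  · rw [starLE_complex_iff]
    have hcl : IsClosed {a : A | 0 ≤ ω (star a * a)} :=
      isClosed_le continuous_const (by fun_prop)
    refine (hcl.closure_subset_iff.2 ?_) (L.dense_iUnion a)
    intro x hx
    obtain ⟨n, b, rfl⟩ := Set.mem_iUnion.1 hx
    change 0 ≤ ω (star (L.incl n b) * L.incl n b)
    rw [← map_star, ← map_mul, hval]
    exact starLE_complex_iff.1 (isPositiveFunctional_levelState hc n b)
  · change ω 1 = 1
    rw [← map_one (L.incl 0), hval, levelState_one]
  · simp only [hval]
    exact hasStripExt_levelState hc n a b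
  · have h : (fun a : S.Alg n => (ω : A →ₗ[ℂ] ℂ) (L.incl n a)) = fun a => levelState hc n a :=
      funext fun a => hval n a
    rw [h]
    exact isNormalMap_levelState hc n
  · change HasSum _ (ω (L.incl n a))
    rw [hval]
    exact hasSum_levelState hc n a

end Extension

namespace Density

/-! ### Weights on the dimension group -/

variable {S : AtomicSequence.{u}} {A : Type v} [CStarAlgebra A] {L : CStarLimit S A}
variable {α : InductiveFlow L} (R : Density α) {β : ℝ}

instance countable_gam : Countable R.Gam := by
  have hset : {g : {x : ℝ // 0 < x} | ∃ n z i, (g : ℝ) = (R.herm n z).eigenvalues i}.Countable := by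
    have : ∀ n, Countable (S.Z n) := S.countable_Z
    refine (Set.countable_range fun p : (Σ n, Σ z : S.Z n, Fin (S.dim n z)) =>
      (⟨(R.herm p.1 p.2.1).eigenvalues p.2.2, (R.posDef p.1 p.2.1).eigenvalues_pos p.2.2⟩ :
        {x : ℝ // 0 < x})).mono ?_
    rintro g ⟨n, z, i, h⟩
    exact ⟨⟨n, z, i⟩, Subtype.ext h.symm⟩
  have := hset.to_subtype
  refine Set.Countable.to_subtype (s := (R.Gam : Set {x : ℝ // 0 < x})) ?_
  change ((Subgroup.closure _ : Subgroup {x : ℝ // 0 < x}) : Set {x : ℝ // 0 < x}).Countable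
  rw [FreeGroup.closure_eq_range, MonoidHom.coe_range]
  exact Set.countable_range _

instance countable_vert (n : ℕ) : Countable (R.Vert n) := by
  have := S.countable_Z n
  exact inferInstanceAs (Countable (S.Z n × R.Gam))

instance directedSystem_trans :
    DirectedSystem (fun n => R.levelGroup n) fun _ _ h => R.trans _ _ h where
  map_self i x := by rw [trans_self]; rfl
  map_map {k j i} hij hjk x := by
    induction k, hjk using Nat.le_induction with
    | base => rw [trans_self]; rfl
    | succ k hjk ih =>
      rw [R.trans_succ j k hjk, R.trans_succ i k (hij.trans hjk)]
      exact congrArg (R.step k) ih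

/-- The connecting map between the positive cones of consecutive levels. -/
def stepPos (n : ℕ) (f : R.levelPos n) : R.levelPos (n + 1) :=
  ⟨R.step n f.1, R.step_nonneg n f.2⟩

/-- The connecting maps between the positive cones. -/
def transPos (m n : ℕ) (h : m ≤ n) (f : R.levelPos m) : R.levelPos n :=
  ⟨R.trans m n h f.1, R.trans_nonneg m n h f.2⟩

theorem toDimPos_transPos (m n : ℕ) (h : m ≤ n) (f : R.levelPos m) :
    R.toDimPos n (R.transPos m n h f) = R.toDimPos m f :=
  Subtype.ext (R.toDim_trans m n h f.1)

theorem toDimPos_stepPos (n : ℕ) (f : R.levelPos n) :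
    R.toDimPos (n + 1) (R.stepPos n f) = R.toDimPos n f := by
  rw [← R.toDimPos_transPos n (n + 1) n.le_succ f]
  congr 1
  refine Subtype.ext ?_
  change R.step n f.1 = R.trans n (n + 1) _ f.1
  rw [R.trans_succ n n le_rfl, trans_self]
  rfl

theorem exists_toDimPos (x : R.dimPos) : ∃ n f, R.toDimPos n f = x := by
  obtain ⟨_, n, f, hf, rfl⟩ := x
  exact ⟨n, ⟨f, hf⟩, rfl⟩

/-- Positive functions with the same image in the limit agree from some level on. -/
theorem exists_transPos_eq {m n : ℕ} {f : R.levelPos m} {g : R.levelPos n}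
    (h : R.toDimPos m f = R.toDimPos n g) :
    ∃ k, ∃ hm : m ≤ k, ∃ hn : n ≤ k, R.transPos m k hm f = R.transPos n k hn g := by
  have h1 : R.toDim (max m n) (R.trans m _ (le_max_left m n) f.1 -
      R.trans n _ (le_max_right m n) g.1) = 0 := by
    rw [map_sub, toDim_trans, toDim_trans, sub_eq_zero]
    exact congrArg Subtype.val h
  obtain ⟨k, hk, h2⟩ := AddCommGroup.DirectLimit.of.zero_exact _ _ h1
  rw [map_sub, sub_eq_zero] at h2
  refine ⟨k, (le_max_left m n).trans hk, (le_max_right m n).trans hk, Subtype.ext ?_⟩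
  have h3 := DirectedSystem.map_map (f := fun _ _ h => R.trans _ _ h) (le_max_left m n) hk f.1
  have h4 := DirectedSystem.map_map (f := fun _ _ h => R.trans _ _ h) (le_max_right m n) hk g.1
  exact h3.symm.trans (h2.trans h4)

/-- The value at a vertex of the weight given by a family `c`. -/
def vertexWeight (β : ℝ) (c : ∀ n, S.Z n → ℝ≥0) (n : ℕ) (p : R.Vert n) : ℝ≥0∞ :=
  (c n p.1 : ℝ≥0∞) * ENNReal.ofReal (R.gpow p.2 β)

theorem ofReal_step (n : ℕ) (f : R.levelPos n) (p : R.Vert (n + 1)) :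
    ENNReal.ofReal ((R.stepPos n f).1.1 p) =
      ∑' p', ENNReal.ofReal (R.link n p p') * ENNReal.ofReal (f.1.1 p') := by
  have hfin := R.finite_support_link n p
  change ENNReal.ofReal (∑ᶠ p', R.link n p p' * f.1.1 p') = _
  rw [finsum_eq_sum_of_support_subset (s := hfin.toFinset), ENNReal.ofReal_sum_of_nonneg,
    tsum_eq_sum (s := hfin.toFinset)]
  · exact Finset.sum_congr rfl fun p' _ => ENNReal.ofReal_mul (R.link_nonneg n _ _)
  · intro p' hp'
    have : R.link n p p' = 0 := by simpa using hp'
    rw [this, ENNReal.ofReal_zero, zero_mul]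
  · exact fun p' _ => mul_nonneg (R.link_nonneg n _ _) (f.2 p')
  · intro p' hp'
    simp only [Set.Finite.coe_toFinset, Function.mem_support] at hp' ⊢
    exact left_ne_zero_of_mul hp'

/-- The transpose of the link maps `w_z γ^β` to a function of the same form, given by the averaged
link. -/
theorem tsum_link_mul (n : ℕ) (w : S.Z (n + 1) → ℝ≥0∞) (p' : R.Vert n) :
    ∑' p : R.Vert (n + 1), ENNReal.ofReal (R.link n p p') *
      (w p.1 * ENNReal.ofReal (R.gpow p.2 β)) =
      (∑' z, w z * ENNReal.ofReal (R.kernel β n z p'.1)) * ENNReal.ofReal (R.gpow p'.2 β) := by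
  rw [ENNReal.tsum_prod (f := fun z γ => ENNReal.ofReal (R.link n (z, γ) p') *
      (w z * ENNReal.ofReal (R.gpow γ β))), ← ENNReal.tsum_mul_right]
  refine tsum_congr fun z => ?_
  rw [mul_assoc, mul_comm (ENNReal.ofReal (R.kernel β n z p'.1)),
    ← R.tsum_link_mul_gpow β n z p'.1 p'.2, ← ENNReal.tsum_mul_left]
  exact tsum_congr fun γ => mul_left_comm _ _ _

variable {R} {c : ∀ n, S.Z n → ℝ≥0}

theorem IsHarmonic.tsum_link_mul_vertexWeight (hc : R.IsHarmonic β c) (n : ℕ) (p' : R.Vert n) :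
    ∑' p, ENNReal.ofReal (R.link n p p') * R.vertexWeight β c (n + 1) p =
      R.vertexWeight β c n p' := by
  rw [vertexWeight, hc.2 n p'.1]
  exact R.tsum_link_mul n (fun z => (c (n + 1) z : ℝ≥0∞)) p'

variable (R β c) in
/-- The weight on the positive cone of the `n`-th level group given by a family `c`. -/
def levelWeight (n : ℕ) : R.levelPos n →+ ℝ≥0∞ where
  toFun f := ∑' p, ENNReal.ofReal (f.1.1 p) * R.vertexWeight β c n p
  map_zero' := by
    refine ENNReal.tsum_eq_zero.2 fun p => ?_
    change ENNReal.ofReal 0 * _ = 0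
    rw [ENNReal.ofReal_zero, zero_mul]
  map_add' f g := by
    rw [← ENNReal.tsum_add]
    refine tsum_congr fun p => ?_
    rw [← add_mul, ← ENNReal.ofReal_add (f.2 p) (g.2 p)]
    rfl

theorem levelWeight_apply (n : ℕ) (f : R.levelPos n) :
    R.levelWeight β c n f = ∑' p, ENNReal.ofReal (f.1.1 p) * R.vertexWeight β c n p := rfl

theorem levelWeight_stepPos (hc : R.IsHarmonic β c) (n : ℕ) (f : R.levelPos n) :
    R.levelWeight β c (n + 1) (R.stepPos n f) = R.levelWeight β c n f := by
  rw [levelWeight_apply, levelWeight_apply]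
  simp only [ofReal_step, ← ENNReal.tsum_mul_right]
  rw [ENNReal.tsum_comm]
  refine tsum_congr fun p' => ?_
  rw [← hc.tsum_link_mul_vertexWeight, ← ENNReal.tsum_mul_left]
  exact tsum_congr fun p => by rw [mul_comm (ENNReal.ofReal (R.link n p p')), mul_assoc]

theorem levelWeight_transPos (hc : R.IsHarmonic β c) (m n : ℕ) (h : m ≤ n) (f : R.levelPos m) :
    R.levelWeight β c n (R.transPos m n h f) = R.levelWeight β c m f := by
  induction n, h using Nat.le_induction with
  | base =>
    congr 1
    refine Subtype.ext ?_
    change R.trans m m _ f.1 = f.1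
    rw [trans_self]
    rfl
  | succ n h ih =>
    have h1 : R.transPos m (n + 1) (h.trans n.le_succ) f = R.stepPos n (R.transPos m n h f) := by
      refine Subtype.ext ?_
      change R.trans m (n + 1) _ f.1 = R.step n (R.trans m n h f.1)
      rw [R.trans_succ m n h]
      rfl
    rw [h1, levelWeight_stepPos hc, ih]

theorem levelWeight_eq (hc : R.IsHarmonic β c) {m n : ℕ} {f : R.levelPos m} {g : R.levelPos n}
    (h : R.toDimPos m f = R.toDimPos n g) : R.levelWeight β c m f = R.levelWeight β c n g := by
  obtain ⟨k, hm, hn, hk⟩ := R.exists_transPos_eq h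
  rw [← levelWeight_transPos hc m k hm, hk, levelWeight_transPos hc n k hn]

/-- The weights of the levels are compatible and define a weight on the limit. -/
theorem exists_weight (hc : R.IsHarmonic β c) :
    ∃ ψ : R.dimPos →+ ℝ≥0∞, ∀ n f, ψ (R.toDimPos n f) = R.levelWeight β c n f := by
  have hval : ∀ x, ∃ v, ∀ n g, R.toDimPos n g = x → R.levelWeight β c n g = v := fun x => by
    obtain ⟨m, f, rfl⟩ := R.exists_toDimPos x
    exact ⟨_, fun n g hg => levelWeight_eq hc hg⟩
  choose φ hφ using hval
  have hadd : ∀ m n (g : R.levelPos m) (h : R.levelPos n),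
      φ (R.toDimPos m g + R.toDimPos n h) = φ (R.toDimPos m g) + φ (R.toDimPos n h) := by
    intro m n g h
    rw [← toDimPos_transPos R m (max m n) (le_max_left m n) g,
      ← toDimPos_transPos R n (max m n) (le_max_right m n) h, ← map_add,
      ← hφ _ _ _ rfl, ← hφ _ _ _ rfl, ← hφ _ _ _ rfl, map_add]
  refine ⟨{ toFun := φ, map_zero' := ?_, map_add' := fun x y => ?_ }, fun n g => (hφ _ n g rfl).symm⟩
  · rw [← hφ 0 0 0 (map_zero _), map_zero]
  · obtain ⟨m, g, rfl⟩ := R.exists_toDimPos x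
    obtain ⟨n, h, rfl⟩ := R.exists_toDimPos y
    exact hadd m n g h

theorem dirac_apply_self (n : ℕ) (p : R.Vert n) : (R.dirac n p).1.1 p = 1 := by
  classical
  exact Pi.single_eq_same p 1

theorem dirac_apply_ne (n : ℕ) {p p' : R.Vert n} (h : p' ≠ p) : (R.dirac n p).1.1 p' = 0 := by
  classical
  exact Pi.single_eq_of_ne h 1

theorem levelWeight_dirac (n : ℕ) (p : R.Vert n) :
    R.levelWeight β c n (R.dirac n p) = R.vertexWeight β c n p := by
  rw [levelWeight_apply, tsum_eq_single p fun p' hp' => by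
    rw [dirac_apply_ne n hp', ENNReal.ofReal_zero, zero_mul], dirac_apply_self, ENNReal.ofReal_one,
    one_mul]

theorem levelPos_ext {n : ℕ} {f g : R.levelPos n} (h : ∀ p, f.1.1 p = g.1.1 p) : f = g :=
  Subtype.ext (Subtype.ext (funext h))

/-- The action of `γ` on the positive cone of a level. -/
def levelPosAct (γ : R.Gam) (n : ℕ) (f : R.levelPos n) : R.levelPos n :=
  ⟨R.levelAct γ n f.1, fun p => f.2 (p.1, γ⁻¹ * p.2)⟩

theorem dimPosAct_toDimPos (γ : R.Gam) (n : ℕ) (f : R.levelPos n) :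
    R.dimPosAct γ (R.toDimPos n f) = R.toDimPos n (levelPosAct γ n f) :=
  Subtype.ext (R.dimAct_toDim γ n f.1)

theorem levelWeight_levelPosAct (γ : R.Gam) (n : ℕ) (f : R.levelPos n) :
    R.levelWeight β c n (levelPosAct γ n f) =
      ENNReal.ofReal (R.gpow γ β) * R.levelWeight β c n f := by
  rw [levelWeight_apply, levelWeight_apply, ← ENNReal.tsum_mul_left,
    ← ((Equiv.refl (S.Z n)).prodCongr (Equiv.mulLeft γ)).tsum_eq]
  refine tsum_congr fun p => ?_
  change ENNReal.ofReal (f.1.1 (p.1, γ⁻¹ * (γ * p.2))) *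
    ((c n p.1 : ℝ≥0∞) * ENNReal.ofReal (R.gpow (γ * p.2) β)) = _
  rw [inv_mul_cancel_left, gpow_mul, ENNReal.ofReal_mul (R.gpow_pos β γ).le, vertexWeight]
  ring

/-- Monotone convergence, for the counting measure. -/
theorem tendsto_levelWeight (n : ℕ) {f : ℕ → R.levelPos n} {g : R.levelPos n}
    (hmono : ∀ p, Monotone fun k => (f k).1.1 p)
    (hlim : ∀ p, Tendsto (fun k => (f k).1.1 p) atTop (𝓝 (g.1.1 p))) :
    Tendsto (fun k => R.levelWeight β c n (f k)) atTop (𝓝 (R.levelWeight β c n g)) := by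
  let _ : MeasurableSpace (R.Vert n) := ⊤
  have : MeasurableSingletonClass (R.Vert n) := ⟨fun _ => trivial⟩
  simp only [levelWeight_apply, ← MeasureTheory.lintegral_count]
  refine MeasureTheory.lintegral_tendsto_of_tendsto_of_monotone
    (fun k => Measurable.aemeasurable fun _ _ => trivial) (MeasureTheory.ae_of_all _ fun p k l hkl => ?_)
    (MeasureTheory.ae_of_all _ fun p => ?_)
  · exact mul_le_mul_left (ENNReal.ofReal_le_ofReal (hmono p hkl)) _
  · refine ENNReal.Tendsto.mul_const ((ENNReal.continuous_ofReal.tendsto _).comp (hlim p))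
      (Or.inr ?_)
    exact ENNReal.mul_ne_top ENNReal.coe_ne_top ENNReal.ofReal_ne_top

/-- `ψ` is given on the Dirac functions by the family `c`. -/
def Weighs (β : ℝ) (c : ∀ n, S.Z n → ℝ≥0) (ψ : R.dimPos →+ ℝ≥0∞) : Prop :=
  ∀ n p, ψ (R.toDimPos n (R.dirac n p)) = R.vertexWeight β c n p

/-- Every harmonic family comes from an element of `lnWeights`. -/
theorem exists_weight_of_harmonic (hc : R.IsHarmonic β c) :
    ∃ ψ ∈ R.lnWeights β, Weighs β c ψ := by
  obtain ⟨ψ, hψ⟩ := exists_weight hc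
  refine ⟨ψ, ⟨fun γ x => ?_, fun n f g hmono hlim => ⟨fun k l hkl => ?_, ?_⟩, ?_⟩, fun n p => ?_⟩
  · obtain ⟨n, f, rfl⟩ := R.exists_toDimPos x
    rw [dimPosAct_toDimPos, hψ, hψ, levelWeight_levelPosAct]
  · simp only [hψ, levelWeight_apply]
    exact ENNReal.tsum_le_tsum fun p =>
      mul_le_mul_left (ENNReal.ofReal_le_ofReal (hmono p hkl)) _
  · simp only [hψ]
    exact tendsto_levelWeight n hmono hlim
  · rw [hψ, levelWeight_dirac, vertexWeight, hc.1, gpow_one]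
    simp
  · rw [hψ, levelWeight_dirac]

open scoped Classical in
/-- The restriction of a function in the positive cone of a level to a set of vertices. -/
def levelRestrict (n : ℕ) (f : R.levelPos n) (E : Finset (R.Vert n)) : R.levelPos n :=
  ⟨⟨fun p => if p ∈ E then f.1.1 p else 0, fun p => by
      change ∃ k : ℤ, (if p ∈ E then f.1.1 p else 0) = k / (S.dim n p.1 : ℕ)
      split_ifs
      · exact f.1.2.1 p
      · exact ⟨0, by simp⟩,
    f.1.2.2.imp fun C hC p => by
      change |if p ∈ E then f.1.1 p else 0| ≤ C
      split_ifs
      · exact hC p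
      · rw [abs_zero]; exact (abs_nonneg _).trans (hC p)⟩,
    fun p => by
      change 0 ≤ if p ∈ E then f.1.1 p else 0
      split_ifs
      · exact f.2 p
      · exact le_rfl⟩

open scoped Classical in
theorem levelRestrict_apply (n : ℕ) (f : R.levelPos n) (E : Finset (R.Vert n)) (p : R.Vert n) :
    (levelRestrict n f E).1.1 p = if p ∈ E then f.1.1 p else 0 := rfl

theorem levelRestrict_singleton (n : ℕ) (f : R.levelPos n) (p : R.Vert n)
    (φ : R.levelPos n →+ ℝ≥0∞) :
    φ (levelRestrict n f {p}) = ENNReal.ofReal (f.1.1 p) * φ (R.dirac n p) := by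
  classical
  obtain ⟨k, hk⟩ := f.1.2.1 p
  have hd := dim_pos n p.1
  have hk0 : 0 ≤ k := by
    have h0 : 0 ≤ f.1.1 p := f.2 p
    rw [hk, div_nonneg_iff] at h0
    rcases h0 with h0 | h0
    · exact_mod_cast h0.1
    · exact absurd h0.2 (not_le.2 hd)
  obtain ⟨k, rfl⟩ := Int.eq_ofNat_of_zero_le hk0
  -- `dim(z)` times the restriction is an integer multiple of the Dirac function
  have h1 : (S.dim n p.1 : ℕ) • levelRestrict n f {p} = k • R.dirac n p := by
    refine levelPos_ext fun p' => ?_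
    change ((S.dim n p.1 : ℕ) • fun p' => (levelRestrict n f {p}).1.1 p') p' =
      (k • fun p' => (R.dirac n p).1.1 p') p'
    rw [Pi.smul_apply, Pi.smul_apply, levelRestrict_apply]
    by_cases h : p' = p
    · subst h
      rw [if_pos (Finset.mem_singleton_self _), dirac_apply_self, hk, nsmul_eq_mul, nsmul_eq_mul]
      push_cast
      field_simp
    · rw [if_neg (by simpa using h), dirac_apply_ne n h, smul_zero, smul_zero]
  have h2 := congrArg φ h1
  rw [map_nsmul, map_nsmul, nsmul_eq_mul, nsmul_eq_mul] at h2
  have hd0 : ((S.dim n p.1 : ℕ) : ℝ≥0∞) ≠ 0 := by exact_mod_cast (S.dim n p.1).ne_zero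
  rw [hk, Int.cast_natCast, ENNReal.ofReal_div_of_pos hd, ENNReal.ofReal_natCast,
    ENNReal.ofReal_natCast, div_eq_mul_inv, mul_right_comm, ← h2, mul_right_comm,
    ENNReal.mul_inv_cancel hd0 (ENNReal.natCast_ne_top _), one_mul]

theorem map_levelRestrict (n : ℕ) (f : R.levelPos n) (E : Finset (R.Vert n))
    (φ : R.levelPos n →+ ℝ≥0∞) :
    φ (levelRestrict n f E) = ∑ p ∈ E, ENNReal.ofReal (f.1.1 p) * φ (R.dirac n p) := by
  classical
  induction E using Finset.induction_on with
  | empty =>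
    have : levelRestrict n f ∅ = 0 := levelPos_ext fun p => by
      rw [levelRestrict_apply, if_neg (Finset.notMem_empty p)]; rfl
    rw [this, map_zero, Finset.sum_empty]
  | insert p E hp ih =>
    have : levelRestrict n f (insert p E) = levelRestrict n f {p} + levelRestrict n f E :=
      levelPos_ext fun p' => by
        change _ = (levelRestrict n f {p}).1.1 p' + (levelRestrict n f E).1.1 p'
        simp only [levelRestrict_apply, Finset.mem_insert, Finset.mem_singleton]
        by_cases h : p' = p
        · subst h; simp [hp]
        · simp [h]
    rw [this, map_add, ih, levelRestrict_singleton, Finset.sum_insert hp]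

/-- By normality, an element of `lnWeights` is determined by its values at the Dirac functions: the
vertices being countable, every function is an increasing limit of finitely supported ones. -/
theorem apply_toDimPos {ψ : R.dimPos →+ ℝ≥0∞} (hψ : ψ ∈ R.lnWeights β) (n : ℕ)
    (f : R.levelPos n) : ψ (R.toDimPos n f) =
      ∑' p, ENNReal.ofReal (f.1.1 p) * ψ (R.toDimPos n (R.dirac n p)) := by
  classical
  let _ := Encodable.ofCountable (R.Vert n)
  have hfin : ∀ k, {p : R.Vert n | Encodable.encode p < k}.Finite := fun k =>
    Set.Finite.of_injOn (f := Encodable.encode) (t := Set.Iio k) (fun p hp => hp)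
      Encodable.encode_injective.injOn (Set.finite_Iio k)
  let E : ℕ → Finset (R.Vert n) := fun k => (hfin k).toFinset
  have hE : ∀ k p, p ∈ E k ↔ Encodable.encode p < k := fun k p => by simp [E]
  have hEmono : Monotone E := fun k l hkl p hp => (hE l p).2 (((hE k p).1 hp).trans_le hkl)
  have hElim : Tendsto E atTop atTop := by
    refine tendsto_atTop_finset_of_monotone hEmono fun p => ⟨Encodable.encode p + 1, ?_⟩
    exact (hE _ p).2 (Nat.lt_succ_self _)
  have h1 := (hψ.2.1 n (fun k => levelRestrict n f (E k)) f (fun p k l hkl => by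
    simp only [levelRestrict_apply]
    by_cases h : p ∈ E k
    · rw [if_pos h, if_pos (hEmono hkl h)]
    · rw [if_neg h]
      split_ifs
      · exact f.2 p
      · exact le_rfl) (fun p => by
    refine tendsto_const_nhds.congr' ?_
    filter_upwards [eventually_ge_atTop (Encodable.encode p + 1)] with k hk
    rw [levelRestrict_apply, if_pos ((hE k p).2 hk)])).2
  have h2 : ∀ k, ψ (R.toDimPos n (levelRestrict n f (E k))) =
      ∑ p ∈ E k, ENNReal.ofReal (f.1.1 p) * ψ (R.toDimPos n (R.dirac n p)) := fun k =>
    map_levelRestrict n f (E k) (ψ.comp (R.toDimPos n))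
  simp only [h2] at h1
  exact tendsto_nhds_unique h1 (ENNReal.summable.hasSum.comp hElim)

theorem Weighs.weight_unique {ψ ψ' : R.dimPos →+ ℝ≥0∞} (h : Weighs β c ψ) (h' : Weighs β c ψ')
    (hψ : ψ ∈ R.lnWeights β) (hψ' : ψ' ∈ R.lnWeights β) : ψ = ψ' := by
  ext x
  obtain ⟨n, f, rfl⟩ := R.exists_toDimPos x
  rw [apply_toDimPos hψ, apply_toDimPos hψ']
  simp only [h n, h' n]

theorem Weighs.coe_eq {ψ : R.dimPos →+ ℝ≥0∞} (h : Weighs β c ψ) (n : ℕ) (z : S.Z n) :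
    (c n z : ℝ≥0∞) = ψ (R.toDimPos n (R.dirac n (z, 1))) := by
  rw [h n, vertexWeight, gpow_one, ENNReal.ofReal_one, mul_one]

theorem Weighs.family_unique {c' : ∀ n, S.Z n → ℝ≥0} {ψ : R.dimPos →+ ℝ≥0∞}
    (h : Weighs β c ψ) (h' : Weighs β c' ψ) : c = c' := by
  funext n z
  rw [← ENNReal.coe_inj, h.coe_eq, h'.coe_eq]

/-- The values at `δ_(z,γ)` follow from those at `δ_(z,1)` by the scaling property. -/
theorem apply_dirac {ψ : R.dimPos →+ ℝ≥0∞} (hψ : ψ ∈ R.lnWeights β) (n : ℕ) (p : R.Vert n) :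
    ψ (R.toDimPos n (R.dirac n p)) =
      ψ (R.toDimPos n (R.dirac n (p.1, 1))) * ENNReal.ofReal (R.gpow p.2 β) := by
  have h1 : levelPosAct p.2 n (R.dirac n (p.1, 1)) = R.dirac n p := levelPos_ext fun p' => by
    change (R.dirac n (p.1, 1)).1.1 (p'.1, p.2⁻¹ * p'.2) = _
    by_cases h : p' = p
    · subst h
      rw [inv_mul_cancel, dirac_apply_self, dirac_apply_self]
    · rw [dirac_apply_ne n h, dirac_apply_ne]
      intro h'
      rw [Prod.mk.injEq, inv_mul_eq_one] at h'
      exact h (Prod.ext h'.1 h'.2.symm)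
  rw [← h1, ← dimPosAct_toDimPos, hψ.1, mul_comm]

/-- Every element of `lnWeights` comes from a harmonic family. -/
theorem exists_harmonic_of_weight {ψ : R.dimPos →+ ℝ≥0∞} (hψ : ψ ∈ R.lnWeights β) :
    ∃ c, R.IsHarmonic β c ∧ Weighs β c ψ := by
  let w : ∀ n, S.Z n → ℝ≥0∞ := fun n z => ψ (R.toDimPos n (R.dirac n (z, 1)))
  have hw : ∀ n (p : R.Vert n), ψ (R.toDimPos n (R.dirac n p)) =
      w n p.1 * ENNReal.ofReal (R.gpow p.2 β) := fun n p => apply_dirac hψ n p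
  have hharm : ∀ n z', w n z' = ∑' z, w (n + 1) z * ENNReal.ofReal (R.kernel β n z z') := by
    intro n z'
    have h1 : ∀ p, (R.stepPos n (R.dirac n (z', 1))).1.1 p = R.link n p (z', 1) := by
      intro p
      change ∑ᶠ p', R.link n p p' * (R.dirac n (z', 1)).1.1 p' = _
      rw [finsum_eq_single _ ((z', 1) : R.Vert n) fun p' hp' => by
        rw [dirac_apply_ne n hp', mul_zero], dirac_apply_self, mul_one]
    change ψ (R.toDimPos n (R.dirac n (z', 1))) = _
    rw [← R.toDimPos_stepPos, apply_toDimPos hψ]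
    simp only [h1, hw]
    rw [R.tsum_link_mul n (w (n + 1)), gpow_one, ENNReal.ofReal_one, mul_one]
  have hroot : w 0 S.root = 1 := hψ.2.2
  -- the value at the root is finite, and every `z` has a predecessor `z'`, whose finite value
  -- dominates a positive multiple of the value at `z`
  have hfin : ∀ n z, w n z ≠ ⊤ := by
    intro n
    induction n with
    | zero =>
      intro z
      rw [S.eq_root z, hroot]
      exact ENNReal.one_ne_top
    | succ n ih =>
      intro z
      obtain ⟨z', hz'⟩ := R.exists_kernel_pos β n z
      have h1 : w (n + 1) z * ENNReal.ofReal (R.kernel β n z z') ≠ ⊤ :=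
        ((ENNReal.le_tsum z).trans_lt (by rw [← hharm]; exact (ih z').lt_top)).ne
      intro h2
      rw [h2, ENNReal.top_mul (ENNReal.ofReal_pos.2 hz').ne'] at h1
      exact h1 rfl
  have hcoe : ∀ n z, ((w n z).toNNReal : ℝ≥0∞) = w n z := fun n z => ENNReal.coe_toNNReal (hfin n z)
  refine ⟨fun n z => (w n z).toNNReal, ⟨?_, fun n z' => ?_⟩, fun n p => ?_⟩
  · change (w 0 S.root).toNNReal = 1
    rw [hroot, ENNReal.toNNReal_one]
  · simp only [hcoe]
    exact hharm n z'
  · rw [hw, vertexWeight, hcoe]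

end Density

/-! ### Convexity and the correspondence -/

variable {S : AtomicSequence.{u}} {A : Type v} [CStarAlgebra A] {L : CStarLimit S A}
variable {α : InductiveFlow L} {R : Density α} {β : ℝ} {c c₀ c₁ : ∀ n, S.Z n → ℝ≥0} {s t : ℝ≥0}

open Density

theorem Density.IsHarmonic.smul_add_smul (h₀ : R.IsHarmonic β c₀) (h₁ : R.IsHarmonic β c₁)
    (hst : s + t = 1) : R.IsHarmonic β fun n z => s * c₀ n z + t * c₁ n z := by
  refine ⟨?_, fun n z' => ?_⟩
  · change s * c₀ 0 S.root + t * c₁ 0 S.root = 1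
    rw [h₀.1, h₁.1, mul_one, mul_one, hst]
  · simp only [ENNReal.coe_add, ENNReal.coe_mul, add_mul, mul_assoc]
    rw [ENNReal.tsum_add, ENNReal.tsum_mul_left, ENNReal.tsum_mul_left, ← h₀.2, ← h₁.2]

theorem Represents.smul_add_smul {ω₀ ω₁ : A →ₗ[ℂ] ℂ} (h₀ : Represents R β c₀ ω₀)
    (h₁ : Represents R β c₁ ω₁) :
    Represents R β (fun n z => s * c₀ n z + t * c₁ n z) (s • ω₀ + t • ω₁) := by
  intro n a
  have h := ((h₀ n a).mul_left ((s : ℝ) : ℂ)).add ((h₁ n a).mul_left ((t : ℝ) : ℂ))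
  refine (congrArg (HasSum · _) (funext fun z => ?_)).mp h
  push_cast
  ring

theorem IsPositiveFunctional.smul_add_smul {ω₀ ω₁ : A →ₗ[ℂ] ℂ} (h₀ : IsPositiveFunctional ω₀)
    (h₁ : IsPositiveFunctional ω₁) : IsPositiveFunctional (s • ω₀ + t • ω₁) := by
  intro a
  have hs : (0 : ℂ) ≤ ((s : ℝ) : ℂ) := by exact_mod_cast s.2
  have ht : (0 : ℂ) ≤ ((t : ℝ) : ℂ) := by exact_mod_cast t.2
  exact starLE_complex_iff.2 (add_nonneg (mul_nonneg hs (starLE_complex_iff.1 (h₀ a)))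
    (mul_nonneg ht (starLE_complex_iff.1 (h₁ a))))

/-- A convex combination of states is represented by the corresponding combination of families, which
is harmonic and thus represents a locally normal KMS state. -/
theorem convex_lnKMSStates (R : Density α) (β : ℝ) : Convex ℝ≥0 (lnKMSStates α β) := by
  intro ω₀ h₀ ω₁ h₁ s t _ _ hst
  obtain ⟨c₀, hc₀, hr₀⟩ := exists_harmonic_of_state R h₀
  obtain ⟨c₁, hc₁, hr₁⟩ := exists_harmonic_of_state R h₁
  obtain ⟨ω, hω, hr⟩ := exists_state_of_harmonic (hc₀.smul_add_smul hc₁ hst)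
  rwa [(hr₀.smul_add_smul hr₁).state_unique hr (h₀.1.1.smul_add_smul h₁.1.1) hω.1.1]

theorem Density.Weighs.smul_add_smul {ψ₀ ψ₁ : R.dimPos →+ ℝ≥0∞} (h₀ : Weighs β c₀ ψ₀)
    (h₁ : Weighs β c₁ ψ₁) :
    Weighs β (fun n z => s * c₀ n z + t * c₁ n z) (s • ψ₀ + t • ψ₁) := by
  intro n p
  change (s : ℝ≥0∞) * ψ₀ _ + (t : ℝ≥0∞) * ψ₁ _ = _
  rw [h₀ n p, h₁ n p]
  simp only [vertexWeight, ENNReal.coe_add, ENNReal.coe_mul]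
  ring

theorem convex_lnWeights (R : Density α) (β : ℝ) : Convex ℝ≥0 (R.lnWeights β) := by
  intro ψ₀ h₀ ψ₁ h₁ s t _ _ hst
  have happ : ∀ x, (s • ψ₀ + t • ψ₁) x = (s : ℝ≥0∞) * ψ₀ x + (t : ℝ≥0∞) * ψ₁ x := fun _ => rfl
  refine ⟨fun γ x => ?_, fun n f g hmono hlim => ?_, ?_⟩
  · rw [happ, happ, h₀.1, h₁.1]
    ring
  · obtain ⟨hm₀, hl₀⟩ := h₀.2.1 n f g hmono hlim
    obtain ⟨hm₁, hl₁⟩ := h₁.2.1 n f g hmono hlim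
    simp only [happ]
    exact ⟨fun k l hkl => add_le_add (mul_le_mul_right (hm₀ hkl) _) (mul_le_mul_right (hm₁ hkl) _),
      (ENNReal.Tendsto.const_mul hl₀ (Or.inr ENNReal.coe_ne_top)).add
        (ENNReal.Tendsto.const_mul hl₁ (Or.inr ENNReal.coe_ne_top))⟩
  · rw [happ, h₀.2.2, h₁.2.2, mul_one, mul_one, ← ENNReal.coe_add, hst, ENNReal.coe_one]

variable (R β) in
/-- The correspondence between states and weights: both come from the same harmonic family. -/
theorem exists_equiv : ∃ Ψ : lnKMSStates α β ≃ R.lnWeights β,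
    ∀ ω, ∃ c, Represents R β c ω.1 ∧ Weighs β c (Ψ ω).1 := by
  choose cω hω hωr using fun ω : lnKMSStates α β => exists_harmonic_of_state R ω.2
  choose cψ hψ hψr using fun ψ : R.lnWeights β => exists_harmonic_of_weight ψ.2
  choose Ω hΩ hΩr using fun ψ : R.lnWeights β => exists_state_of_harmonic (hψ ψ)
  choose W hW hWr using fun ω : lnKMSStates α β => exists_weight_of_harmonic (hω ω)
  refine ⟨⟨fun ω => ⟨W ω, hW ω⟩, fun ψ => ⟨Ω ψ, hΩ ψ⟩, fun ω => ?_, fun ψ => ?_⟩,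
    fun ω => ⟨cω ω, hωr ω, hWr ω⟩⟩
  · have h := (hψr ⟨W ω, hW ω⟩).family_unique (hWr ω)
    exact Subtype.ext (Represents.state_unique (hΩr _) (h ▸ hωr ω) (hΩ _).1.1 ω.2.1.1)
  · have h := (hωr ⟨Ω ψ, hΩ ψ⟩).family_unique (hΩr ψ)
    exact Subtype.ext (Weighs.weight_unique (hWr _) (h ▸ hψr ψ) (hW _) ψ.2)

end LimitFlow

end

theorem theorem5p5 {S : LimitFlow.AtomicSequence.{u}} {A : Type v} [CStarAlgebra A]
    {L : LimitFlow.CStarLimit S A} (α : LimitFlow.InductiveFlow L) (R : LimitFlow.Density α)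
    (β : ℝ) :
    Convex ℝ≥0 (LimitFlow.lnKMSStates α β) ∧ Convex ℝ≥0 (R.lnWeights β) ∧
    ∃ Ψ : LimitFlow.lnKMSStates α β ≃ R.lnWeights β,
      -- `ψ_ω` is the unique element with the prescribed values at the Dirac functions
      (∀ (ω : LimitFlow.lnKMSStates α β) (ψ : R.lnWeights β), Ψ ω = ψ ↔
        ∀ (n : ℕ) (z : S.Z n) (γ : R.Gam),
          ψ.1 (R.toDimPos n (R.dirac n (z, γ))) =
            ENNReal.ofReal ((S.dim n z : ℕ) / R.dimBeta β n z *
              (ω.1 (L.incl n (S.centralProj n z))).re * R.gpow γ β)) ∧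
      -- `ω ↦ ψ_ω` is affine
      (∀ (ω₀ ω₁ ω : LimitFlow.lnKMSStates α β) (s t : ℝ≥0), s + t = 1 →
        ω.1 = s • ω₀.1 + t • ω₁.1 → (Ψ ω).1 = s • (Ψ ω₀).1 + t • (Ψ ω₁).1) ∧
      -- the inverse `ψ ↦ ω_ψ`, and the uniqueness of `ω_ψ`
      (∀ (ψ : R.lnWeights β) (ω : LimitFlow.lnKMSStates α β), Ψ.symm ψ = ω ↔
        ∀ (n : ℕ) (a : S.Alg n),
          HasSum (fun z : S.Z n =>
            ((ψ.1 (R.toDimPos n (R.dirac n (z, 1)))).toReal : ℂ) *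
              ((LimitFlow.realPow (R.herm n z) (-β) * a z).trace / (S.dim n z : ℕ)))
            (ω.1 (L.incl n a))) := by
  obtain ⟨Ψ, hΨ⟩ := LimitFlow.exists_equiv R β
  refine ⟨LimitFlow.convex_lnKMSStates R β, LimitFlow.convex_lnWeights R β, Ψ, fun ω ψ => ?_,
    fun ω₀ ω₁ ω s t hst hω => ?_, fun ψ ω => ?_⟩
  · obtain ⟨c, hr, hw⟩ := hΨ ω
    have hval : ∀ (n : ℕ) (p : R.Vert n), ENNReal.ofReal ((S.dim n p.1 : ℕ) / R.dimBeta β n p.1 *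
        (ω.1 (L.incl n (S.centralProj n p.1))).re * R.gpow p.2 β) = R.vertexWeight β c n p := by
      intro n p
      rw [← hr.coe_eq, ENNReal.ofReal_mul NNReal.zero_le_coe, ENNReal.ofReal_coe_nnreal]
      rfl
    constructor
    · rintro rfl n z γ
      rw [hw n (z, γ), ← hval]
    · intro h
      refine Subtype.ext (hw.weight_unique (fun n p => ?_) (Ψ ω).2 ψ.2)
      rw [← hval]
      exact h n p.1 p.2
  · obtain ⟨c₀, hr₀, hw₀⟩ := hΨ ω₀
    obtain ⟨c₁, hr₁, hw₁⟩ := hΨ ω₁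
    obtain ⟨c, hr, hw⟩ := hΨ ω
    have hc := hr.family_unique (hω ▸ hr₀.smul_add_smul hr₁)
    exact hw.weight_unique (hc ▸ hw₀.smul_add_smul hw₁)
      (Ψ ω).2 (LimitFlow.convex_lnWeights R β (Ψ ω₀).2 (Ψ ω₁).2 zero_le zero_le hst)
  · obtain ⟨c, hr, hw⟩ := hΨ (Ψ.symm ψ)
    rw [Ψ.apply_symm_apply] at hw
    have hval : ∀ n z, (ψ.1 (R.toDimPos n (R.dirac n (z, 1)))).toReal = c n z := fun n z => by
      rw [← hw.coe_eq]
      rfl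
    simp only [hval]
    constructor
    · rintro rfl
      exact hr
    · intro h
      exact Subtype.ext (LimitFlow.Represents.state_unique hr h (Ψ.symm ψ).2.1.1 ω.2.1.1)
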